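/- Let $B_r\subset\mathbb R^2$ be the open disk of radius $r$ centered at the origin. For $\alpha>0$ let $\Omega=\Omega_{\rm out}\setminus\overline{B_\alpha}$ be a bounded Lipschitz domain, where $\Omega_{\rm out}$ is open and $\overline{B_\alpha}\subset\Omega_{\rm out}$. For $h\in\mathbb R\cup\{+\infty\}$ let $\tau_1(\Omega)<\tau_2(\Omega)\le\tau_3(\Omega)\le\dots$ be the eigenvalues, counted with multiplicity, of $$-\Delta u=\tau u\ \text{ in }\Omega,\qquad \frac{\partial u}{\partial\eta}+hu=0\ \text{ on }\partial B_\alpha,\qquad \frac{\partial u}{\partial\eta}=0\ \text{ on }\partial\Omega_{\rm out},$$ where $\eta$ is the outward unit normal to $\partial\Omega$ and $h=+\infty$ means $u=0$ on $\partial B_\alpha$; that is, $$\tau_k(\Omega)=\min_{X}\ \max_{u\in X\setminus\{0\}}\frac{\int_\Omega|\nabla u|^2\,dx+h\int_{\partial B_\alpha}u^2\,dS}{\int_\Omega u^2\,dx},\qquad k\ge 1,$$ where $X$ runs over the $k$-dimensional subspaces of $H^1(\Omega)$ if $h<+\infty$, and of $\{u\in H^1(\Omega): u=0 \text{ on }\partial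 B_\alpha \text{ in the sense of traces}\}$ if $h=+\infty$, the boundary term being omitted in the latter case. We say that $\Omega$ is symmetric of order $q\in\mathbb N$ if the rotation about the origin by the angle $2\pi/q$ maps $\Omega$ onto itself. **Theorem.** Let $\beta>0$. There are numbers $\alpha_\kappa\in(0,\beta)$, $\kappa=1,2,\dots$, depending only on $\beta$ and $\kappa$, such that the following holds. (a) For every integer $\kappa\ge1$ and every $\alpha\in(0,\beta)$ there is $\bar h_\kappa\in\mathbb R\cup\{+\infty\}$, with $\bar h_\kappa=+\infty$ whenever $\alpha\in[\alpha_\kappa,\beta)$, such that for every $h\in\mathbb R\cup\{+\infty\}$ with $h\le\bar h_\kappa$ and every $\Omega=\Omega_{\rm out}\setminus\overline{B_\alpha}$ as above that is symmetric of order $2^\kappa$ and satisfies $|\Omega|=|B_\beta\setminus\overline{B_\alpha}|$, $$\tau_i(\Omega)\le\tau_i(B_\beta\setminus\overline{B_\alpha})\qquad\text{for } i=2,3,\dots,2^\kappa.\tag{1}$$ (b) For every $\alpha\in(0,\alpha_2)$ there is $h_2<0$ such that, for every $h\in[h_2,+\infty]$ and every $\Omega=\Omega_{\rm out}\setminus\overline{B_\alpha}$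 as above that is symmetric of order $2^\kappa$ and satisfies $|\Omega|=|B_\beta\setminus\overline{B_\alpha}|$: (i) if $\kappa\in\{1,2\}$, then (1) holds; (ii) if $\kappa=3$, then the inequality in (1) holds for $i=2,3,4,5$. Moreover, in all these cases and for each of the indices $i$ concerned, equality $\tau_i(\Omega)=\tau_i(B_\beta\setminus\overline{B_\alpha})$ holds if and only if $\Omega=B_\beta\setminus\overline{B_\alpha}$. -/

import Mathlib

open Set MeasureTheory
open scoped ContDiff ENNReal NNReal Topology

noncomputable section

/-- The Euclidean plane. -/
abbrev Plane : Type := EuclideanSpace ℝ (Fin 2)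

/-! ### Geometry -/

/-- The open concentric shell `B_β \ closure B_α`. -/
def shell (α β : ℝ) : Set Plane := Metric.ball 0 β \ Metric.closedBall 0 α

/-- The anticlockwise rotation of the plane by the angle `t` about the origin. -/
def rotate (t : ℝ) (x : Plane) : Plane :=
  !₂[Real.cos t * x 0 - Real.sin t * x 1, Real.sin t * x 0 + Real.cos t * x 1]

/-- A planar set is symmetric of order `q` if the rotation by `2π/q` maps it onto itself. -/
def SymmetricOfOrder (q : ℕ) (Ω : Set Plane) : Prop :=
  rotate (2 * Real.pi / q) '' Ω = Ω

/-- `Ω` has a Lipschitz boundary: near each boundary point, and in suitable Cartesian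
coordinates, `Ω` is the region above the graph of a Lipschitz function. -/
def HasLipschitzBoundary (Ω : Set Plane) : Prop :=
  ∀ p ∈ frontier Ω, ∃ U ∈ 𝓝 p, ∃ (A : Plane ≃ᵃⁱ[ℝ] Plane) (L : ℝ≥0) (f : ℝ → ℝ),
    LipschitzWith L f ∧ ∀ x ∈ U, x ∈ Ω ↔ f ((A x) 0) < (A x) 1

/-- A bounded Lipschitz domain: bounded, open, connected, with Lipschitz boundary. -/
structure IsBoundedLipschitzDomain (Ω : Set Plane) : Prop where
  isOpen : IsOpen Ω
  isConnected : IsConnected Ω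
  isBounded : Bornology.IsBounded Ω
  lipschitz : HasLipschitzBoundary Ω

/-- The standing assumption on the domain `Ωout \ closure B_α`. -/
structure AssumptionA (α : ℝ) (Ωout : Set Plane) : Prop where
  isOpen_out : IsOpen Ωout
  ball_subset : Metric.closedBall 0 α ⊆ Ωout
  domain : IsBoundedLipschitzDomain (Ωout \ Metric.closedBall 0 α)

/-! ### Sobolev space, trace on the inner circle -/

/-- Arc length on the circle `∂B_α`: the image of `α dθ` under `θ ↦ (α cos θ, α sin θ)`. -/
def circleMeasure (α : ℝ) : Measure Plane :=
  ENNReal.ofReal α • (volume.restrict (Ioc (-Real.pi) Real.pi)).map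
    (fun θ : ℝ => (!₂[α * Real.cos θ, α * Real.sin θ] : Plane))

/-- `g` is the weak gradient of `u` on `Ω`. -/
def IsWeakGradient (Ω : Set Plane) (u : Plane → ℝ) (g : Plane → Plane) : Prop :=
  ∀ φ : Plane → ℝ, ContDiff ℝ ∞ φ → HasCompactSupport φ → tsupport φ ⊆ Ω →
    ∫ x in Ω, u x • gradient φ x = - ∫ x in Ω, φ x • g x

/-- The space `L²(Ω) × L²(Ω; ℝ²) × L²(∂B_α)`, in which a function is recorded
together with its gradient in `Ω` and its boundary values on `∂B_α`. -/
abbrev DataSpace (α : ℝ) (Ω : Set Plane) : Type :=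
  Lp ℝ 2 (volume.restrict Ω) × Lp Plane 2 (volume.restrict Ω) × Lp ℝ 2 (circleMeasure α)

/-- The triples `(φ|_Ω, ∇φ|_Ω, φ|_{∂B_α})` of the functions `φ ∈ C_c^∞(ℝ²)`, whose restrictions
to a bounded `Ω` are those of all functions in `C^∞(ℝ²)`. -/
def smoothData (α : ℝ) (Ω : Set Plane) : Set (DataSpace α Ω) :=
  {p | ∃ φ : Plane → ℝ, ContDiff ℝ ∞ φ ∧ HasCompactSupport φ ∧
    p.1 =ᵐ[volume.restrict Ω] φ ∧
    p.2.1 =ᵐ[volume.restrict Ω] gradient φ ∧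
    p.2.2 =ᵐ[circleMeasure α] φ}

/-- `t ∈ L²(∂B_α)` is the trace of `u ∈ H¹(Ω)` with gradient `g`: the trace operator is the
extension by continuity, in the norm of `H¹(Ω)`, of the restriction of smooth functions. -/
def IsTrace (α : ℝ) (Ω : Set Plane) (u : Lp ℝ 2 (volume.restrict Ω))
    (g : Lp Plane 2 (volume.restrict Ω)) (t : Lp ℝ 2 (circleMeasure α)) : Prop :=
  (u, g, t) ∈ closure (smoothData α Ω)

/-- The form domain: all of `H¹(Ω)` if `h < +∞`, and the functions in `H¹(Ω)` with zero trace on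
`∂B_α` if `h = +∞`. An element `u` is recorded as the triple `(u, ∇u, tr u)`; its gradient and
its trace are determined by `u`. -/
def formDomain (h : WithTop ℝ) (α : ℝ) (Ω : Set Plane) : Set (DataSpace α Ω) :=
  {p | IsWeakGradient Ω p.1 p.2.1 ∧ IsTrace α Ω p.1 p.2.1 p.2.2 ∧ (h = ⊤ → p.2.2 = 0)}

/-! ### Eigenvalues -/

/-- The Rayleigh quotient `(∫_Ω |∇u|² + h ∫_{∂B_α} u² dS) / ∫_Ω u²`, without the boundary term
if `h = +∞`. -/
def rayleigh (h : WithTop ℝ) {α : ℝ} {Ω : Set Plane} (p : DataSpace α Ω) : ℝ :=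
  ((∫ x in Ω, ‖p.2.1 x‖ ^ 2) + h.untopD 0 * ∫ x, (p.2.2 x) ^ 2 ∂(circleMeasure α)) /
    ∫ x in Ω, (p.1 x) ^ 2

/-- The `k`-th eigenvalue (`k ≥ 1`, counted with multiplicity) of `-Δ` on `Ω` with the Robin
condition with parameter `h` (Dirichlet if `h = +∞`) on `∂B_α` and the Neumann condition on the
rest of `∂Ω`: the minimum, over the `k`-dimensional subspaces of the form domain, of the maximum
of the Rayleigh quotient. -/
def tau (k : ℕ) (h : WithTop ℝ) (α : ℝ) (Ω : Set Plane) : EReal :=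
  ⨅ (X : Submodule ℝ (DataSpace α Ω)) (_ : Module.finrank ℝ X = k)
    (_ : (X : Set (DataSpace α Ω)) ⊆ formDomain h α Ω),
    ⨆ (p : DataSpace α Ω) (_ : p ∈ X) (_ : p ≠ 0), ((rayleigh h p : ℝ) : EReal)

/-! ### The class of domains and the inequality -/

/-- `Ωout \ closure B_α` satisfies the standing assumption, is symmetric of order `2 ^ κ`, and
has the area of the shell `B_β \ closure B_α`. -/
structure IsCompetitor (κ : ℕ) (α β : ℝ) (Ωout : Set Plane) : Prop where
  assumption : AssumptionA α Ωout
  symmetric : SymmetricOfOrder (2 ^ κ) (Ωout \ Metric.closedBall 0 α)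
  volume_eq : volume (shell α β) = volume (Ωout \ Metric.closedBall 0 α)

/-- The inequality between the `i`-th eigenvalues of `Ω` and of the shell, together with its
equality case. -/
def SharpBound (i : ℕ) (h : WithTop ℝ) (α β : ℝ) (Ω : Set Plane) : Prop :=
  tau i h α Ω ≤ tau i h α (shell α β) ∧
    (tau i h α Ω = tau i h α (shell α β) ↔ Ω = shell α β)

end

noncomputable section

/-! ### Picone's inequality -/

/-! With `r = β e^{-t}` the shell becomes the strip `0 < t < L`, `L = log (β / α)`, whose edge `t =
0` is the outer circle. Angular frequency `l` and eigenvalue `μ` lead to `u'' = (l² - m e^{-2t}) u`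
with `m = μ β²`, `u'(0) = 0` and `u'(L) + h α u(L) = 0`, or `u(L) = 0` if `h = +∞`. Let `l = i / 2`,
rounded down, and let `μ` be the first eigenvalue of frequency `l`. If `Ω` is not the shell, then
`τ_i(Ω) < μ ≤ τ_i(shell)`; this yields the inequality and its equality case together.

Upper bound (`exists_tau_le_lt`). The first eigenfunction of frequency `l`, continued by the
constant 1 beyond the outer circle, is a common radial profile for test functions of angular
frequencies `0, 1, 1, 2, 2, …` up to `l`. The symmetry of order `2^κ ≥ i` makes them orthogonal in
`Ω`, in energy and on the inner circle, so that only the angularly averaged form of frequency `l`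
matters. Its density is at least its outer-circle value `l²/β² - μ` inside the shell
(`ModeSol.density_ge`) and below that value outside radius `β`. As the areas agree, moving mass out
of the shell strictly lowers the form (`profileForm_lt`).

Lower bound (`le_tau_shell`). Require the `2 l - 1` real Fourier coefficients of order below `l` to
vanish on one circle `t = s`; a space of dimension `i ≥ 2 l` contains a limit of functions obeying
this. Frequencies at least `l` contribute nonnegatively by Picone's and Wirtinger's inequalities,
compared with a positive solution of frequency `l` (`StripFunction.form_nonneg`). Lower frequencies
cost at least as much as frequency 0, and their coefficients vanish at `s`; so it suffices that the
form of frequency 0 is nonnegative on functions vanishing at `s` (`NonnegOnHyperplane`).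

This last condition is where the parameter ranges enter. It holds if `m ≤ 0`, which very negative
`h` forces; if `m ≤ 4 / L²` and the boundary weight is at least `-1 / L`, which thin shells
guarantee; and if `m` is at most the first Dirichlet eigenvalue of frequency 2, which covers `i ≤ 5`
for `h` slightly negative or larger. -/

theorem picone_le_integral {A B : ℝ} (hAB : A ≤ B) {q u v a a' : ℝ → ℝ}
    (hu : ∀ t ∈ Ioo A B, HasDerivAt u (v t) t)
    (hv : ∀ t ∈ Ioo A B, HasDerivAt v (q t * u t) t)
    (hu0 : ∀ t ∈ Ioo A B, u t ≠ 0)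
    (ha : ∀ t ∈ Icc A B, HasDerivAt a (a' t) t) (ha' : ContinuousOn a' (Icc A B))
    (hq : ContinuousOn q (Icc A B))
    (hF : ContinuousOn (fun t => v t * a t ^ 2 / u t) (Icc A B)) :
    v B * a B ^ 2 / u B - v A * a A ^ 2 / u A ≤ ∫ t in A..B, (a' t ^ 2 + q t * a t ^ 2) := by
  have hac : ContinuousOn a (Icc A B) := fun t ht => (ha t ht).continuousAt.continuousWithinAt
  refine intervalIntegral.sub_le_integral_of_hasDeriv_right_of_le hAB hF
    -- Picone's identity: `(v a² / u)'` equals `a'² + q a²` minus a square. Only continuity of the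
    -- quotient is asked at the end points, so `u` may vanish there.
    (g' := fun t => a' t ^ 2 + q t * a t ^ 2 - (v t * a t / u t - a' t) ^ 2) ?_ ?_ ?_
  · intro t ht
    have h := ((((hv t ht).mul ((ha t (Ioo_subset_Icc_self ht)).pow 2))).div (hu t ht) (hu0 t ht))
    refine (h.congr_deriv ?_).hasDerivWithinAt
    have := hu0 t ht
    simp only [Pi.mul_apply, Pi.pow_apply]
    field_simp
    push_cast
    ring
  · exact ContinuousOn.integrableOn_Icc (by fun_prop)
  · intro t _
    nlinarith [sq_nonneg (v t * a t / u t - a' t)]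

/-- Near a simple zero of `u` shared by `a`, the quotient is `v a` times a ratio of difference
quotients, hence tends to 0. This supplies the continuity that Picone's inequality needs at such an
end point. -/
theorem continuousAt_picone_of_zero {u v a : ℝ → ℝ} {a's s : ℝ}
    (hu : HasDerivAt u (v s) s) (hv : ContinuousAt v s) (ha : HasDerivAt a a's s)
    (hus : u s = 0) (has : a s = 0) (hvs : v s ≠ 0) :
    ContinuousAt (fun t => v t * a t ^ 2 / u t) s := by
  rw [continuousAt_iff_punctured_nhds]
  have h1 : Filter.Tendsto (fun t => v t * a t * (slope a s t / slope u s t)) (𝓝[≠] s)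
      (𝓝 (v s * a s * (a's / v s))) :=
    ((hv.tendsto.mono_left nhdsWithin_le_nhds).mul
      (ha.continuousAt.tendsto.mono_left nhdsWithin_le_nhds)).mul
      ((hasDerivAt_iff_tendsto_slope.1 ha).div (hasDerivAt_iff_tendsto_slope.1 hu) hvs)
  have h2 : v s * a s * (a's / v s) = v s * a s ^ 2 / u s := by simp [has]
  rw [h2] at h1
  refine h1.congr' ?_
  filter_upwards [self_mem_nhdsWithin] with t ht
  have ht' : t - s ≠ 0 := sub_ne_zero.2 ht
  simp only [slope_def_field, has, hus, sub_zero]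
  rw [div_div_div_cancel_right₀ ht']
  ring

/-! ### The radial equation in a fixed angular mode -/

/-- On `(-1, L + 1)`, `u` solves `u'' = (l² - m e^{-2t}) u` with `u(0) = 1` and `u'(0) = 0`,
and `v` is its derivative. -/
structure ModeSol (l m L : ℝ) (u v : ℝ → ℝ) : Prop where
  hu : ∀ t ∈ Ioo (-1) (L + 1), HasDerivAt u (v t) t
  hv : ∀ t ∈ Ioo (-1) (L + 1), HasDerivAt v ((l ^ 2 - m * Real.exp (-2 * t)) * u t) t
  u_zero : u 0 = 1
  v_zero : v 0 = 0

/-- The vector field of the Prüfer angle of `u'' = (l² - m e^{-2t}) u`. -/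
def pruferField (l m t x : ℝ) : ℝ :=
  Real.sin x ^ 2 + (m * Real.exp (-2 * t) - l ^ 2) * Real.cos x ^ 2

theorem abs_sin_sq_sub_le (x y : ℝ) : |Real.sin x ^ 2 - Real.sin y ^ 2| ≤ |x - y| := by
  have h : Real.sin x ^ 2 - Real.sin y ^ 2 = Real.sin (x - y) * Real.sin (x + y) := by
    rw [Real.sin_sub, Real.sin_add]
    nlinarith [Real.sin_sq_add_cos_sq x, Real.sin_sq_add_cos_sq y]
  rw [h, abs_mul]
  calc |Real.sin (x - y)| * |Real.sin (x + y)| ≤ |x - y| * 1 :=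
        mul_le_mul Real.abs_sin_le_abs (Real.abs_sin_le_one _) (abs_nonneg _) (abs_nonneg _)
    _ = |x - y| := mul_one _

/-- A bound of the potential `m e^{-2t} - l²` for `t ≥ -1`, increased by one. -/
def pruferBound (l m : ℝ) : ℝ≥0 := (|m| * Real.exp 2 + l ^ 2 + 1).toNNReal

theorem coe_pruferBound (l m : ℝ) : (pruferBound l m : ℝ) = |m| * Real.exp 2 + l ^ 2 + 1 :=
  Real.coe_toNNReal _ (by positivity)

theorem abs_potential_le {l m t : ℝ} (ht : -1 ≤ t) :
    |m * Real.exp (-2 * t) - l ^ 2| ≤ |m| * Real.exp 2 + l ^ 2 := by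
  refine (abs_sub _ _).trans ?_
  rw [abs_mul, abs_of_pos (Real.exp_pos _), abs_of_nonneg (sq_nonneg l)]
  gcongr
  linarith

theorem lipschitzWith_pruferField {l m t : ℝ} (ht : -1 ≤ t) :
    LipschitzWith (pruferBound l m) (pruferField l m t) := by
  refine LipschitzWith.of_dist_le_mul fun x y => ?_
  rw [Real.dist_eq, Real.dist_eq]
  have h : pruferField l m t x - pruferField l m t y =
      (1 - (m * Real.exp (-2 * t) - l ^ 2)) * (Real.sin x ^ 2 - Real.sin y ^ 2) := by
    simp only [pruferField, Real.cos_sq']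
    ring
  rw [h, abs_mul]
  refine mul_le_mul ?_ (abs_sin_sq_sub_le x y) (abs_nonneg _) (NNReal.coe_nonneg _)
  refine (abs_sub _ _).trans ?_
  have := abs_potential_le (l := l) (m := m) ht
  rw [coe_pruferBound]
  rw [abs_one]
  linarith

theorem abs_pruferField_le {l m t : ℝ} (ht : -1 ≤ t) (x : ℝ) :
    |pruferField l m t x| ≤ pruferBound l m := by
  have h1 := abs_potential_le (l := l) (m := m) ht
  refine (abs_add_le _ _).trans ?_
  rw [abs_mul, abs_of_nonneg (sq_nonneg (Real.sin x)), abs_of_nonneg (sq_nonneg (Real.cos x))]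
  rw [coe_pruferBound]
  have h2 := Real.sin_sq_le_one x
  have h3 := Real.cos_sq_le_one x
  nlinarith [abs_nonneg (m * Real.exp (-2 * t) - l ^ 2), sq_nonneg (Real.cos x)]

/-- The field is bounded and Lipschitz in the angle uniformly in time, so Picard–Lindelöf applies to
the whole interval at once. The interval overshoots `[0, L]` to provide two-sided derivatives at
both ends. -/
theorem exists_pruferAngle (l m : ℝ) {L : ℝ} (hL : 0 < L) :
    ∃ ψ : ℝ → ℝ, ψ 0 = 0 ∧ ∀ t ∈ Ioo (-1) (L + 1), HasDerivAt ψ (pruferField l m t (ψ t)) t := by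
  have h0 : (0 : ℝ) ∈ Icc (-1) (L + 1) := ⟨by norm_num, by linarith⟩
  have hP : IsPicardLindelof (pruferField l m) (tmin := -1) (tmax := L + 1) ⟨0, h0⟩ 0
      (pruferBound l m * (L + 1).toNNReal) 0 (pruferBound l m) (pruferBound l m) := by
    refine ⟨fun t ht => (lipschitzWith_pruferField ht.1).lipschitzOnWith, fun x _ => ?_,
      fun t ht x _ => abs_pruferField_le ht.1 x, ?_⟩
    · unfold pruferField
      fun_prop
    · have : max (L + 1 - 0) (0 - -1) = L + 1 := by
        rw [max_eq_left]; ring; linarith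
      simp only [this]
      rw [NNReal.coe_mul, NNReal.coe_zero, sub_zero, Real.coe_toNNReal _ (by linarith)]
  obtain ⟨ψ, h1, h2⟩ := hP.exists_eq_forall_mem_Icc_hasDerivWithinAt₀
  exact ⟨ψ, h1, fun t ht => (h2 t (Ioo_subset_Icc_self ht)).hasDerivAt (Icc_mem_nhds ht.1 ht.2)⟩

/-- Inverse Prüfer transformation: for `u = ρ cos ψ`, `u' = -ρ sin ψ` the amplitude satisfies `ρ' /
ρ = (m e^{-2t} - l² - 1) sin ψ cos ψ`. So `ρ` is an exponential, and the sign of `u` is that of `cos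
ψ`. -/
theorem modeSol_of_pruferAngle {l m L : ℝ} (hL : 0 < L) {ψ : ℝ → ℝ} (h0 : ψ 0 = 0)
    (hψ : ∀ t ∈ Ioo (-1) (L + 1), HasDerivAt ψ (pruferField l m t (ψ t)) t) :
    ∃ ρ : ℝ → ℝ, (∀ t, 0 < ρ t) ∧
      ModeSol l m L (fun t => ρ t * Real.cos (ψ t)) (fun t => -(ρ t * Real.sin (ψ t))) := by
  set G : ℝ → ℝ := fun t =>
    (m * Real.exp (-2 * t) - l ^ 2 - 1) * (Real.sin (ψ t) * Real.cos (ψ t)) with hG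
  have hψc : ContinuousOn ψ (Ioo (-1) (L + 1)) :=
    fun t ht => (hψ t ht).continuousAt.continuousWithinAt
  have hGc : ContinuousOn G (Ioo (-1) (L + 1)) := by
    have := Real.continuous_sin.comp_continuousOn hψc
    have := Real.continuous_cos.comp_continuousOn hψc
    simp only [hG]
    fun_prop
  have h0m : (0 : ℝ) ∈ Ioo (-1) (L + 1) := ⟨by norm_num, by linarith⟩
  have hI : ∀ t ∈ Ioo (-1) (L + 1), HasDerivAt (fun t => ∫ s in (0:ℝ)..t, G s) (G t) t := by
    intro t ht
    have hsub : uIcc 0 t ⊆ Ioo (-1) (L + 1) := ordConnected_Ioo.uIcc_subset h0m ht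
    exact intervalIntegral.integral_hasDerivAt_right ((hGc.mono hsub).intervalIntegrable)
      (hGc.stronglyMeasurableAtFilter isOpen_Ioo t ht) (hGc.continuousAt (isOpen_Ioo.mem_nhds ht))
  refine ⟨fun t => Real.exp (∫ s in (0:ℝ)..t, G s), fun t => Real.exp_pos _, ?_, ?_, ?_, ?_⟩
  · intro t ht
    refine ((hI t ht).exp.mul (hψ t ht).cos).congr_deriv ?_
    simp only [hG, pruferField]
    have := Real.sin_sq_add_cos_sq (ψ t)
    linear_combination (-Real.exp (∫ s in (0:ℝ)..t, G s) * Real.sin (ψ t)) * this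
  · intro t ht
    refine ((hI t ht).exp.mul (hψ t ht).sin).neg.congr_deriv ?_
    simp only [hG, pruferField]
    have := Real.sin_sq_add_cos_sq (ψ t)
    linear_combination (-Real.exp (∫ s in (0:ℝ)..t, G s) * Real.cos (ψ t) *
      (m * Real.exp (-2 * t) - l ^ 2)) * this
  · simp [h0]
  · simp [h0]

/-- The Prüfer angle cannot return to a zero of the cosine from above. -/
theorem pruferAngle_gt {l m a b c : ℝ} (hc : Real.cos c = 0) {ψ : ℝ → ℝ}
    (hψ : ∀ t ∈ Icc a b, HasDerivAt ψ (pruferField l m t (ψ t)) t) (ha : c ≤ ψ a) :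
    ∀ t ∈ Ioc a b, c < ψ t := by
  have hs : Real.sin c ^ 2 = 1 := by
    have := Real.sin_sq_add_cos_sq c
    rw [hc] at this
    linarith
  have hfield : ∀ t, pruferField l m t c = 1 := fun t => by simp [pruferField, hc, hs]
  have hle : ∀ t ∈ Icc a b, c ≤ ψ t :=
    image_le_of_deriv_right_lt_deriv_boundary' (f := fun _ => c) (f' := fun _ => 0)
      continuousOn_const (fun x _ => hasDerivWithinAt_const _ _ _) ha
      (fun t ht => (hψ t ht).continuousAt.continuousWithinAt)
      (fun t ht => (hψ t (Ico_subset_Icc_self ht)).hasDerivWithinAt)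
      (fun t ht h => by rw [← h, hfield]; norm_num)
  intro t ht
  -- Where the angle equals `c` its slope is 1, so touching `c` at a later time would force it below
  -- `c` just before.
  refine lt_of_le_of_ne (hle t (Ioc_subset_Icc_self ht)) fun h => ?_
  have hd := hψ t (Ioc_subset_Icc_self ht)
  rw [← h, hfield] at hd
  have h1 := (hasDerivAt_iff_tendsto_slope.1 hd).eventually (lt_mem_nhds zero_lt_one)
  have h2 : ∀ᶠ s in 𝓝[<] t, 0 < slope ψ t s :=
    h1.filter_mono (nhdsWithin_mono _ fun s hs => ne_of_lt hs)
  obtain ⟨s, hs1, hs2⟩ := (h2.and (Ioo_mem_nhdsLT ht.1)).exists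
  rw [slope_def_field] at hs1
  have h3 : s - t < 0 := sub_neg.2 hs2.2
  have h4 : ψ s - ψ t < 0 := by
    by_contra hcon
    exact absurd hs1 (not_lt.2 (div_nonpos_of_nonneg_of_nonpos (not_lt.1 hcon) h3.le))
  have := hle s ⟨hs2.1.le, hs2.2.le.trans ht.2⟩
  linarith

/-- The angle starts above `-π/2` and cannot fall to it; had it reached `π/2` before `L`, it would
exceed `π/2` at `L`. Hence the solution is positive before `L`. -/
theorem pruferAngle_mem {l m L : ℝ} {ψ : ℝ → ℝ} (h0 : ψ 0 = 0)
    (hψ : ∀ t ∈ Ioo (-1) (L + 1), HasDerivAt ψ (pruferField l m t (ψ t)) t)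
    (hψL : ψ L ≤ Real.pi / 2) :
    ∀ t ∈ Ico 0 L, ψ t ∈ Ioo (-(Real.pi / 2)) (Real.pi / 2) := by
  intro t ht
  constructor
  · rcases ht.1.eq_or_lt with h | h
    · rw [← h, h0]
      linarith [Real.pi_pos]
    · refine pruferAngle_gt (a := 0) (b := t) (by simp)
        (fun s hs => hψ s ⟨by linarith [hs.1], by linarith [hs.2, ht.2]⟩) ?_ t ⟨h, le_rfl⟩
      rw [h0]
      linarith [Real.pi_pos]
  · by_contra hcon
    have := pruferAngle_gt (a := t) (b := L) Real.cos_pi_div_two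
      (fun s hs => hψ s ⟨by linarith [hs.1, ht.1], by linarith [hs.2, ht.2]⟩) (not_lt.1 hcon) L
      ⟨ht.2, le_rfl⟩
    linarith

theorem neg_pi_div_two_lt_pruferAngle {l m L : ℝ} (hL : 0 < L) {ψ : ℝ → ℝ} (h0 : ψ 0 = 0)
    (hψ : ∀ t ∈ Ioo (-1) (L + 1), HasDerivAt ψ (pruferField l m t (ψ t)) t) :
    -(Real.pi / 2) < ψ L := by
  refine pruferAngle_gt (a := 0) (b := L) (by simp)
    (fun s hs => hψ s ⟨by linarith [hs.1], by linarith [hs.2]⟩) ?_ L ⟨hL, le_rfl⟩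
  rw [h0]
  linarith [Real.pi_pos]

theorem ModeSol.picone {l m L : ℝ} (hL : 0 < L) {u v : ℝ → ℝ} (h : ModeSol l m L u v)
    (hpos : ∀ t ∈ Icc 0 L, 0 < u t) {a a' : ℝ → ℝ}
    (ha : ∀ t ∈ Icc 0 L, HasDerivAt a (a' t) t) (ha' : ContinuousOn a' (Icc 0 L)) :
    v L * a L ^ 2 / u L ≤
      ∫ t in (0:ℝ)..L, (a' t ^ 2 + (l ^ 2 - m * Real.exp (-2 * t)) * a t ^ 2) := by
  have hsub : ∀ t ∈ Icc 0 L, t ∈ Ioo (-1) (L + 1) :=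
    fun t ht => ⟨by linarith [ht.1], by linarith [ht.2]⟩
  have hv : ContinuousOn v (Icc 0 L) :=
    fun t ht => (h.hv t (hsub t ht)).continuousAt.continuousWithinAt
  have hu : ContinuousOn u (Icc 0 L) :=
    fun t ht => (h.hu t (hsub t ht)).continuousAt.continuousWithinAt
  have hac : ContinuousOn a (Icc 0 L) := fun t ht => (ha t ht).continuousAt.continuousWithinAt
  have := picone_le_integral hL.le (q := fun t => l ^ 2 - m * Real.exp (-2 * t))
    (fun t ht => h.hu t (hsub t (Ioo_subset_Icc_self ht)))
    (fun t ht => h.hv t (hsub t (Ioo_subset_Icc_self ht)))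
    (fun t ht => (hpos t (Ioo_subset_Icc_self ht)).ne') ha ha' (by fun_prop)
    ((hv.mul (hac.pow 2)).div hu fun t ht => (hpos t ht).ne')
  simpa [h.v_zero] using this

/-- The Prüfer angle with initial value `0`. -/
def pruferAngle {L : ℝ} (hL : 0 < L) (l m : ℝ) : ℝ → ℝ := (exists_pruferAngle l m hL).choose

theorem pruferAngle_zero {L : ℝ} (hL : 0 < L) (l m : ℝ) : pruferAngle hL l m 0 = 0 :=
  (exists_pruferAngle l m hL).choose_spec.1

theorem hasDerivAt_pruferAngle {L : ℝ} (hL : 0 < L) (l m : ℝ) :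
    ∀ t ∈ Ioo (-1) (L + 1), HasDerivAt (pruferAngle hL l m)
      (pruferField l m t (pruferAngle hL l m t)) t :=
  (exists_pruferAngle l m hL).choose_spec.2

/-! ### Dependence of the Prüfer angle on the spectral parameter -/

theorem continuous_pruferAngle {L : ℝ} (hL : 0 < L) (l : ℝ) :
    Continuous fun m => pruferAngle hL l m L := by
  rw [continuous_iff_continuousAt]
  intro m
  have key : ∀ m', dist (pruferAngle hL l m' L) (pruferAngle hL l m L) ≤
      gronwallBound 0 (pruferBound l m) (|m' - m| + 0) (L - 0) := by
    intro m'
    refine dist_le_of_approx_trajectories_ODE_of_mem (v := pruferField l m) (s := fun _ => univ)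
      (f' := fun t => pruferField l m' t (pruferAngle hL l m' t))
      (g' := fun t => pruferField l m t (pruferAngle hL l m t)) (a := 0) (b := L)
      ?_ ?_ ?_ ?_ ?_ ?_ ?_ ?_ ?_ ?_ L ⟨hL.le, le_rfl⟩
    · exact fun t ht => (lipschitzWith_pruferField (by linarith [ht.1])).lipschitzOnWith
    · exact fun t ht => (hasDerivAt_pruferAngle hL l m' t
        ⟨by linarith [ht.1], by linarith [ht.2]⟩).continuousAt.continuousWithinAt
    · exact fun t ht => (hasDerivAt_pruferAngle hL l m' t
        ⟨by linarith [ht.1], by linarith [ht.2]⟩).hasDerivWithinAt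
    -- Grönwall's inequality needs the defect of one field along the other trajectory; it is at most
    -- `|m' - m|` because `e^{-2t} ≤ 1` for `t ≥ 0`.
    · intro t ht
      rw [Real.dist_eq]
      have : pruferField l m' t (pruferAngle hL l m' t) - pruferField l m t (pruferAngle hL l m' t)
          = (m' - m) * (Real.exp (-2 * t) * Real.cos (pruferAngle hL l m' t) ^ 2) := by
        simp only [pruferField]
        ring
      rw [this, abs_mul]
      refine mul_le_of_le_one_right (abs_nonneg _) ?_
      rw [abs_of_nonneg (by positivity)]
      have h1 : Real.exp (-2 * t) ≤ 1 := Real.exp_le_one_iff.2 (by linarith [ht.1])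
      exact mul_le_one₀ h1 (sq_nonneg _) (Real.cos_sq_le_one _)
    · exact fun _ _ => mem_univ _
    · exact fun t ht => (hasDerivAt_pruferAngle hL l m t
        ⟨by linarith [ht.1], by linarith [ht.2]⟩).continuousAt.continuousWithinAt
    · exact fun t ht => (hasDerivAt_pruferAngle hL l m t
        ⟨by linarith [ht.1], by linarith [ht.2]⟩).hasDerivWithinAt
    · exact fun t _ => (dist_self _).le
    · exact fun _ _ => mem_univ _
    · simp [pruferAngle_zero]
  have h0 : Filter.Tendsto (fun m' => gronwallBound 0 (pruferBound l m) (|m' - m| + 0) (L - 0))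
      (𝓝 m) (𝓝 0) := by
    have hc : Continuous fun m' => gronwallBound 0 (pruferBound l m) (|m' - m| + 0) (L - 0) :=
      (gronwallBound_continuous_ε 0 (pruferBound l m) (L - 0)).comp (by fun_prop)
    have := hc.tendsto m
    simpa [gronwallBound_ε0_δ0] using this
  exact tendsto_iff_dist_tendsto_zero.2
    (squeeze_zero (fun _ => dist_nonneg) key h0)

/-- For very negative `m` the curve `-arctan (c t)` is an upper barrier for the angle, and it ends
at `-arctan K < τ`. This bounds the eigenvalues from below. -/
theorem exists_pruferAngle_lt {L : ℝ} (hL : 0 < L) (l : ℝ) {τ : ℝ} (hτ : -(Real.pi / 2) < τ) :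
    ∃ m₀, ∀ m ≤ m₀, pruferAngle hL l m L < τ := by
  obtain ⟨K, hK1, hK0⟩ : ∃ K : ℝ, -τ < Real.arctan K ∧ 0 < K :=
    (((tendsto_nhds_of_tendsto_nhdsWithin Real.tendsto_arctan_atTop).eventually
      (lt_mem_nhds (by linarith : -τ < Real.pi / 2))).and
        (Filter.eventually_gt_atTop 0)).exists
  set c := K / L with hc
  have hc0 : 0 < c := div_pos hK0 hL
  have hcL : c * L = K := div_mul_cancel₀ _ hL.ne'
  -- With this choice `m e^{-2t} ≤ -(c + K² + 1)` on `[0, L]`, so on the barrier the field lies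
  -- strictly below the slope `-c / (1 + (c t)²)` of the barrier.
  refine ⟨-((c + K ^ 2 + 1) * Real.exp (2 * L)), fun m hm => ?_⟩
  have hfence := image_le_of_deriv_right_lt_deriv_boundary' (a := 0) (b := L)
    (f := pruferAngle hL l m) (f' := fun t => pruferField l m t (pruferAngle hL l m t))
    (B := fun t => -Real.arctan (c * t)) (B' := fun t => -(1 / (1 + (c * t) ^ 2) * c))
    (fun t ht => (hasDerivAt_pruferAngle hL l m t
        ⟨by linarith [ht.1], by linarith [ht.2]⟩).continuousAt.continuousWithinAt)
    (fun t ht => (hasDerivAt_pruferAngle hL l m t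
        ⟨by linarith [ht.1], by linarith [ht.2]⟩).hasDerivWithinAt)
    (by simp [pruferAngle_zero])
    (by fun_prop)
    (fun t _ => ((((hasDerivAt_id t).const_mul c).arctan).neg.congr_deriv
      (by simp)).hasDerivWithinAt)
    (by
      intro t ht h
      rw [h]
      have h1 : pruferField l m t (-Real.arctan (c * t)) =
          ((c * t) ^ 2 + (m * Real.exp (-2 * t) - l ^ 2)) / (1 + (c * t) ^ 2) := by
        have : (1 + (c * t) ^ 2) ≠ 0 := by positivity
        simp only [pruferField, Real.sin_neg, Real.cos_neg, neg_sq, Real.cos_sq_arctan,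
          Real.sin_sq_arctan]
        field_simp
      have h2 : -(1 / (1 + (c * t) ^ 2) * c) = (-c) / (1 + (c * t) ^ 2) := by ring
      rw [h1, h2]
      refine div_lt_div_of_pos_right ?_ (by positivity)
      have h3 : (c * t) ^ 2 ≤ K ^ 2 := by
        rw [← hcL]
        have := ht.1
        have := ht.2.le
        gcongr
      have h4 : m * Real.exp (-2 * t) ≤ -(c + K ^ 2 + 1) := by
        have h5 : Real.exp (-2 * L) ≤ Real.exp (-2 * t) := Real.exp_le_exp.2 (by linarith [ht.2])
        have h6 : Real.exp (2 * L) * Real.exp (-2 * L) = 1 := by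
          rw [← Real.exp_add]; simp
        have h7 : 0 < c + K ^ 2 + 1 := by positivity
        calc m * Real.exp (-2 * t)
            ≤ -((c + K ^ 2 + 1) * Real.exp (2 * L)) * Real.exp (-2 * t) := by gcongr
          _ ≤ -((c + K ^ 2 + 1) * Real.exp (2 * L)) * Real.exp (-2 * L) := by
              apply mul_le_mul_of_nonpos_left h5
              have := Real.exp_pos (2 * L)
              nlinarith
          _ = -(c + K ^ 2 + 1) := by linear_combination (-(c + K ^ 2 + 1)) * h6
      nlinarith [sq_nonneg l])
  have := hfence (x := L) ⟨hL.le, le_rfl⟩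
  simp only [hcL] at this
  linarith

theorem integral_dirichlet_test_le {L : ℝ} (hL : 0 < L) {l m : ℝ} (hm : 0 ≤ m) :
    ∫ t in (0:ℝ)..L, ((-1 : ℝ) ^ 2 + (l ^ 2 - m * Real.exp (-2 * t)) * (L - t) ^ 2) ≤
      L + l ^ 2 * L ^ 3 / 3 - m * Real.exp (-2 * L) * (L ^ 3 / 3) := by
  have h1 : ∫ t in (0:ℝ)..L, (1 + (l ^ 2 - m * Real.exp (-2 * L)) * (L - t) ^ 2) =
      L + l ^ 2 * L ^ 3 / 3 - m * Real.exp (-2 * L) * (L ^ 3 / 3) := by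
    have hd : ∀ t ∈ uIcc 0 L, HasDerivAt
        (fun t => t - (l ^ 2 - m * Real.exp (-2 * L)) * ((L - t) ^ 3 / 3))
        (1 + (l ^ 2 - m * Real.exp (-2 * L)) * (L - t) ^ 2) t := by
      intro t _
      have h := (hasDerivAt_id t).sub ((((((hasDerivAt_id t).const_sub L).pow 3).div_const
        3)).const_mul (l ^ 2 - m * Real.exp (-2 * L)))
      refine h.congr_deriv ?_
      simp
      ring
    rw [intervalIntegral.integral_eq_sub_of_hasDerivAt hd
      (Continuous.intervalIntegrable (by fun_prop) _ _)]
    ring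
  rw [← h1]
  refine intervalIntegral.integral_mono_on hL.le (Continuous.intervalIntegrable (by fun_prop) _ _)
    (Continuous.intervalIntegrable (by fun_prop) _ _) fun t ht => ?_
  have h5 : Real.exp (-2 * L) ≤ Real.exp (-2 * t) := Real.exp_le_exp.2 (by linarith [ht.2])
  have h6 : m * Real.exp (-2 * L) * (L - t) ^ 2 ≤ m * Real.exp (-2 * t) * (L - t) ^ 2 := by gcongr
  nlinarith

/-- Picone's inequality against the test function `L - t`, whose zero at `L` removes the boundary
term whatever the boundary condition. -/
theorem ModeSol.upper_bound {L : ℝ} (hL : 0 < L) {l m : ℝ} (hm : 0 ≤ m) {u v : ℝ → ℝ}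
    (h : ModeSol l m L u v) (hpos : ∀ t ∈ Icc 0 L, 0 < u t) :
    m * Real.exp (-2 * L) * (L ^ 3 / 3) ≤ L + l ^ 2 * L ^ 3 / 3 := by
  have h1 := h.picone hL hpos (a := fun t => L - t) (a' := fun _ => -1)
    (fun t _ => (hasDerivAt_id t).const_sub L) continuousOn_const
  have h2 := integral_dirichlet_test_le hL (l := l) hm
  have h3 : v L * (L - L) ^ 2 / u L = 0 := by simp
  rw [h3] at h1
  have h4 := h1.trans h2
  linarith

theorem exists_modeSol_of_pruferAngle_lt {L : ℝ} (hL : 0 < L) {l m : ℝ}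
    (hlt : pruferAngle hL l m L < Real.pi / 2) :
    ∃ u v, ModeSol l m L u v ∧ (∀ t ∈ Icc 0 L, 0 < u t) ∧
      v L = - Real.tan (pruferAngle hL l m L) * u L := by
  have h0 := pruferAngle_zero hL l m
  have hψ := hasDerivAt_pruferAngle hL l m
  obtain ⟨ρ, hρ, hs⟩ := modeSol_of_pruferAngle hL h0 hψ
  have hmem : ∀ t ∈ Icc 0 L, pruferAngle hL l m t ∈ Ioo (-(Real.pi / 2)) (Real.pi / 2) := by
    intro t ht
    rcases ht.2.eq_or_lt with h | h
    · rw [h]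
      exact ⟨neg_pi_div_two_lt_pruferAngle hL h0 hψ, hlt⟩
    · exact pruferAngle_mem h0 hψ hlt.le t ⟨ht.1, h⟩
  refine ⟨_, _, hs, fun t ht => mul_pos (hρ t) (Real.cos_pos_of_mem_Ioo (hmem t ht)), ?_⟩
  have := (Real.cos_pos_of_mem_Ioo (hmem L ⟨hL.le, le_rfl⟩)).ne'
  rw [Real.tan_eq_sin_div_cos]
  field_simp

/-- Otherwise a positive solution would exist for every `m`, against `ModeSol.upper_bound`; the
chosen `m` violates that bound by exactly 1. -/
theorem exists_pi_div_two_le_pruferAngle {L : ℝ} (hL : 0 < L) (l : ℝ) :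
    ∃ m, Real.pi / 2 ≤ pruferAngle hL l m L := by
  by_contra! hcon
  set m := (L + l ^ 2 * L ^ 3 / 3 + 1) / (Real.exp (-2 * L) * (L ^ 3 / 3)) with hm
  have hpos : 0 < Real.exp (-2 * L) * (L ^ 3 / 3) := by positivity
  have hm0 : 0 ≤ m := by positivity
  obtain ⟨u, v, h1, h2, -⟩ := exists_modeSol_of_pruferAngle_lt hL (hcon m)
  have h3 := h1.upper_bound hL hm0 h2
  have h4 : m * (Real.exp (-2 * L) * (L ^ 3 / 3)) = L + l ^ 2 * L ^ 3 / 3 + 1 :=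
    div_mul_cancel₀ _ hpos.ne'
  rw [mul_assoc] at h3
  linarith

/-- The first eigenvalue in the angular mode `l` and its eigenfunction; `τ` encodes the boundary
condition at `L`. -/
theorem exists_first_eigenpair {L : ℝ} (hL : 0 < L) (l : ℝ) {τ : ℝ}
    (hτ : τ ∈ Ioc (-(Real.pi / 2)) (Real.pi / 2)) :
    ∃ m u v, ModeSol l m L u v ∧ (∀ t ∈ Ico 0 L, 0 < u t) ∧
      (∃ ρ > 0, u L = ρ * Real.cos τ ∧ v L = -(ρ * Real.sin τ)) ∧
      ∀ m' < m, pruferAngle hL l m' L < τ := by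
  -- The first eigenvalue is the least parameter whose angle reaches `τ` at `L`. Leastness and
  -- continuity suffice; monotonicity of the angle in `m` is not needed.
  set S := {m | τ ≤ pruferAngle hL l m L} with hS
  have hcont := continuous_pruferAngle hL l
  have hSc : IsClosed S := isClosed_le continuous_const hcont
  have hne : S.Nonempty := by
    obtain ⟨m, hm⟩ := exists_pi_div_two_le_pruferAngle hL l
    exact ⟨m, hτ.2.trans hm⟩
  have hbdd : BddBelow S := by
    obtain ⟨m₀, hm₀⟩ := exists_pruferAngle_lt hL l hτ.1
    exact ⟨m₀, fun m hm => le_of_not_ge fun h => absurd hm (not_le.2 (hm₀ m h))⟩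
  set m := sInf S with hm
  have hmS : m ∈ S := hSc.csInf_mem hne hbdd
  have hlt : ∀ m' < m, pruferAngle hL l m' L < τ :=
    fun m' h => not_le.1 fun h' => absurd (csInf_le hbdd h') (not_le.2 h)
  have heq : pruferAngle hL l m L = τ := by
    refine le_antisymm ?_ hmS
    refine le_of_tendsto (hcont.continuousAt.tendsto.mono_left
      (nhdsWithin_le_nhds (s := Iio m))) ?_
    filter_upwards [self_mem_nhdsWithin] with m' hm'
    exact (hlt m' hm').le
  have h0 := pruferAngle_zero hL l m
  have hψ := hasDerivAt_pruferAngle hL l m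
  obtain ⟨ρ, hρ, hs⟩ := modeSol_of_pruferAngle hL h0 hψ
  refine ⟨m, _, _, hs, fun t ht => mul_pos (hρ t) (Real.cos_pos_of_mem_Ioo
    (pruferAngle_mem h0 hψ (heq ▸ hτ.2) t ht)), ⟨ρ L, hρ L, ?_⟩, hlt⟩
  simp only [heq, and_self]

/-! ### Convexity, energy and logarithmic derivative of positive mode solutions -/

namespace ModeSol

variable {l m L : ℝ} {u v : ℝ → ℝ}

theorem mem_Ioo_of_mem_Icc {t : ℝ} (ht : t ∈ Icc 0 L) : t ∈ Ioo (-1) (L + 1) :=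
  ⟨by linarith [ht.1], by linarith [ht.2]⟩

theorem hasDerivAt_u (h : ModeSol l m L u v) {t : ℝ} (ht : t ∈ Icc 0 L) : HasDerivAt u (v t) t :=
  h.hu t (mem_Ioo_of_mem_Icc ht)

theorem hasDerivAt_v (h : ModeSol l m L u v) {t : ℝ} (ht : t ∈ Icc 0 L) :
    HasDerivAt v ((l ^ 2 - m * Real.exp (-2 * t)) * u t) t :=
  h.hv t (mem_Ioo_of_mem_Icc ht)

theorem continuousOn_u (h : ModeSol l m L u v) : ContinuousOn u (Icc 0 L) :=
  fun _ ht => (h.hasDerivAt_u ht).continuousAt.continuousWithinAt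

theorem continuousOn_v (h : ModeSol l m L u v) : ContinuousOn v (Icc 0 L) :=
  fun _ ht => (h.hasDerivAt_v ht).continuousAt.continuousWithinAt

/-- A positive solution with nonnegative potential is convex; starting with slope 0 it stays above
its initial value 1. -/
theorem one_le_of_potential_nonneg (h : ModeSol l m L u v) {T : ℝ} (hT : T ∈ Icc 0 L)
    (hu : ∀ t ∈ Ico 0 L, 0 < u t) (hq : ∀ t ∈ Icc 0 T, 0 ≤ l ^ 2 - m * Real.exp (-2 * t)) :
    1 ≤ u T := by
  have hsub : ∀ t ∈ Icc 0 T, t ∈ Icc 0 L := fun t ht => ⟨ht.1, ht.2.trans hT.2⟩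
  have hv : MonotoneOn v (Icc 0 T) := by
    refine monotoneOn_of_hasDerivWithinAt_nonneg (convex_Icc 0 T)
      (h.continuousOn_v.mono hsub) (f' := fun t => (l ^ 2 - m * Real.exp (-2 * t)) * u t)
      (fun t ht => ?_) (fun t ht => ?_) <;> rw [interior_Icc] at ht
    · exact (h.hasDerivAt_v (hsub t (Ioo_subset_Icc_self ht))).hasDerivWithinAt
    · exact mul_nonneg (hq t (Ioo_subset_Icc_self ht))
        (hu t ⟨ht.1.le, ht.2.trans_le hT.2⟩).le
  have hmono : MonotoneOn u (Icc 0 T) := by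
    refine monotoneOn_of_hasDerivWithinAt_nonneg (convex_Icc 0 T)
      (h.continuousOn_u.mono hsub) (f' := v) (fun t ht => ?_) (fun t ht => ?_) <;>
      rw [interior_Icc] at ht
    · exact (h.hasDerivAt_u (hsub t (Ioo_subset_Icc_self ht))).hasDerivWithinAt
    · rw [← h.v_zero]
      exact hv ⟨le_rfl, hT.1⟩ (Ioo_subset_Icc_self ht) ht.1.le
  have := hmono ⟨le_rfl, hT.1⟩ ⟨hT.1, le_rfl⟩ hT.1
  rwa [h.u_zero] at this

theorem le_one_of_potential_nonpos (h : ModeSol l m L u v) {T : ℝ} (hT : T ∈ Icc 0 L)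
    (hu : ∀ t ∈ Ico 0 L, 0 < u t) (hq : ∀ t ∈ Icc 0 T, l ^ 2 - m * Real.exp (-2 * t) ≤ 0) :
    u T ≤ 1 := by
  have hsub : ∀ t ∈ Icc 0 T, t ∈ Icc 0 L := fun t ht => ⟨ht.1, ht.2.trans hT.2⟩
  have hv : AntitoneOn v (Icc 0 T) := by
    refine antitoneOn_of_hasDerivWithinAt_nonpos (convex_Icc 0 T)
      (h.continuousOn_v.mono hsub) (f' := fun t => (l ^ 2 - m * Real.exp (-2 * t)) * u t)
      (fun t ht => ?_) (fun t ht => ?_) <;> rw [interior_Icc] at ht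
    · exact (h.hasDerivAt_v (hsub t (Ioo_subset_Icc_self ht))).hasDerivWithinAt
    · exact mul_nonpos_of_nonpos_of_nonneg (hq t (Ioo_subset_Icc_self ht))
        (hu t ⟨ht.1.le, ht.2.trans_le hT.2⟩).le
  have hmono : AntitoneOn u (Icc 0 T) := by
    refine antitoneOn_of_hasDerivWithinAt_nonpos (convex_Icc 0 T)
      (h.continuousOn_u.mono hsub) (f' := v) (fun t ht => ?_) (fun t ht => ?_) <;>
      rw [interior_Icc] at ht
    · exact (h.hasDerivAt_u (hsub t (Ioo_subset_Icc_self ht))).hasDerivWithinAt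
    · rw [← h.v_zero]
      exact hv ⟨le_rfl, hT.1⟩ (Ioo_subset_Icc_self ht) ht.1.le
  have := hmono ⟨le_rfl, hT.1⟩ ⟨hT.1, le_rfl⟩ hT.1
  rwa [h.u_zero] at this

/-- The energy density inside the shell dominates its value on the outer circle. -/
theorem density_ge (h : ModeSol l m L u v) (hu : ∀ t ∈ Ico 0 L, 0 < u t)
    (hu' : ∀ t ∈ Icc 0 L, 0 ≤ u t) {t : ℝ} (ht : t ∈ Icc 0 L) :
    l ^ 2 - m ≤
      Real.exp (2 * t) * (v t ^ 2 + (l ^ 2 - m * Real.exp (-2 * t)) * u t ^ 2) := by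
  have he : Real.exp (2 * t) * Real.exp (-2 * t) = 1 := by
    rw [← Real.exp_add]; simp
  have he1 : 1 ≤ Real.exp (2 * t) := Real.one_le_exp (by linarith [ht.1])
  have hpos := Real.exp_pos (2 * t)
  have hq1 : Real.exp (2 * t) * (l ^ 2 - m * Real.exp (-2 * t)) = Real.exp (2 * t) * l ^ 2 - m := by
    linear_combination (-m) * he
  have hbase : l ^ 2 - m ≤ Real.exp (2 * t) * l ^ 2 - m := by nlinarith [sq_nonneg l]
  -- The term with `v²` is dropped, and the sign of the potential decides on which side of 1 the
  -- solution lies. If `m ≤ l²`, then `u ≥ 1`. If `m > l²`, the left side is negative: either the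
  -- factor is nonnegative at `t`, or the potential is nonpositive on all of `[0, t]` and `u ≤ 1`.
  suffices hs : l ^ 2 - m ≤ (Real.exp (2 * t) * l ^ 2 - m) * u t ^ 2 by
    have : 0 ≤ Real.exp (2 * t) * v t ^ 2 := by positivity
    rw [← hq1] at hs
    linarith
  have hut := hu' t ht
  rcases le_or_gt m (l ^ 2) with hm | hm
  · have h1 : 1 ≤ u t := by
      refine h.one_le_of_potential_nonneg ht hu fun s hs => ?_
      have : Real.exp (-2 * s) ≤ 1 := Real.exp_le_one_iff.2 (by linarith [hs.1])
      rcases le_or_gt m 0 with h0 | h0 <;> nlinarith [Real.exp_pos (-2 * s), sq_nonneg l]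
    have h2 : 1 ≤ u t ^ 2 := by nlinarith
    nlinarith
  · rcases le_or_gt 0 (Real.exp (2 * t) * l ^ 2 - m) with hp | hp
    · have : 0 ≤ (Real.exp (2 * t) * l ^ 2 - m) * u t ^ 2 := by positivity
      linarith
    · have h1 : u t ≤ 1 := by
        refine h.le_one_of_potential_nonpos ht hu fun s hs => ?_
        have h3 : Real.exp (-2 * t) ≤ Real.exp (-2 * s) := Real.exp_le_exp.2 (by linarith [hs.2])
        have h4 : l ^ 2 - m * Real.exp (-2 * t) ≤ 0 := by
          by_contra hcon
          have : 0 < Real.exp (2 * t) * (l ^ 2 - m * Real.exp (-2 * t)) :=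
            mul_pos hpos (not_le.1 hcon)
          linarith
        nlinarith [sq_nonneg l]
      have h2 : u t ^ 2 ≤ 1 := by nlinarith
      nlinarith

/-- The integrand is the derivative of `u v`, and the Neumann condition removes the value at 0. -/
theorem integral_energy (h : ModeSol l m L u v) (hL : 0 ≤ L) :
    ∫ t in (0:ℝ)..L, (v t ^ 2 + (l ^ 2 - m * Real.exp (-2 * t)) * u t ^ 2) = u L * v L := by
  have hu := h.continuousOn_u
  have hv := h.continuousOn_v
  rw [intervalIntegral.integral_eq_sub_of_hasDerivAt (f := fun t => u t * v t)]
  · simp [h.v_zero]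
  · intro t ht
    rw [uIcc_of_le hL] at ht
    refine ((h.hasDerivAt_u ht).mul (h.hasDerivAt_v ht)).congr_deriv ?_
    ring
  · refine ContinuousOn.intervalIntegrable ?_
    rw [uIcc_of_le hL]
    fun_prop

/-- The logarithmic derivative grows at most linearly when the eigenvalue is positive. -/
theorem v_le_mul_u (h : ModeSol l m L u v) (hL : 0 ≤ L) (hm : 0 ≤ m)
    (hpos : ∀ t ∈ Icc 0 L, 0 < u t) : v L ≤ l ^ 2 * L * u L := by
  have key := image_le_of_deriv_right_le_deriv_boundary (a := 0) (b := L)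
    (f := fun t => v t / u t) (B := fun t => l ^ 2 * t) (B' := fun _ => l ^ 2)
    -- The Riccati equation: the derivative of `v / u` is the potential minus `(v / u)²`, at most
    -- `l²` when `m ≥ 0`.
    (f' := fun t => ((l ^ 2 - m * Real.exp (-2 * t)) * u t * u t - v t * v t) / u t ^ 2)
    (h.continuousOn_v.div h.continuousOn_u fun t ht => (hpos t ht).ne')
    (fun t ht => ((h.hasDerivAt_v (Ico_subset_Icc_self ht)).div
      (h.hasDerivAt_u (Ico_subset_Icc_self ht))
      (hpos t (Ico_subset_Icc_self ht)).ne').hasDerivWithinAt)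
    (by simp [h.v_zero]) (by fun_prop)
    (fun t _ => (((hasDerivAt_id t).const_mul (l ^ 2)).congr_deriv (by simp)).hasDerivWithinAt)
    (fun t ht => by
      have := hpos t (Ico_subset_Icc_self ht)
      rw [div_le_iff₀ (by positivity)]
      have : 0 ≤ m * Real.exp (-2 * t) * u t ^ 2 := by positivity
      nlinarith [sq_nonneg (v t)])
    (x := L) ⟨hL, le_rfl⟩
  exact (div_le_iff₀ (hpos L ⟨hL, le_rfl⟩)).1 key

end ModeSol

/-! ### The form of the mode 0 on functions vanishing at one point -/

/-- Restricted to functions vanishing at some point of `[0, L]`, the radial form of the mode `0`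
with eigenvalue parameter `m` and boundary parameter `η` is non-negative. -/
def NonnegOnHyperplane (m η L : ℝ) : Prop :=
  ∃ s ∈ Icc 0 L, ∀ a a' : ℝ → ℝ, (∀ t ∈ Icc 0 L, HasDerivAt a (a' t) t) →
    ContinuousOn a' (Icc 0 L) → a s = 0 →
    0 ≤ (∫ t in (0:ℝ)..L, (a' t ^ 2 - m * Real.exp (-2 * t) * a t ^ 2)) + η * a L ^ 2

theorem NonnegOnHyperplane.mono {m m' η η' L : ℝ} (hL : 0 ≤ L) (h : NonnegOnHyperplane m η L)
    (hm : m' ≤ m) (hη : η ≤ η') : NonnegOnHyperplane m' η' L := by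
  obtain ⟨s, hs, H⟩ := h
  refine ⟨s, hs, fun a a' ha ha' has => (H a a' ha ha' has).trans ?_⟩
  have hac : ContinuousOn a (Icc 0 L) := fun t ht => (ha t ht).continuousAt.continuousWithinAt
  refine add_le_add (intervalIntegral.integral_mono_on hL ?_ ?_ fun t ht => ?_) (by gcongr)
  · refine ContinuousOn.intervalIntegrable ?_
    rw [uIcc_of_le hL]
    fun_prop
  · refine ContinuousOn.intervalIntegrable ?_
    rw [uIcc_of_le hL]
    fun_prop
  · gcongr

/-- Cauchy–Schwarz, read off from the nonnegative variance of `a'` about its mean `a(B) / (B - A)`.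
-/
theorem sq_le_mul_integral_sq_deriv {A B : ℝ} (hAB : A < B) {a a' : ℝ → ℝ}
    (ha : ∀ t ∈ Icc A B, HasDerivAt a (a' t) t) (ha' : ContinuousOn a' (Icc A B)) (hA : a A = 0) :
    a B ^ 2 / (B - A) ≤ ∫ t in A..B, a' t ^ 2 := by
  have hBA : 0 < B - A := sub_pos.2 hAB
  have h1 : ∫ t in A..B, a' t = a B := by
    rw [intervalIntegral.integral_eq_sub_of_hasDerivAt
      (fun t ht => ha t (by rwa [uIcc_of_le hAB.le] at ht))
      (ContinuousOn.intervalIntegrable (by rwa [uIcc_of_le hAB.le])), hA, sub_zero]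
  have hi : IntervalIntegrable a' volume A B :=
    ContinuousOn.intervalIntegrable (by rwa [uIcc_of_le hAB.le])
  have hi2 : IntervalIntegrable (fun t => a' t ^ 2) volume A B :=
    ContinuousOn.intervalIntegrable (by rw [uIcc_of_le hAB.le]; fun_prop)
  have h2 : 0 ≤ ∫ t in A..B, (a' t - a B / (B - A)) ^ 2 :=
    intervalIntegral.integral_nonneg hAB.le fun t _ => sq_nonneg _
  have h3 : ∫ t in A..B, (a' t - a B / (B - A)) ^ 2 =
      (∫ t in A..B, a' t ^ 2) - 2 * (a B / (B - A)) * a B + (a B / (B - A)) ^ 2 * (B - A) := by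
    have : ∀ t, (a' t - a B / (B - A)) ^ 2 =
        a' t ^ 2 - 2 * (a B / (B - A)) * a' t + (a B / (B - A)) ^ 2 := fun t => by ring
    simp_rw [this]
    rw [intervalIntegral.integral_add (hi2.sub (hi.const_mul _)) (by simp),
      intervalIntegral.integral_sub hi2 (hi.const_mul _), intervalIntegral.integral_const_mul, h1,
      intervalIntegral.integral_const, smul_eq_mul]
    ring
  rw [h3] at h2
  have h4 : a B / (B - A) * (B - A) = a B := div_mul_cancel₀ _ hBA.ne'
  have h5 : a B ^ 2 / (B - A) = a B / (B - A) * a B := by ring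
  have h6 : (a B / (B - A)) ^ 2 * (B - A) = a B / (B - A) * a B := by
    linear_combination (a B / (B - A)) * h4
  rw [h5]
  linarith

/-- The mass term has the good sign, so only `η a(L)²` has to be absorbed. A zero at distance `δ`
from the end makes the Dirichlet integral at least `a(L)² / δ`, which beats any given `η` for small
`δ`. -/
theorem nonnegOnHyperplane_of_nonpos {m L : ℝ} (hL : 0 < L) (hm : m ≤ 0) (η : ℝ) :
    NonnegOnHyperplane m η L := by
  set δ := min L (1 / (|η| + 1)) with hδ
  have hδ0 : 0 < δ := lt_min hL (by positivity)
  have hδL : δ ≤ L := min_le_left _ _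
  refine ⟨L - δ, ⟨by linarith, by linarith⟩, fun a a' ha ha' has => ?_⟩
  have hac : ContinuousOn a (Icc 0 L) := fun t ht => (ha t ht).continuousAt.continuousWithinAt
  have hsub : Icc (L - δ) L ⊆ Icc 0 L := Icc_subset_Icc (by linarith) le_rfl
  have h1 := sq_le_mul_integral_sq_deriv (by linarith : L - δ < L)
    (fun t ht => ha t (hsub ht)) (ha'.mono hsub) has
  have h2 : ∫ t in (L - δ)..L, a' t ^ 2 ≤ ∫ t in (0:ℝ)..L, a' t ^ 2 := by
    refine intervalIntegral.integral_mono_interval (by linarith) (by linarith) le_rfl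
      (Filter.Eventually.of_forall fun t => sq_nonneg _) (ContinuousOn.intervalIntegrable ?_)
    rw [uIcc_of_le hL.le]
    fun_prop
  have h3 : ∫ t in (0:ℝ)..L, a' t ^ 2 ≤
      ∫ t in (0:ℝ)..L, (a' t ^ 2 - m * Real.exp (-2 * t) * a t ^ 2) := by
    refine intervalIntegral.integral_mono_on hL.le (ContinuousOn.intervalIntegrable ?_)
      (ContinuousOn.intervalIntegrable ?_) fun t _ => ?_
    · rw [uIcc_of_le hL.le]
      fun_prop
    · rw [uIcc_of_le hL.le]
      fun_prop
    · have : 0 ≤ -m * Real.exp (-2 * t) * a t ^ 2 :=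
        mul_nonneg (mul_nonneg (by linarith) (Real.exp_pos _).le) (sq_nonneg _)
      linarith
  have h4 : (|η| + 1) * a L ^ 2 ≤ a L ^ 2 / (L - (L - δ)) := by
    rw [sub_sub_cancel, le_div_iff₀ hδ0]
    have : δ * (|η| + 1) ≤ 1 := by
      calc δ * (|η| + 1) ≤ 1 / (|η| + 1) * (|η| + 1) := by gcongr; exact min_le_right _ _
        _ = 1 := div_mul_cancel₀ _ (by positivity)
    nlinarith [sq_nonneg (a L)]
  nlinarith [neg_abs_le η, sq_nonneg (a L)]

/-- A zero at the midpoint splits the interval into two halves, on which Picone's inequality is used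
with `cos (σ t)` and `sin (σ (t - L/2))`. For `σ = 2 / L` the arguments stay in `[0, 1]`, so both
are positive inside their halves. The boundary term at `L` is `σ cot 1 ≥ 1 / L`, and `e^{-2t} ≤ 1`
permits replacing the weight by 1. -/
theorem nonnegOnHyperplane_of_small {m η L : ℝ} (hL : 0 < L) (hm : m ≤ 4 / L ^ 2)
    (hη : -(1 / L) ≤ η) : NonnegOnHyperplane m η L := by
  suffices h : NonnegOnHyperplane (4 / L ^ 2) (-(1 / L)) L from h.mono hL.le hm hη
  set σ := 2 / L with hσ
  have hσ0 : 0 < σ := by positivity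
  have hσL : σ * L = 2 := div_mul_cancel₀ _ hL.ne'
  have hσ2 : 4 / L ^ 2 = σ ^ 2 := by rw [hσ]; ring
  refine ⟨L / 2, ⟨by linarith, by linarith⟩, fun a a' ha ha' has => ?_⟩
  have hac : ContinuousOn a (Icc 0 L) := fun t ht => (ha t ht).continuousAt.continuousWithinAt
  have hs1 : Icc 0 (L / 2) ⊆ Icc 0 L := Icc_subset_Icc le_rfl (by linarith)
  have hs2 : Icc (L / 2) L ⊆ Icc 0 L := Icc_subset_Icc (by linarith) le_rfl
  have hpi : 3 < Real.pi := Real.pi_gt_three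
  have hleft := picone_le_integral (A := 0) (B := L / 2) (by linarith)
    (u := fun t => Real.cos (σ * t)) (v := fun t => -(σ * Real.sin (σ * t)))
    (q := fun _ => -σ ^ 2) (a := a) (a' := a')
    (fun t _ => (((hasDerivAt_id t).const_mul σ).cos).congr_deriv (by simp; ring))
    (fun t _ => ((((hasDerivAt_id t).const_mul σ).sin).const_mul σ).neg.congr_deriv
      (by simp; ring))
    (fun t ht => (Real.cos_pos_of_mem_Ioo ⟨by nlinarith [ht.1], by nlinarith [ht.2]⟩).ne')
    (fun t ht => ha t (hs1 ht)) (ha'.mono hs1) continuousOn_const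
    (by
      have := hac.mono hs1
      refine ContinuousOn.div (by fun_prop) (by fun_prop) fun t ht => ?_
      exact (Real.cos_pos_of_mem_Ioo ⟨by nlinarith [ht.1], by nlinarith [ht.2]⟩).ne')
  have hsin : ∀ t ∈ Ioc (L / 2) L, 0 < Real.sin (σ * (t - L / 2)) := fun t ht =>
    Real.sin_pos_of_pos_of_lt_pi (mul_pos hσ0 (by linarith [ht.1])) (by nlinarith [ht.2])
  have hder : ∀ t, HasDerivAt (fun t => Real.sin (σ * (t - L / 2)))
      (σ * Real.cos (σ * (t - L / 2))) t := fun t =>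
    ((((hasDerivAt_id t).sub_const (L / 2)).const_mul σ).sin).congr_deriv (by simp; ring)
  have hright := picone_le_integral (A := L / 2) (B := L) (by linarith)
    (u := fun t => Real.sin (σ * (t - L / 2))) (v := fun t => σ * Real.cos (σ * (t - L / 2)))
    (q := fun _ => -σ ^ 2) (a := a) (a' := a')
    (fun t _ => hder t)
    (fun t _ => (((((hasDerivAt_id t).sub_const (L / 2)).const_mul σ).cos).const_mul
      σ).congr_deriv (by simp; ring))
    (fun t ht => (hsin t ⟨ht.1, ht.2.le⟩).ne')
    (fun t ht => ha t (hs2 ht)) (ha'.mono hs2) continuousOn_const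
    (by
      intro t ht
      rcases ht.1.eq_or_lt with h | h
      · subst h
        refine (continuousAt_picone_of_zero (hder _) (by fun_prop) (ha _ (hs2 ht)) (by simp) has
          (by simp [hσ0.ne'])).continuousWithinAt
      · refine ContinuousWithinAt.div ?_ ?_ (hsin t ⟨h, ht.2⟩).ne'
        · have := (hac.mono hs2) t ht
          have h2 : Continuous fun t => σ * Real.cos (σ * (t - L / 2)) := by fun_prop
          exact h2.continuousWithinAt.mul (this.pow 2)
        · exact (hder t).continuousAt.continuousWithinAt)
  have hσhalf : σ * (L - L / 2) = 1 := by linarith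
  simp only [has, hσhalf, mul_zero, Real.sin_zero, neg_zero, zero_mul] at hleft hright
  norm_num at hleft hright
  have hI1 : IntervalIntegrable (fun t => a' t ^ 2 + -(σ ^ 2 * a t ^ 2)) volume 0 (L / 2) := by
    have := hac.mono hs1
    have := ha'.mono hs1
    refine ContinuousOn.intervalIntegrable ?_
    rw [uIcc_of_le (by linarith)]
    fun_prop
  have hI2 : IntervalIntegrable (fun t => a' t ^ 2 + -(σ ^ 2 * a t ^ 2)) volume (L / 2) L := by
    have := hac.mono hs2
    have := ha'.mono hs2
    refine ContinuousOn.intervalIntegrable ?_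
    rw [uIcc_of_le (by linarith)]
    fun_prop
  have hsum := intervalIntegral.integral_add_adjacent_intervals hI1 hI2
  have hmono : ∫ t in (0:ℝ)..L, (a' t ^ 2 + -(σ ^ 2 * a t ^ 2)) ≤
      ∫ t in (0:ℝ)..L, (a' t ^ 2 - 4 / L ^ 2 * Real.exp (-2 * t) * a t ^ 2) := by
    refine intervalIntegral.integral_mono_on hL.le (hI1.trans hI2)
      (ContinuousOn.intervalIntegrable ?_) fun t ht => ?_
    · rw [uIcc_of_le hL.le]
      fun_prop
    · rw [hσ2]
      have : Real.exp (-2 * t) ≤ 1 := Real.exp_le_one_iff.2 (by linarith [ht.1])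
      have : σ ^ 2 * Real.exp (-2 * t) * a t ^ 2 ≤ σ ^ 2 * 1 * a t ^ 2 := by gcongr
      linarith
  have hcot : 1 / L * a L ^ 2 ≤ σ * Real.cos 1 * a L ^ 2 / Real.sin 1 := by
    have h1 : 1 / 2 ≤ Real.cos 1 := by
      have := Real.one_sub_sq_div_two_le_cos (x := 1)
      linarith
    have h2 : 0 < Real.sin 1 := Real.sin_pos_of_pos_of_lt_pi one_pos (by linarith)
    have h3 := Real.sin_le_one 1
    have h4 : 1 / L = σ / 2 := by rw [hσ]; ring
    rw [le_div_iff₀ h2, h4]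
    have h5 : 0 ≤ a L ^ 2 := sq_nonneg _
    calc σ / 2 * a L ^ 2 * Real.sin 1 ≤ σ / 2 * a L ^ 2 * 1 := by gcongr
      _ = σ * (1 / 2) * a L ^ 2 := by ring
      _ ≤ σ * Real.cos 1 * a L ^ 2 := by gcongr
  linarith

theorem ModeSol.eigenvalue_pos_of_dirichlet {l m L : ℝ} (hL : 0 < L) {u v : ℝ → ℝ}
    (h : ModeSol l m L u v) (hu : ∀ t ∈ Ico 0 L, 0 < u t) (huL : u L = 0) : 0 < m := by
  by_contra hm
  have := h.one_le_of_potential_nonneg ⟨hL.le, le_rfl⟩ hu fun t _ => by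
    nlinarith [sq_nonneg l, Real.exp_pos (-2 * t), not_lt.1 hm]
  linarith

/-- A Dirichlet eigenvalue of the mode `k` bounds the first eigenvalues of lower modes. -/
theorem ModeSol.le_of_dirichlet {l k m M L : ℝ} (hL : 0 < L) (hlk : l ^ 2 ≤ k ^ 2)
    {f g u v : ℝ → ℝ} (h : ModeSol k M L f g) (hfL : f L = 0)
    (hs : ModeSol l m L u v) (hpos : ∀ t ∈ Icc 0 L, 0 < u t) : m ≤ M := by
  by_contra! hcon
  have hfc := h.continuousOn_u
  have hgc := h.continuousOn_v
  -- The Dirichlet eigenfunction `f` is the test function: its form for `(l, m)` is nonnegative, its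
  -- form for `(k, M)` is 0, and `m > M` would make the former strictly smaller.
  have h1 := hs.picone hL hpos (fun t ht => h.hasDerivAt_u ht) h.continuousOn_v
  have h2 := h.integral_energy hL.le
  rw [hfL, zero_mul] at h2
  have h3 : ∫ t in (0:ℝ)..L, (g t ^ 2 + (l ^ 2 - m * Real.exp (-2 * t)) * f t ^ 2) <
      ∫ t in (0:ℝ)..L, (g t ^ 2 + (k ^ 2 - M * Real.exp (-2 * t)) * f t ^ 2) := by
    refine intervalIntegral.integral_lt_integral_of_continuousOn_of_le_of_exists_lt hL
      (by fun_prop) (by fun_prop) (fun t _ => ?_) ⟨0, ⟨le_rfl, hL.le⟩, ?_⟩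
    · have : M * Real.exp (-2 * t) ≤ m * Real.exp (-2 * t) := by gcongr
      have : (l ^ 2 - m * Real.exp (-2 * t)) ≤ (k ^ 2 - M * Real.exp (-2 * t)) := by linarith
      nlinarith [sq_nonneg (f t)]
    · simp [h.u_zero]
      linarith
  rw [hfL] at h1
  norm_num at h1
  norm_num at h2 h3
  linarith

/-- Below the first Dirichlet eigenvalue of the mode `2`, the radial form of the mode `0` has at
most one negative direction. -/
theorem ModeSol.nonnegOnHyperplane_of_dirichlet {M L : ℝ} (hL : 0 < L) {f g : ℝ → ℝ}
    (h : ModeSol 2 M L f g) (hf : ∀ t ∈ Ico 0 L, 0 < f t) (hfL : f L = 0) :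
    ∃ c > 0, NonnegOnHyperplane M (-c) L := by
  have hM := h.eigenvalue_pos_of_dirichlet hL hf hfL
  obtain ⟨ρ, hρ, hs⟩ := modeSol_of_pruferAngle (l := 0) hL (pruferAngle_zero hL 0 M)
    (hasDerivAt_pruferAngle hL 0 M)
  set y := fun t => ρ t * Real.cos (pruferAngle hL 0 M t)
  set w := fun t => -(ρ t * Real.sin (pruferAngle hL 0 M t))
  have hyc := hs.continuousOn_u
  have hwc := hs.continuousOn_v
  have hee : ∀ t : ℝ, Real.exp (2 * t) * Real.exp (-2 * t) = 1 := fun t => by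
    rw [← Real.exp_add]; simp
  -- the raised solution, which belongs to the mode `2`
  set z := fun t => -M * y t + 2 * Real.exp (2 * t) * w t with hz
  have hexp : ∀ t : ℝ, HasDerivAt (fun t => Real.exp (2 * t)) (2 * Real.exp (2 * t)) t := fun t =>
    (((hasDerivAt_id t).const_mul 2).exp).congr_deriv (by simp; ring)
  have hdz : ∀ t ∈ Icc 0 L, HasDerivAt z (2 * z t - M * w t) t := fun t ht => by
    refine (((hs.hasDerivAt_u ht).const_mul (-M)).add
      (((hexp t).const_mul 2).mul (hs.hasDerivAt_v ht))).congr_deriv ?_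
    simp only [hz]
    linear_combination (-2 * M * y t) * hee t
  have hzc : ContinuousOn z (Icc 0 L) := fun t ht => (hdz t ht).continuousAt.continuousWithinAt
  -- `z` is `β² (∂_r² - r⁻¹ ∂_r) y`, up to a constant the radial factor of `(∂_x + i ∂_y)² y`. That
  -- operator commutes with the Laplacian and raises the angular frequency by 2.
  have hdz2 : ∀ t ∈ Icc 0 L, HasDerivAt (fun t => 2 * z t - M * w t)
      ((2 ^ 2 - M * Real.exp (-2 * t)) * z t) t := fun t ht => by
    refine (((hdz t ht).const_mul 2).sub ((hs.hasDerivAt_v ht).const_mul M)).congr_deriv ?_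
    simp only [hz]
    linear_combination (2 * M * w t) * hee t
  -- The Wronskian of `z` and `f` is constant, as both solve the equation of the mode 2 with the
  -- same `M`.
  have hW : ∀ t ∈ Icc 0 L, (2 * z t - M * w t) * f t - z t * g t = -2 * M := by
    have hd : ∀ t ∈ Icc 0 L, HasDerivAt (fun t => (2 * z t - M * w t) * f t - z t * g t) 0 t := by
      intro t ht
      refine (((hdz2 t ht).mul (h.hasDerivAt_u ht)).sub
        ((hdz t ht).mul (h.hasDerivAt_v ht))).congr_deriv ?_
      ring
    intro t ht
    have := constant_of_has_deriv_right_zero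
      (fun t ht => (hd t ht).continuousAt.continuousWithinAt)
      (fun t ht => (hd t (Ico_subset_Icc_self ht)).hasDerivWithinAt) t ht
    rw [this]
    simp [hz, h.u_zero, h.v_zero, hs.u_zero, hs.v_zero]
  -- By the Wronskian `(z / f)' = -2 M / f²` is negative, and `z / f` starts at `-M`; hence `z < 0`
  -- before `L`.
  have hzf : ∀ t ∈ Ico 0 L, z t ≤ -M * f t := by
    intro t ht
    have hsub : Icc 0 t ⊆ Icc 0 L := Icc_subset_Icc le_rfl ht.2.le
    have hfpos : ∀ s ∈ Icc 0 t, 0 < f s := fun s hs => hf s ⟨hs.1, hs.2.trans_lt ht.2⟩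
    have := image_le_of_deriv_right_le_deriv_boundary (a := 0) (b := t)
      (f := fun s => z s / f s) (B := fun _ => -M) (B' := fun _ => 0)
      (f' := fun s => ((2 * z s - M * w s) * f s - z s * g s) / f s ^ 2)
      ((hzc.mono hsub).div (h.continuousOn_u.mono hsub) fun s hs => (hfpos s hs).ne')
      (fun s hs => ((hdz s (hsub (Ico_subset_Icc_self hs))).div
        (h.hasDerivAt_u (hsub (Ico_subset_Icc_self hs)))
        (hfpos s (Ico_subset_Icc_self hs)).ne').hasDerivWithinAt)
      (by simp [hz, h.u_zero, hs.u_zero, hs.v_zero]) continuousOn_const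
      (fun s _ => hasDerivWithinAt_const _ _ _)
      (fun s hs => by
        rw [hW s (hsub (Ico_subset_Icc_self hs))]
        exact div_nonpos_of_nonpos_of_nonneg (by linarith) (sq_nonneg _))
      (x := t) ⟨ht.1, le_rfl⟩
    exact (div_le_iff₀ (hfpos t ⟨ht.1, le_rfl⟩)).1 this
  -- `z` is the derivative of `e^{2t} w`, so `w < 0`. Thus `y` is strictly decreasing and has at
  -- most one zero.
  have hwneg : ∀ t ∈ Ioc 0 L, w t < 0 := by
    have hd : ∀ t ∈ Icc 0 L, HasDerivAt (fun t => Real.exp (2 * t) * w t) (z t) t := by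
      intro t ht
      refine ((hexp t).mul (hs.hasDerivAt_v ht)).congr_deriv ?_
      simp only [hz]
      linear_combination (-M * y t) * hee t
    have hanti : StrictAntiOn (fun t => Real.exp (2 * t) * w t) (Icc 0 L) := by
      refine strictAntiOn_of_hasDerivWithinAt_neg (convex_Icc 0 L)
        (fun t ht => (hd t ht).continuousAt.continuousWithinAt) (f' := z)
        (fun t ht => ?_) (fun t ht => ?_) <;> rw [interior_Icc] at ht
      · exact (hd t (Ioo_subset_Icc_self ht)).hasDerivWithinAt
      · have h1 := hzf t (Ioo_subset_Ico_self ht)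
        have h2 := hf t (Ioo_subset_Ico_self ht)
        nlinarith
    intro t ht
    have := hanti ⟨le_rfl, hL.le⟩ (Ioc_subset_Icc_self ht) ht.1
    simp only [hs.v_zero, mul_zero] at this
    by_contra hcon
    have : 0 ≤ Real.exp (2 * t) * w t := mul_nonneg (Real.exp_pos _).le (not_lt.1 hcon)
    linarith
  have hyanti : StrictAntiOn y (Icc 0 L) := by
    refine strictAntiOn_of_hasDerivWithinAt_neg (convex_Icc 0 L) hyc (f' := w)
      (fun t ht => ?_) (fun t ht => ?_) <;> rw [interior_Icc] at ht
    · exact (hs.hasDerivAt_u (Ioo_subset_Icc_self ht)).hasDerivWithinAt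
    · exact hwneg t (Ioo_subset_Ioc_self ht)
  -- the form on `[0, s]` for functions vanishing at the end point
  have hqc : Continuous fun t : ℝ => (0:ℝ) ^ 2 - M * Real.exp (-2 * t) := by fun_prop
  have hinner : ∀ s ∈ Ioc 0 L, (∀ t ∈ Ico 0 s, 0 < y t) → 0 ≤ y s → ∀ a a' : ℝ → ℝ,
      (∀ t ∈ Icc 0 L, HasDerivAt a (a' t) t) → ContinuousOn a' (Icc 0 L) → a s = 0 →
      0 ≤ ∫ t in (0:ℝ)..s, (a' t ^ 2 - M * Real.exp (-2 * t) * a t ^ 2) := by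
    intro s hsL hy hys a a' ha ha' has
    have hsub : Icc 0 s ⊆ Icc 0 L := Icc_subset_Icc le_rfl hsL.2
    have hac : ContinuousOn a (Icc 0 L) := fun t ht => (ha t ht).continuousAt.continuousWithinAt
    have := picone_le_integral hsL.1.le
      (fun t ht => hs.hasDerivAt_u (hsub (Ioo_subset_Icc_self ht)))
      (fun t ht => hs.hasDerivAt_v (hsub (Ioo_subset_Icc_self ht)))
      (fun t ht => (hy t (Ioo_subset_Ico_self ht)).ne') (fun t ht => ha t (hsub ht))
      (ha'.mono hsub) hqc.continuousOn ?_
    · simp only [has, hs.v_zero] at this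
      norm_num at this
      convert this using 2
      ext t
      norm_num
      ring
    · intro t ht
      rcases eq_or_ne (y t) 0 with h0 | h0
      · have hts : t = s := by
          by_contra hne
          exact (hy t ⟨ht.1, lt_of_le_of_ne ht.2 hne⟩).ne' h0
        subst hts
        exact (continuousAt_picone_of_zero (hs.hasDerivAt_u (hsub ht))
          (hs.hasDerivAt_v (hsub ht)).continuousAt (ha t (hsub ht)) h0 has
          (hwneg t ⟨hsL.1, hsL.2⟩).ne).continuousWithinAt
      · exact (((hwc.mono hsub) t ht).mul (((hac.mono hsub) t ht).pow 2)).div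
          ((hyc.mono hsub) t ht) h0
  -- If `y` stays positive before `L`, take `s = L`: the boundary term vanishes and any `c` works.
  -- Otherwise `s` is the zero of `y`, and the boundary term of Picone's inequality on `[s, L]`
  -- gives `c = w(L) / y(L) > 0`.
  rcases le_or_gt 0 (y L) with hyL | hyL
  · refine ⟨1, one_pos, L, ⟨hL.le, le_rfl⟩, fun a a' ha ha' has => ?_⟩
    have := hinner L ⟨hL, le_rfl⟩ (fun t ht => hyL.trans_lt
      (hyanti (Ico_subset_Icc_self ht) ⟨hL.le, le_rfl⟩ ht.2)) hyL a a' ha ha' has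
    simpa [has] using this
  · obtain ⟨s, hsm, hys⟩ : ∃ s ∈ Icc 0 L, y s = 0 :=
      intermediate_value_Icc' hL.le hyc ⟨hyL.le, by rw [hs.u_zero]; exact zero_le_one⟩
    have hs0 : 0 < s := lt_of_le_of_ne hsm.1 fun h0 => by
      rw [← h0, hs.u_zero] at hys
      exact one_ne_zero hys
    have hsL : s < L := lt_of_le_of_ne hsm.2 fun h0 => by
      rw [h0] at hys
      exact hyL.ne hys
    refine ⟨w L / y L, div_pos_of_neg_of_neg (hwneg L ⟨hL, le_rfl⟩) hyL, s, hsm,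
      fun a a' ha ha' has => ?_⟩
    have hac : ContinuousOn a (Icc 0 L) := fun t ht => (ha t ht).continuousAt.continuousWithinAt
    have h1 := hinner s ⟨hs0, hsm.2⟩ (fun t ht => by
      rw [← hys]
      exact hyanti ⟨ht.1, ht.2.le.trans hsm.2⟩ hsm ht.2) hys.ge a a' ha ha' has
    have hsub : Icc s L ⊆ Icc 0 L := Icc_subset_Icc hsm.1 le_rfl
    have hneg : ∀ t ∈ Ioc s L, y t < 0 := fun t ht => by
      rw [← hys]
      exact hyanti hsm ⟨hsm.1.trans ht.1.le, ht.2⟩ ht.1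
    have h2 := picone_le_integral hsL.le
      (fun t ht => hs.hasDerivAt_u (hsub (Ioo_subset_Icc_self ht)))
      (fun t ht => hs.hasDerivAt_v (hsub (Ioo_subset_Icc_self ht)))
      (fun t ht => (hneg t (Ioo_subset_Ioc_self ht)).ne) (fun t ht => ha t (hsub ht))
      (ha'.mono hsub) hqc.continuousOn (by
        intro t ht
        rcases ht.1.eq_or_lt with h0 | h0
        · subst h0
          exact (continuousAt_picone_of_zero (hs.hasDerivAt_u (hsub ht))
            (hs.hasDerivAt_v (hsub ht)).continuousAt (ha s (hsub ht)) hys has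
            (hwneg s ⟨hs0, hsm.2⟩).ne).continuousWithinAt
        · exact (((hwc.mono hsub) t ht).mul (((hac.mono hsub) t ht).pow 2)).div
            ((hyc.mono hsub) t ht) (hneg t ⟨h0, ht.2⟩).ne)
    have h3 : ∫ t in s..L, (a' t ^ 2 + ((0:ℝ) ^ 2 - M * Real.exp (-2 * t)) * a t ^ 2) =
        ∫ t in s..L, (a' t ^ 2 - M * Real.exp (-2 * t) * a t ^ 2) := by
      congr 1
      ext t
      ring
    rw [h3, has] at h2
    have hcont : ContinuousOn (fun t => a' t ^ 2 - M * Real.exp (-2 * t) * a t ^ 2) (Icc 0 L) := by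
      fun_prop
    have hsum := intervalIntegral.integral_add_adjacent_intervals (μ := volume)
      (ContinuousOn.intervalIntegrable (u := fun t => a' t ^ 2 - M * Real.exp (-2 * t) * a t ^ 2)
        (a := 0) (b := s)
        (by rw [uIcc_of_le hsm.1]; exact hcont.mono (Icc_subset_Icc le_rfl hsm.2)))
      (ContinuousOn.intervalIntegrable (a := s) (b := L)
        (by rw [uIcc_of_le hsm.2]; exact hcont.mono hsub))
    have h4 : w L / y L * a L ^ 2 = w L * a L ^ 2 / y L := by ring
    rw [← hsum, neg_mul, h4]
    simp only [zero_pow two_ne_zero, mul_zero, zero_div, sub_zero] at h2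
    linarith

/-! ### Fourier coefficients of periodic functions -/

/-- The `n`-th cosine coefficient. -/
def cosCoeff (F : ℝ → ℝ) (n : ℤ) : ℝ := ∫ θ in (-Real.pi)..Real.pi, F θ * Real.cos (n * θ)

/-- The `n`-th sine coefficient. -/
def sinCoeff (F : ℝ → ℝ) (n : ℤ) : ℝ := ∫ θ in (-Real.pi)..Real.pi, F θ * Real.sin (n * θ)

/-- The squared modulus of the `n`-th Fourier coefficient, up to normalisation. -/
def sqCoeff (F : ℝ → ℝ) (n : ℤ) : ℝ := cosCoeff F n ^ 2 + sinCoeff F n ^ 2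

theorem norm_fourierCoeffOn_sq {F : ℝ → ℝ} (hF : Continuous F) (n : ℤ)
    (h : -Real.pi < Real.pi) :
    ‖fourierCoeffOn h (fun θ => (F θ : ℂ)) n‖ ^ 2 = (1 / (2 * Real.pi)) ^ 2 * sqCoeff F n := by
  have hpi : (Real.pi : ℂ) ≠ 0 := by exact_mod_cast Real.pi_ne_zero
  have h1 : ∫ x in (-Real.pi)..Real.pi,
      fourier (-n) (x : AddCircle (Real.pi - -Real.pi)) • (F x : ℂ) =
      (cosCoeff F n : ℂ) - (sinCoeff F n : ℂ) * Complex.I := by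
    have h2 : ∀ x : ℝ, fourier (-n) (x : AddCircle (Real.pi - -Real.pi)) • (F x : ℂ) =
        ((F x * Real.cos (n * x) : ℝ) : ℂ) - ((F x * Real.sin (n * x) : ℝ) : ℂ) * Complex.I := by
      intro x
      rw [fourier_coe_apply]
      have : 2 * (Real.pi : ℂ) * Complex.I * ((-n : ℤ) : ℂ) * (x : ℂ) /
          ((Real.pi - -Real.pi : ℝ) : ℂ) = ((-(n * x) : ℝ) : ℂ) * Complex.I := by
        push_cast
        field_simp
        ring
      rw [this, Complex.exp_mul_I, ← Complex.ofReal_cos, ← Complex.ofReal_sin, Real.cos_neg,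
        Real.sin_neg, smul_eq_mul]
      push_cast
      ring
    simp_rw [h2]
    rw [intervalIntegral.integral_sub (Continuous.intervalIntegrable (by fun_prop) _ _)
      (Continuous.intervalIntegrable (by fun_prop) _ _), intervalIntegral.integral_mul_const,
      intervalIntegral.integral_ofReal, intervalIntegral.integral_ofReal]
    rfl
  rw [fourierCoeffOn_eq_integral, h1, norm_smul, mul_pow, sub_neg_eq_add, ← two_mul,
    Real.norm_eq_abs, sq_abs]
  congr 1
  rw [← Complex.normSq_eq_norm_sq, sqCoeff, Complex.normSq_apply]
  simp
  ring

/-- Parseval's identity; the factor `2π` comes from leaving the coefficients unnormalised. -/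
theorem hasSum_sqCoeff {F : ℝ → ℝ} (hF : Continuous F) :
    HasSum (sqCoeff F) (2 * Real.pi * ∫ θ in (-Real.pi)..Real.pi, F θ ^ 2) := by
  have h : -Real.pi < Real.pi := by linarith [Real.pi_pos]
  have hL2 : MemLp (fun θ => (F θ : ℂ)) 2 (volume.restrict (Ioc (-Real.pi) Real.pi)) := by
    have hc : Continuous fun θ => (F θ : ℂ) := by fun_prop
    obtain ⟨C, hC⟩ := (isCompact_Icc (a := -Real.pi) (b := Real.pi)).exists_bound_of_continuousOn
      hc.continuousOn
    refine MemLp.of_bound hc.aestronglyMeasurable C ?_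
    filter_upwards [ae_restrict_mem measurableSet_Ioc] with θ hθ
    exact hC θ (Ioc_subset_Icc_self hθ)
  have h1 := (hasSum_sq_fourierCoeffOn h hL2).mul_left ((2 * Real.pi) ^ 2)
  have hpi := Real.pi_ne_zero
  have e1 : (fun i => (2 * Real.pi) ^ 2 * ‖fourierCoeffOn h (fun θ => (F θ : ℂ)) i‖ ^ 2) =
      sqCoeff F := by
    ext n
    rw [norm_fourierCoeffOn_sq hF]
    field_simp
  have e2 : (2 * Real.pi) ^ 2 * ((Real.pi - -Real.pi)⁻¹ •
      ∫ θ in (-Real.pi)..Real.pi, ‖(F θ : ℂ)‖ ^ 2) =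
      2 * Real.pi * ∫ θ in (-Real.pi)..Real.pi, F θ ^ 2 := by
    simp only [Complex.norm_real, Real.norm_eq_abs, sq_abs, smul_eq_mul, sub_neg_eq_add, ← two_mul]
    field_simp
  rwa [e1, e2] at h1

theorem sum_sqCoeff_le {F : ℝ → ℝ} (hF : Continuous F) (s : Finset ℤ) :
    ∑ n ∈ s, sqCoeff F n ≤ 2 * Real.pi * ∫ θ in (-Real.pi)..Real.pi, F θ ^ 2 :=
  sum_le_hasSum s (fun _ _ => add_nonneg (sq_nonneg _) (sq_nonneg _)) (hasSum_sqCoeff hF)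

theorem sqCoeff_deriv {F F' : ℝ → ℝ} (hF : ∀ θ, HasDerivAt F (F' θ) θ) (hF' : Continuous F')
    (hper : F (-Real.pi) = F Real.pi) (n : ℤ) : sqCoeff F' n = n ^ 2 * sqCoeff F n := by
  have hc : cosCoeff F' n = n * sinCoeff F n := by
    have h := intervalIntegral.integral_deriv_mul_eq_sub (a := -Real.pi) (b := Real.pi) (u := F)
      (u' := F') (v := fun θ => Real.cos (n * θ)) (v' := fun θ => -(n * Real.sin (n * θ)))
      (fun θ _ => hF θ)
      (fun θ _ => (((hasDerivAt_id θ).const_mul (n : ℝ)).cos).congr_deriv (by simp; ring))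
      (hF'.intervalIntegrable _ _) (Continuous.intervalIntegrable (by fun_prop) _ _)
    have hFc : Continuous F := continuous_iff_continuousAt.2 fun θ => (hF θ).continuousAt
    rw [intervalIntegral.integral_add (Continuous.intervalIntegrable (by fun_prop) _ _)
      (Continuous.intervalIntegrable (by fun_prop) _ _), hper] at h
    have h2 : ∫ θ in (-Real.pi)..Real.pi, F θ * -(n * Real.sin (n * θ)) = -(n * sinCoeff F n) := by
      rw [sinCoeff, ← intervalIntegral.integral_const_mul, ← intervalIntegral.integral_neg]
      congr 1
      ext θ
      ring
    rw [h2] at h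
    simp only [mul_neg, Real.cos_neg, sub_self] at h
    rw [cosCoeff]
    linarith
  have hs : sinCoeff F' n = -(n * cosCoeff F n) := by
    have h := intervalIntegral.integral_deriv_mul_eq_sub (a := -Real.pi) (b := Real.pi) (u := F)
      (u' := F') (v := fun θ => Real.sin (n * θ)) (v' := fun θ => n * Real.cos (n * θ))
      (fun θ _ => hF θ)
      (fun θ _ => (((hasDerivAt_id θ).const_mul (n : ℝ)).sin).congr_deriv (by simp; ring))
      (hF'.intervalIntegrable _ _) (Continuous.intervalIntegrable (by fun_prop) _ _)
    have hFc : Continuous F := continuous_iff_continuousAt.2 fun θ => (hF θ).continuousAt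
    rw [intervalIntegral.integral_add (Continuous.intervalIntegrable (by fun_prop) _ _)
      (Continuous.intervalIntegrable (by fun_prop) _ _), hper] at h
    have h2 : ∫ θ in (-Real.pi)..Real.pi, F θ * (n * Real.cos (n * θ)) = n * cosCoeff F n := by
      rw [cosCoeff, ← intervalIntegral.integral_const_mul]
      congr 1
      ext θ
      ring
    rw [h2] at h
    simp only [mul_neg, Real.sin_neg, Real.sin_int_mul_pi] at h
    rw [sinCoeff]
    linarith
  rw [sqCoeff, sqCoeff, hc, hs]
  ring

/-- Wirtinger's inequality with the defect of the first Fourier coefficients. -/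
theorem wirtinger_with_defect {F F' : ℝ → ℝ} (hF : ∀ θ, HasDerivAt F (F' θ) θ)
    (hF' : Continuous F') (hper : F (-Real.pi) = F Real.pi) (l : ℕ) :
    2 * Real.pi * ((l : ℝ) ^ 2 * ∫ θ in (-Real.pi)..Real.pi, F θ ^ 2) ≤
      2 * Real.pi * (∫ θ in (-Real.pi)..Real.pi, F' θ ^ 2) +
        ∑ n ∈ Finset.Ioo (-l : ℤ) l, ((l : ℝ) ^ 2 - n ^ 2) * sqCoeff F n := by
  have hFc : Continuous F := continuous_iff_continuousAt.2 fun θ => (hF θ).continuousAt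
  have h1 := (hasSum_sqCoeff hFc).mul_left ((l : ℝ) ^ 2)
  have h2 := hasSum_sqCoeff hF'
  -- By Parseval the difference of the two integrals is the sum of `(n² - l²) |c_n|²`, whose terms
  -- with `|n| ≥ l` are nonnegative.
  have h3 := sum_le_hasSum (Finset.Ioo (-l : ℤ) l) (fun n hn => ?_) (h2.sub h1)
  · have h4 : ∑ n ∈ Finset.Ioo (-l : ℤ) l, ((l : ℝ) ^ 2 - n ^ 2) * sqCoeff F n =
        -∑ n ∈ Finset.Ioo (-l : ℤ) l, (sqCoeff F' n - (l : ℝ) ^ 2 * sqCoeff F n) := by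
      rw [← Finset.sum_neg_distrib]
      refine Finset.sum_congr rfl fun n _ => ?_
      rw [sqCoeff_deriv hF hF' hper]
      ring
    rw [h4]
    linarith
  · rw [sqCoeff_deriv hF hF' hper]
    have h5 : (l : ℤ) ≤ |n| := by
      by_contra hcon
      exact hn (Finset.mem_Ioo.2 (abs_lt.1 (not_le.1 hcon)))
    have h6 : (l : ℝ) ^ 2 ≤ (n : ℝ) ^ 2 := by
      rw [← sq_abs (n : ℝ)]
      have : (l : ℝ) ≤ |(n : ℝ)| := by exact_mod_cast h5
      gcongr
    have : 0 ≤ sqCoeff F n := add_nonneg (sq_nonneg _) (sq_nonneg _)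
    nlinarith

/-! ### The lower bound on a strip -/

theorem hasDerivAt_integral_param {G G' : ℝ → ℝ → ℝ} (hG : Continuous (Function.uncurry G))
    (hG' : Continuous (Function.uncurry G')) (hd : ∀ t θ, HasDerivAt (fun t => G t θ) (G' t θ) t)
    (a b t : ℝ) : HasDerivAt (fun t => ∫ θ in a..b, G t θ) (∫ θ in a..b, G' t θ) t := by
  obtain ⟨C, hC⟩ := ((isCompact_closedBall t 1).prod (isCompact_uIcc (a := a)
    (b := b))).exists_bound_of_continuousOn hG'.continuousOn
  refine (intervalIntegral.hasDerivAt_integral_of_dominated_loc_of_deriv_le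
    (F := G) (F' := G') (bound := fun _ => C) (s := Metric.closedBall t 1)
    (Metric.closedBall_mem_nhds t one_pos) ?_ ?_ ?_ ?_ ?_ ?_).2
  · exact Filter.Eventually.of_forall fun s =>
      (hG.comp (Continuous.prodMk_right s)).aestronglyMeasurable
  · exact (hG.comp (Continuous.prodMk_right t)).intervalIntegrable _ _
  · exact (hG'.comp (Continuous.prodMk_right t)).aestronglyMeasurable
  · exact Filter.Eventually.of_forall fun θ hθ s hs => hC (s, θ) ⟨hs, uIoc_subset_uIcc hθ⟩
  · simp
  · exact Filter.Eventually.of_forall fun θ _ s _ => hd s θ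

theorem continuous_integral_param {G : ℝ → ℝ → ℝ} (hG : Continuous (Function.uncurry G))
    (a b : ℝ) : Continuous fun t => ∫ θ in a..b, G t θ :=
  intervalIntegral.continuous_parametric_intervalIntegral_of_continuous' hG a b

theorem hasDerivAt_cosCoeff {G G' : ℝ → ℝ → ℝ} (hG : Continuous (Function.uncurry G))
    (hG' : Continuous (Function.uncurry G')) (hd : ∀ t θ, HasDerivAt (fun t => G t θ) (G' t θ) t)
    (n : ℤ) (t : ℝ) : HasDerivAt (fun t => cosCoeff (G t) n) (cosCoeff (G' t) n) t :=
  hasDerivAt_integral_param (G := fun t θ => G t θ * Real.cos (n * θ))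
    (G' := fun t θ => G' t θ * Real.cos (n * θ))
    (hG.mul (by fun_prop : Continuous fun p : ℝ × ℝ => Real.cos (n * p.2)))
    (hG'.mul (by fun_prop : Continuous fun p : ℝ × ℝ => Real.cos (n * p.2)))
    (fun t θ => (hd t θ).mul_const _) _ _ t

theorem hasDerivAt_sinCoeff {G G' : ℝ → ℝ → ℝ} (hG : Continuous (Function.uncurry G))
    (hG' : Continuous (Function.uncurry G')) (hd : ∀ t θ, HasDerivAt (fun t => G t θ) (G' t θ) t)
    (n : ℤ) (t : ℝ) : HasDerivAt (fun t => sinCoeff (G t) n) (sinCoeff (G' t) n) t :=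
  hasDerivAt_integral_param (G := fun t θ => G t θ * Real.sin (n * θ))
    (G' := fun t θ => G' t θ * Real.sin (n * θ))
    (hG.mul (by fun_prop : Continuous fun p : ℝ × ℝ => Real.sin (n * p.2)))
    (hG'.mul (by fun_prop : Continuous fun p : ℝ × ℝ => Real.sin (n * p.2)))
    (fun t θ => (hd t θ).mul_const _) _ _ t

theorem continuous_cosCoeff {G : ℝ → ℝ → ℝ} (hG : Continuous (Function.uncurry G)) (n : ℤ) :
    Continuous fun t => cosCoeff (G t) n :=
  continuous_integral_param (G := fun t θ => G t θ * Real.cos (n * θ))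
    (hG.mul (by fun_prop : Continuous fun p : ℝ × ℝ => Real.cos (n * p.2))) _ _

theorem continuous_sinCoeff {G : ℝ → ℝ → ℝ} (hG : Continuous (Function.uncurry G)) (n : ℤ) :
    Continuous fun t => sinCoeff (G t) n :=
  continuous_integral_param (G := fun t θ => G t θ * Real.sin (n * θ))
    (hG.mul (by fun_prop : Continuous fun p : ℝ × ℝ => Real.sin (n * p.2))) _ _

theorem sqCoeff_sub_mul {F G : ℝ → ℝ} (hF : Continuous F) (hG : Continuous G) (w : ℝ) (n : ℤ) :
    sqCoeff (fun θ => F θ - w * G θ) n =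
      (cosCoeff F n - w * cosCoeff G n) ^ 2 + (sinCoeff F n - w * sinCoeff G n) ^ 2 := by
  have h1 : cosCoeff (fun θ => F θ - w * G θ) n = cosCoeff F n - w * cosCoeff G n := by
    simp only [cosCoeff, ← intervalIntegral.integral_const_mul]
    rw [← intervalIntegral.integral_sub (Continuous.intervalIntegrable (by fun_prop) _ _)
      (Continuous.intervalIntegrable (by fun_prop) _ _)]
    congr 1
    ext θ
    ring
  have h2 : sinCoeff (fun θ => F θ - w * G θ) n = sinCoeff F n - w * sinCoeff G n := by
    simp only [sinCoeff, ← intervalIntegral.integral_const_mul]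
    rw [← intervalIntegral.integral_sub (Continuous.intervalIntegrable (by fun_prop) _ _)
      (Continuous.intervalIntegrable (by fun_prop) _ _)]
    congr 1
    ext θ
    ring
  rw [sqCoeff, h1, h2]

/-- Jointly continuous functions on the plane of `(t, θ)` that are `2π`-periodic in `θ`, together
with their partial derivatives. -/
structure StripFunction (ψ ψt ψa : ℝ → ℝ → ℝ) : Prop where
  cont : Continuous (Function.uncurry ψ)
  cont_t : Continuous (Function.uncurry ψt)
  cont_a : Continuous (Function.uncurry ψa)
  deriv_t : ∀ t θ, HasDerivAt (fun t => ψ t θ) (ψt t θ) t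
  deriv_a : ∀ t θ, HasDerivAt (fun θ => ψ t θ) (ψa t θ) θ
  periodic : ∀ t, ψ t (-Real.pi) = ψ t Real.pi

/-- Pointwise in `t`, the energy of a strip function dominates a derivative plus the energies of
its first Fourier coefficients. -/
theorem StripFunction.energy_ge {ψ ψt ψa : ℝ → ℝ → ℝ} (h : StripFunction ψ ψt ψa) (l : ℕ)
    (m w t : ℝ) :
    2 * Real.pi * (((l : ℝ) ^ 2 - m - w ^ 2) * (∫ θ in (-Real.pi)..Real.pi, ψ t θ ^ 2) +
        w * ∫ θ in (-Real.pi)..Real.pi, 2 * ψ t θ * ψt t θ) +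
      ∑ n ∈ Finset.Ioo (-l : ℤ) l, ((cosCoeff (ψt t) n - w * cosCoeff (ψ t) n) ^ 2 +
        (sinCoeff (ψt t) n - w * sinCoeff (ψ t) n) ^ 2 - ((l : ℝ) ^ 2 - n ^ 2) * sqCoeff (ψ t) n) ≤
    2 * Real.pi * ∫ θ in (-Real.pi)..Real.pi, (ψt t θ ^ 2 + ψa t θ ^ 2 - m * ψ t θ ^ 2) := by
  have c0 : Continuous (ψ t) := h.cont.comp (Continuous.prodMk_right t)
  have c1 : Continuous (ψt t) := h.cont_t.comp (Continuous.prodMk_right t)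
  have c2 : Continuous (ψa t) := h.cont_a.comp (Continuous.prodMk_right t)
  have h1 := wirtinger_with_defect (h.deriv_a t) c2 (h.periodic t) l
  -- Bessel's inequality for `ψ_t - w ψ`: completing the square with a free number `w` keeps the low
  -- frequencies exactly and brings in `w` times the derivative of `∫ ψ²`. Later `w` is the
  -- logarithmic derivative of a mode solution.
  have h2 := sum_sqCoeff_le (F := fun θ => ψt t θ - w * ψ t θ) (by fun_prop)
    (Finset.Ioo (-l : ℤ) l)
  simp only [sqCoeff_sub_mul c1 c0] at h2
  have h3 : ∫ θ in (-Real.pi)..Real.pi, (ψt t θ - w * ψ t θ) ^ 2 =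
      (∫ θ in (-Real.pi)..Real.pi, ψt t θ ^ 2) -
        w * (∫ θ in (-Real.pi)..Real.pi, 2 * ψ t θ * ψt t θ) +
        w ^ 2 * ∫ θ in (-Real.pi)..Real.pi, ψ t θ ^ 2 := by
    rw [← intervalIntegral.integral_const_mul, ← intervalIntegral.integral_const_mul,
      ← intervalIntegral.integral_sub (Continuous.intervalIntegrable (by fun_prop) _ _)
      (Continuous.intervalIntegrable (by fun_prop) _ _),
      ← intervalIntegral.integral_add (Continuous.intervalIntegrable (by fun_prop) _ _)
      (Continuous.intervalIntegrable (by fun_prop) _ _)]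
    congr 1
    ext θ
    ring
  have h4 : ∫ θ in (-Real.pi)..Real.pi, (ψt t θ ^ 2 + ψa t θ ^ 2 - m * ψ t θ ^ 2) =
      (∫ θ in (-Real.pi)..Real.pi, ψt t θ ^ 2) + (∫ θ in (-Real.pi)..Real.pi, ψa t θ ^ 2) -
        m * ∫ θ in (-Real.pi)..Real.pi, ψ t θ ^ 2 := by
    rw [← intervalIntegral.integral_const_mul,
      ← intervalIntegral.integral_add (Continuous.intervalIntegrable (by fun_prop) _ _)
      (Continuous.intervalIntegrable (by fun_prop) _ _),
      ← intervalIntegral.integral_sub (Continuous.intervalIntegrable (by fun_prop) _ _)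
      (Continuous.intervalIntegrable (by fun_prop) _ _)]
  rw [Finset.sum_sub_distrib, h4]
  rw [h3] at h2
  linarith

theorem continuousOn_logDeriv_mul {L : ℝ} {w p D D' : ℝ → ℝ}
    (hw : ∀ t ∈ Icc 0 L, HasDerivAt w (p t - w t ^ 2) t) (hp : Continuous p)
    (hD : ∀ t, HasDerivAt D (D' t) t) (hD' : Continuous D') :
    ContinuousOn (fun t => (p t - w t ^ 2) * D t + w t * D' t) (Icc 0 L) := by
  have hwc : ContinuousOn w (Icc 0 L) := fun t ht => (hw t ht).continuousAt.continuousWithinAt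
  have hDc : Continuous D := continuous_iff_continuousAt.2 fun t => (hD t).continuousAt
  fun_prop

theorem integral_logDeriv_mul {L : ℝ} (hL : 0 ≤ L) {w p D D' : ℝ → ℝ}
    (hw : ∀ t ∈ Icc 0 L, HasDerivAt w (p t - w t ^ 2) t) (hp : Continuous p)
    (hD : ∀ t, HasDerivAt D (D' t) t) (hD' : Continuous D') :
    ∫ t in (0:ℝ)..L, ((p t - w t ^ 2) * D t + w t * D' t) = w L * D L - w 0 * D 0 := by
  rw [intervalIntegral.integral_eq_sub_of_hasDerivAt (f := fun t => w t * D t)]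
  · intro t ht
    rw [uIcc_of_le hL] at ht
    exact (hw t ht).mul (hD t)
  · refine ContinuousOn.intervalIntegrable ?_
    rw [uIcc_of_le hL]
    exact continuousOn_logDeriv_mul hw hp hD hD'

/-- Picone's inequality for all frequencies at least `l` at once. With `w = v / u`, their energy is
at least the integral of `(w D)'`, where `D(t)` is their squared mass at height `t`. The boundary
terms are 0 at `t = 0` and, with `η` added, `(w(L) + η) D(L) ≥ 0` at `t = L`. The frequencies below
`l` are covered by the assumption on the coefficients. -/
theorem StripFunction.form_nonneg {ψ ψt ψa : ℝ → ℝ → ℝ} (h : StripFunction ψ ψt ψa) {l : ℕ}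
    {m η L : ℝ} (hL : 0 < L) {u v : ℝ → ℝ} (hs : ModeSol l m L u v)
    (hpos : ∀ t ∈ Icc 0 L, 0 < u t) (hη : 0 ≤ v L + η * u L)
    (hnonneg : ∀ n ∈ Finset.Ioo (-l : ℤ) l,
      (0 ≤ (∫ t in (0:ℝ)..L, (cosCoeff (ψt t) n ^ 2 -
          m * Real.exp (-2 * t) * cosCoeff (ψ t) n ^ 2)) + η * cosCoeff (ψ L) n ^ 2) ∧
      0 ≤ (∫ t in (0:ℝ)..L, (sinCoeff (ψt t) n ^ 2 -
          m * Real.exp (-2 * t) * sinCoeff (ψ t) n ^ 2)) + η * sinCoeff (ψ L) n ^ 2) :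
    0 ≤ (∫ t in (0:ℝ)..L, ∫ θ in (-Real.pi)..Real.pi,
        (ψt t θ ^ 2 + ψa t θ ^ 2 - m * Real.exp (-2 * t) * ψ t θ ^ 2)) +
      η * ∫ θ in (-Real.pi)..Real.pi, ψ L θ ^ 2 := by
  have hLL : L ∈ Icc 0 L := ⟨hL.le, le_rfl⟩
  set s := Finset.Ioo (-l : ℤ) l with hsdef
  set w : ℝ → ℝ := fun t => v t / u t with hw
  have hwd : ∀ t ∈ Icc 0 L, HasDerivAt w
      ((l : ℝ) ^ 2 - m * Real.exp (-2 * t) - w t ^ 2) t := fun t ht => by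
    refine ((hs.hasDerivAt_v ht).div (hs.hasDerivAt_u ht) (hpos t ht).ne').congr_deriv ?_
    have := (hpos t ht).ne'
    simp only [hw]
    field_simp
  have hwc : ContinuousOn w (Icc 0 L) := fun t ht => (hwd t ht).continuousAt.continuousWithinAt
  set S : ℝ → ℝ := fun t => ∫ θ in (-Real.pi)..Real.pi, ψ t θ ^ 2 with hS
  set S' : ℝ → ℝ := fun t => ∫ θ in (-Real.pi)..Real.pi, 2 * ψ t θ * ψt t θ with hS'
  have hSd : ∀ t, HasDerivAt S (S' t) t := fun t =>
    hasDerivAt_integral_param (G := fun t θ => ψ t θ ^ 2) (G' := fun t θ => 2 * ψ t θ * ψt t θ)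
      (show Continuous fun p : ℝ × ℝ => ψ p.1 p.2 ^ 2 from h.cont.pow 2)
      (show Continuous fun p : ℝ × ℝ => 2 * ψ p.1 p.2 * ψt p.1 p.2 from
        (h.cont.const_mul 2).mul h.cont_t)
      (fun t θ => ((h.deriv_t t θ).pow 2).congr_deriv (by push_cast; ring)) _ _ t
  have hS'c : Continuous S' := continuous_integral_param (G := fun t θ => 2 * ψ t θ * ψt t θ)
    (show Continuous fun p : ℝ × ℝ => 2 * ψ p.1 p.2 * ψt p.1 p.2 from
      (h.cont.const_mul 2).mul h.cont_t) _ _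
  have hSc : Continuous S := continuous_iff_continuousAt.2 fun t => (hSd t).continuousAt
  have hcd := fun n t => hasDerivAt_cosCoeff h.cont h.cont_t h.deriv_t n t
  have hsd := fun n t => hasDerivAt_sinCoeff h.cont h.cont_t h.deriv_t n t
  have hcc := fun n => continuous_cosCoeff h.cont n
  have hsc := fun n => continuous_sinCoeff h.cont n
  have hcc' := fun n => continuous_cosCoeff h.cont_t n
  have hsc' := fun n => continuous_sinCoeff h.cont_t n
  set D : ℝ → ℝ := fun t => 2 * Real.pi * S t - ∑ n ∈ s, sqCoeff (ψ t) n with hD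
  set D' : ℝ → ℝ := fun t => 2 * Real.pi * S' t - ∑ n ∈ s,
    (2 * cosCoeff (ψ t) n * cosCoeff (ψt t) n + 2 * sinCoeff (ψ t) n * sinCoeff (ψt t) n) with hD'
  have hDd : ∀ t, HasDerivAt D (D' t) t := fun t => by
    refine ((hSd t).const_mul _).sub (HasDerivAt.fun_sum fun n _ => ?_)
    refine (((hcd n t).pow 2).add ((hsd n t).pow 2)).congr_deriv ?_
    push_cast
    ring
  have hDc : Continuous D := continuous_iff_continuousAt.2 fun t => (hDd t).continuousAt
  have hD'c : Continuous D' := by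
    refine (hS'c.const_mul _).sub (continuous_finsetSum _ fun n _ => ?_)
    exact (((hcc n).const_mul 2).mul (hcc' n)).add (((hsc n).const_mul 2).mul (hsc' n))
  have hDL : 0 ≤ D L := sub_nonneg.2 (sum_sqCoeff_le (h.cont.comp (Continuous.prodMk_right L)) s)
  set E : ℤ → ℝ → ℝ := fun n t =>
    (cosCoeff (ψt t) n ^ 2 - m * Real.exp (-2 * t) * cosCoeff (ψ t) n ^ 2) +
      (sinCoeff (ψt t) n ^ 2 - m * Real.exp (-2 * t) * sinCoeff (ψ t) n ^ 2) with hE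
  have hEc : ∀ n, Continuous (E n) := fun n => by
    have := hcc n
    have := hsc n
    have := hcc' n
    have := hsc' n
    simp only [hE]
    fun_prop
  clear_value E
  have hwD := integral_logDeriv_mul hL.le hwd (by fun_prop) hDd hD'c
  have hwDc := continuousOn_logDeriv_mul hwd (by fun_prop) hDd hD'c
  have hw0 : w 0 = 0 := by simp [hw, hs.v_zero]
  rw [hw0, zero_mul, sub_zero] at hwD
  have hpt : ∀ t ∈ Icc 0 L, (((l : ℝ) ^ 2 - m * Real.exp (-2 * t) - w t ^ 2) * D t +
      w t * D' t) + ∑ n ∈ s, E n t ≤ 2 * Real.pi * ∫ θ in (-Real.pi)..Real.pi,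
        (ψt t θ ^ 2 + ψa t θ ^ 2 - m * Real.exp (-2 * t) * ψ t θ ^ 2) := by
    intro t _
    refine le_trans ?_ (h.energy_ge l (m * Real.exp (-2 * t)) (w t) t)
    simp only [hD, hD', mul_sub, Finset.mul_sum]
    have h1 : ∀ n ∈ s, E n t ≤ ((cosCoeff (ψt t) n - w t * cosCoeff (ψ t) n) ^ 2 +
        (sinCoeff (ψt t) n - w t * sinCoeff (ψ t) n) ^ 2 -
          ((l : ℝ) ^ 2 - n ^ 2) * sqCoeff (ψ t) n) +
        ((l : ℝ) ^ 2 - m * Real.exp (-2 * t) - w t ^ 2) * sqCoeff (ψ t) n +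
        w t * (2 * cosCoeff (ψ t) n * cosCoeff (ψt t) n +
          2 * sinCoeff (ψ t) n * sinCoeff (ψt t) n) := by
      intro n _
      -- Discarding the angular energy `n²` of a low frequency leaves the form of the mode 0.
      have : 0 ≤ (n : ℝ) ^ 2 * (cosCoeff (ψ t) n ^ 2 + sinCoeff (ψ t) n ^ 2) := by positivity
      simp only [hE, sqCoeff]
      linarith
    have h2 := Finset.sum_le_sum h1
    rw [Finset.sum_add_distrib, Finset.sum_add_distrib] at h2
    linarith
  have hGc : Continuous fun t => ∫ θ in (-Real.pi)..Real.pi,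
      (ψt t θ ^ 2 + ψa t θ ^ 2 - m * Real.exp (-2 * t) * ψ t θ ^ 2) :=
    continuous_integral_param
      (G := fun t θ => ψt t θ ^ 2 + ψa t θ ^ 2 - m * Real.exp (-2 * t) * ψ t θ ^ 2)
      (show Continuous fun p : ℝ × ℝ =>
          ψt p.1 p.2 ^ 2 + ψa p.1 p.2 ^ 2 - m * Real.exp (-2 * p.1) * ψ p.1 p.2 ^ 2 from
        ((h.cont_t.pow 2).add (h.cont_a.pow 2)).sub
          ((by fun_prop : Continuous fun p : ℝ × ℝ => m * Real.exp (-2 * p.1)).mul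
            (h.cont.pow 2))) _ _
  have hEsum : Continuous fun t => ∑ n ∈ s, E n t := continuous_finsetSum _ fun n _ => hEc n
  have hint := intervalIntegral.integral_mono_on (μ := volume) hL.le
    (ContinuousOn.intervalIntegrable (by rw [uIcc_of_le hL.le]; exact hwDc.add hEsum.continuousOn))
    ((hGc.const_mul _).intervalIntegrable _ _) hpt
  rw [intervalIntegral.integral_add
    (ContinuousOn.intervalIntegrable (by rw [uIcc_of_le hL.le]; exact hwDc))
    (hEsum.intervalIntegrable _ _), hwD,
    intervalIntegral.integral_finsetSum fun n _ => (hEc n).intervalIntegrable _ _,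
    intervalIntegral.integral_const_mul] at hint
  have hsum : 0 ≤ ∑ n ∈ s, ((∫ t in (0:ℝ)..L, E n t) + η * sqCoeff (ψ L) n) := by
    refine Finset.sum_nonneg fun n hn => ?_
    have h1 := hcc n
    have h2 := hsc n
    have h3 := hcc' n
    have h4 := hsc' n
    simp only [hE]
    have := intervalIntegral.integral_add
      (f := fun t => cosCoeff (ψt t) n ^ 2 - m * Real.exp (-2 * t) * cosCoeff (ψ t) n ^ 2)
      (g := fun t => sinCoeff (ψt t) n ^ 2 - m * Real.exp (-2 * t) * sinCoeff (ψ t) n ^ 2)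
      (μ := volume) (a := 0) (b := L)
      (Continuous.intervalIntegrable (by fun_prop) _ _)
      (Continuous.intervalIntegrable (by fun_prop) _ _)
    rw [this, sqCoeff]
    have := hnonneg n hn
    linarith
  rw [Finset.sum_add_distrib, ← Finset.mul_sum] at hsum
  have hwL : 0 ≤ (w L + η) * D L := by
    refine mul_nonneg ?_ hDL
    have : w L + η = (v L + η * u L) / u L := by
      have := (hpos L hLL).ne'
      simp only [hw]
      field_simp
    rw [this]
    exact div_nonneg hη (hpos L hLL).le
  have hfin : 0 ≤ 2 * Real.pi * ((∫ t in (0:ℝ)..L, ∫ θ in (-Real.pi)..Real.pi,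
        (ψt t θ ^ 2 + ψa t θ ^ 2 - m * Real.exp (-2 * t) * ψ t θ ^ 2)) + η * S L) := by
    have : η * D L = 2 * Real.pi * (η * S L) - η * ∑ n ∈ s, sqCoeff (ψ L) n := by
      simp only [hD]
      ring
    linarith
  exact nonneg_of_mul_nonneg_right hfin (by positivity)

/-! ### Logarithmic polar coordinates -/

/-- The point with polar coordinates `(β e^{-t}, θ)`. -/
def polarMap (β t θ : ℝ) : Plane :=
  !₂[β * Real.exp (-t) * Real.cos θ, β * Real.exp (-t) * Real.sin θ]

/-- The rotation by a right angle. -/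
def rotQuarter (x : Plane) : Plane := !₂[-x 1, x 0]

theorem norm_sq_plane (x : Plane) : ‖x‖ ^ 2 = x 0 ^ 2 + x 1 ^ 2 := by
  rw [EuclideanSpace.norm_sq_eq, Fin.sum_univ_two]
  simp

theorem norm_sq_polarMap (β t θ : ℝ) : ‖polarMap β t θ‖ ^ 2 = β ^ 2 * Real.exp (-2 * t) := by
  have he : Real.exp (-2 * t) = Real.exp (-t) ^ 2 := by
    rw [← Real.exp_nat_mul]
    congr 1
    push_cast
    ring
  rw [norm_sq_plane, he]
  simp only [polarMap, PiLp.toLp_apply, Matrix.cons_val_zero, Matrix.cons_val_one]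
  linear_combination (β * Real.exp (-t)) ^ 2 * Real.sin_sq_add_cos_sq θ

theorem norm_polarMap {β : ℝ} (hβ : 0 ≤ β) (t θ : ℝ) : ‖polarMap β t θ‖ = β * Real.exp (-t) := by
  have h := norm_sq_polarMap β t θ
  have he : Real.exp (-2 * t) = Real.exp (-t) ^ 2 := by
    rw [← Real.exp_nat_mul]
    congr 1
    push_cast
    ring
  rw [he, ← mul_pow] at h
  exact (pow_left_inj₀ (norm_nonneg _) (by positivity) two_ne_zero).1 h

theorem continuous_polarMap (β : ℝ) : Continuous fun p : ℝ × ℝ => polarMap β p.1 p.2 := by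
  refine (PiLp.continuous_toLp 2 _).comp (continuous_pi fun i => ?_)
  fin_cases i
  · simp only [Fin.zero_eta, Matrix.cons_val_zero]
    fun_prop
  · simp only [Fin.mk_one, Matrix.cons_val_one, Matrix.cons_val_zero]
    fun_prop

theorem hasDerivAt_plane {c : ℝ → Plane} {c' : Plane} {t : ℝ}
    (h : ∀ i, HasDerivAt (fun s => c s i) (c' i) t) : HasDerivAt c c' t :=
  ((PiLp.continuousLinearEquiv 2 ℝ (fun _ : Fin 2 => ℝ)).symm.hasFDerivAt.comp_hasDerivAt t
    (hasDerivAt_pi.2 h : HasDerivAt (fun s i => c s i) (fun i => c' i) t))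

theorem hasDerivAt_polarMap_left (β t θ : ℝ) :
    HasDerivAt (fun t => polarMap β t θ) (-polarMap β t θ) t := by
  have he : HasDerivAt (fun t => β * Real.exp (-t)) (-(β * Real.exp (-t))) t :=
    (((hasDerivAt_id t).neg.exp).const_mul β).congr_deriv (by simp)
  refine hasDerivAt_plane fun i => ?_
  fin_cases i
  · exact (he.mul_const _).congr_deriv (by simp [polarMap])
  · exact (he.mul_const _).congr_deriv (by simp [polarMap])

theorem hasDerivAt_polarMap_right (β t θ : ℝ) :
    HasDerivAt (fun θ => polarMap β t θ) (rotQuarter (polarMap β t θ)) θ := by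
  refine hasDerivAt_plane fun i => ?_
  fin_cases i
  · exact ((Real.hasDerivAt_cos θ).const_mul _).congr_deriv (by simp [polarMap, rotQuarter])
  · exact ((Real.hasDerivAt_sin θ).const_mul _).congr_deriv (by simp [polarMap, rotQuarter])

theorem inner_plane (x y : Plane) : inner ℝ x y = x 0 * y 0 + x 1 * y 1 := by
  rw [PiLp.inner_apply, Fin.sum_univ_two]
  simp [mul_comm]

/-- `-x` and `rotQuarter x` are orthogonal of length `‖x‖`, and they are the velocities of
`polarMap` in `t` and `θ`. So inner products of gradients are expressed by the partial derivatives
in these coordinates. -/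
theorem inner_mul_norm_sq (g k x : Plane) :
    inner ℝ g k * ‖x‖ ^ 2 = inner ℝ g (-x) * inner ℝ k (-x) +
      inner ℝ g (rotQuarter x) * inner ℝ k (rotQuarter x) := by
  simp only [norm_sq_plane, inner_plane, rotQuarter, PiLp.neg_apply,
    Matrix.cons_val_zero, Matrix.cons_val_one]
  ring

theorem norm_sq_mul_norm_sq (g x : Plane) :
    ‖g‖ ^ 2 * ‖x‖ ^ 2 = inner ℝ g (-x) ^ 2 + inner ℝ g (rotQuarter x) ^ 2 := by
  rw [← real_inner_self_eq_norm_sq g, inner_mul_norm_sq]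
  ring

theorem continuous_rotQuarter : Continuous rotQuarter := by
  refine (PiLp.continuous_toLp 2 _).comp (continuous_pi fun i => ?_)
  fin_cases i
  · simp only [Fin.zero_eta, Matrix.cons_val_zero]
    fun_prop
  · simp only [Fin.mk_one, Matrix.cons_val_one, Matrix.cons_val_zero]
    fun_prop

theorem continuous_gradient {φ : Plane → ℝ} (hφ : ContDiff ℝ 1 φ) : Continuous (gradient φ) :=
  (LinearIsometryEquiv.continuous _).comp (hφ.continuous_fderiv (by norm_num))

theorem inner_gradient (φ : Plane → ℝ) (x v : Plane) :
    inner ℝ (gradient φ x) v = fderiv ℝ φ x v :=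
  InnerProductSpace.toDual_symm_apply

theorem hasDerivAt_comp_polarMap_left {φ : Plane → ℝ} {β t θ : ℝ}
    (hφ : DifferentiableAt ℝ φ (polarMap β t θ)) :
    HasDerivAt (fun t => φ (polarMap β t θ))
      (inner ℝ (gradient φ (polarMap β t θ)) (-polarMap β t θ)) t := by
  rw [inner_gradient]
  exact hφ.hasFDerivAt.comp_hasDerivAt t (hasDerivAt_polarMap_left β t θ)

theorem hasDerivAt_comp_polarMap_right {φ : Plane → ℝ} {β t θ : ℝ}
    (hφ : DifferentiableAt ℝ φ (polarMap β t θ)) :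
    HasDerivAt (fun θ => φ (polarMap β t θ))
      (inner ℝ (gradient φ (polarMap β t θ)) (rotQuarter (polarMap β t θ))) θ := by
  rw [inner_gradient]
  exact hφ.hasFDerivAt.comp_hasDerivAt θ (hasDerivAt_polarMap_right β t θ)

theorem polarMap_neg_pi (β t : ℝ) : polarMap β t (-Real.pi) = polarMap β t Real.pi := by
  simp [polarMap]

theorem stripFunction_of_contDiff {φ : Plane → ℝ} (hφ : ContDiff ℝ 1 φ) (β : ℝ) :
    StripFunction (fun t θ => φ (polarMap β t θ))
      (fun t θ => inner ℝ (gradient φ (polarMap β t θ)) (-polarMap β t θ))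
      (fun t θ => inner ℝ (gradient φ (polarMap β t θ)) (rotQuarter (polarMap β t θ))) where
  cont := hφ.continuous.comp (continuous_polarMap β)
  cont_t := ((continuous_gradient hφ).comp (continuous_polarMap β)).inner
    (continuous_polarMap β).neg
  cont_a := ((continuous_gradient hφ).comp (continuous_polarMap β)).inner
    (continuous_rotQuarter.comp (continuous_polarMap β))
  deriv_t _ _ := hasDerivAt_comp_polarMap_left (hφ.differentiable (by norm_num) _)
  deriv_a _ _ := hasDerivAt_comp_polarMap_right (hφ.differentiable (by norm_num) _)
  periodic t := by rw [polarMap_neg_pi]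

/-- The measurable identification of `ℝ × ℝ` with the plane. -/
def planeEquiv : ℝ × ℝ ≃ᵐ Plane :=
  MeasurableEquiv.finTwoArrow.symm.trans (MeasurableEquiv.toLp 2 (Fin 2 → ℝ))

theorem planeEquiv_apply (p : ℝ × ℝ) : planeEquiv p = !₂[p.1, p.2] := rfl

theorem measurePreserving_planeEquiv : MeasurePreserving planeEquiv :=
  ((volume_preserving_finTwoArrow ℝ).symm _).trans (PiLp.volume_preserving_toLp (Fin 2))

theorem measurableSet_shell (α β : ℝ) : MeasurableSet (shell α β) :=
  Metric.isOpen_ball.measurableSet.diff Metric.isClosed_closedBall.measurableSet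

theorem mem_shell {α β : ℝ} {x : Plane} : x ∈ shell α β ↔ ‖x‖ < β ∧ α < ‖x‖ := by
  simp [shell]

theorem isOpen_shell (α β : ℝ) : IsOpen (shell α β) :=
  Metric.isOpen_ball.sdiff Metric.isClosed_closedBall

/-- Polar coordinates followed by `r = β e^{-t}`; the weight is `r |dr/dt|`. -/
theorem integral_shell {α β : ℝ} (hα : 0 < α) (hαβ : α < β) {F : Plane → ℝ}
    (hF : ContinuousOn F {x | α ≤ ‖x‖ ∧ ‖x‖ ≤ β}) :
    ∫ x in shell α β, F x = ∫ t in (0:ℝ)..Real.log (β / α), ∫ θ in (-Real.pi)..Real.pi,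
      β ^ 2 * Real.exp (-2 * t) * F (polarMap β t θ) := by
  have hβ : 0 < β := hα.trans hαβ
  have hpi : -Real.pi ≤ Real.pi := by linarith [Real.pi_pos]
  have hLpos : 0 < Real.log (β / α) := Real.log_pos ((one_lt_div hα).2 hαβ)
  rw [← integral_indicator (measurableSet_shell α β),
    ← measurePreserving_planeEquiv.integral_comp planeEquiv.measurableEmbedding,
    ← integral_comp_polarCoord_symm]
  have hnorm : ∀ r θ : ℝ, 0 ≤ r → ‖(!₂[r * Real.cos θ, r * Real.sin θ] : Plane)‖ = r := by
    intro r θ hr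
    have h := norm_sq_plane !₂[r * Real.cos θ, r * Real.sin θ]
    refine (pow_left_inj₀ (norm_nonneg _) hr two_ne_zero).1 (h.trans ?_)
    simp only [Matrix.cons_val_zero, Matrix.cons_val_one]
    linear_combination r ^ 2 * Real.sin_sq_add_cos_sq θ
  have h1 : ∫ p in polarCoord.target, p.1 • (shell α β).indicator F
      (planeEquiv (polarCoord.symm p)) =
      ∫ p in Ioo α β ×ˢ Ioo (-Real.pi) Real.pi,
        p.1 * F !₂[p.1 * Real.cos p.2, p.1 * Real.sin p.2] := by
    rw [polarCoord_target, ← integral_indicator (measurableSet_Ioi.prod measurableSet_Ioo),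
      ← integral_indicator (measurableSet_Ioo.prod measurableSet_Ioo)]
    congr 1
    ext ⟨r, θ⟩
    simp only [indicator_apply, mem_prod, mem_Ioi, mem_Ioo, polarCoord_symm_apply,
      planeEquiv_apply, smul_eq_mul]
    by_cases hr : 0 < r
    · have hm : (!₂[r * Real.cos θ, r * Real.sin θ] : Plane) ∈ shell α β ↔ r < β ∧ α < r := by
        rw [mem_shell, hnorm r θ hr.le]
      by_cases h2 : α < r ∧ r < β
      · simp [indicator_of_mem (hm.2 ⟨h2.2, h2.1⟩), h2.1, h2.2, hr]
      · rw [indicator_of_notMem fun h => h2 ⟨(hm.1 h).2, (hm.1 h).1⟩]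
        simp [h2]
    · have h2 : ¬ (α < r) := fun h => hr (hα.trans h)
      simp [hr, h2]
  rw [h1]
  have hcont : ContinuousOn
      (fun p : ℝ × ℝ => p.1 * F !₂[p.1 * Real.cos p.2, p.1 * Real.sin p.2])
      (Icc α β ×ˢ Icc (-Real.pi) Real.pi) := by
    refine continuousOn_fst.mul (hF.comp (Continuous.continuousOn ?_) ?_)
    · refine (PiLp.continuous_toLp 2 _).comp (continuous_pi fun i => ?_)
      fin_cases i
      · simp only [Fin.zero_eta, Matrix.cons_val_zero]
        fun_prop
      · simp only [Fin.mk_one, Matrix.cons_val_one, Matrix.cons_val_zero]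
        fun_prop
    · rintro ⟨r, θ⟩ ⟨hr, -⟩
      simp only [mem_ofPred_eq]
      rw [hnorm r θ (hα.le.trans hr.1)]
      exact hr
  have hint : IntegrableOn
      (fun p : ℝ × ℝ => p.1 * F !₂[p.1 * Real.cos p.2, p.1 * Real.sin p.2])
      (Ioo α β ×ˢ Ioo (-Real.pi) Real.pi) (volume.prod volume) :=
    (hcont.integrableOn_compact (isCompact_Icc.prod isCompact_Icc)).mono_set
      (prod_mono Ioo_subset_Icc_self Ioo_subset_Icc_self)
  rw [Measure.volume_eq_prod, setIntegral_prod _ hint]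
  have himg : Ioo α β = (fun t => β * Real.exp (-t)) '' Ioo 0 (Real.log (β / α)) := by
    ext r
    constructor
    · intro hr
      have hr0 : 0 < r := hα.trans hr.1
      refine ⟨Real.log (β / r), ⟨Real.log_pos ((one_lt_div hr0).2 hr.2),
        Real.log_lt_log (by positivity) (by gcongr; exact hr.1)⟩, ?_⟩
      simp only
      rw [Real.exp_neg, Real.exp_log (by positivity)]
      field_simp
    · rintro ⟨t, ht, rfl⟩
      have h2 : Real.exp (-t) < 1 := Real.exp_lt_one_iff.2 (by linarith [ht.1])
      have h3 : α / β < Real.exp (-t) := by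
        have := Real.exp_lt_exp.2 (neg_lt_neg ht.2)
        rwa [← Real.log_inv, Real.exp_log (by positivity), inv_div] at this
      rw [div_lt_iff₀ hβ] at h3
      exact ⟨by linarith, by nlinarith⟩
  have hder : ∀ t : ℝ, HasDerivAt (fun t => β * Real.exp (-t)) (-(β * Real.exp (-t))) t := fun t =>
    (((hasDerivAt_id t).neg.exp).const_mul β).congr_deriv (by simp)
  rw [himg, integral_image_eq_integral_abs_deriv_smul (f' := fun t => -(β * Real.exp (-t)))
    measurableSet_Ioo (fun t _ => (hder t).hasDerivWithinAt) ?_, intervalIntegral.integral_of_le hLpos.le,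
    integral_Ioc_eq_integral_Ioo]
  · refine integral_congr_ae (Filter.Eventually.of_forall fun t => ?_)
    simp only
    rw [intervalIntegral.integral_of_le hpi, integral_Ioc_eq_integral_Ioo, smul_eq_mul,
      ← integral_const_mul]
    refine integral_congr_ae (Filter.Eventually.of_forall fun θ => ?_)
    have he : Real.exp (-2 * t) = Real.exp (-t) * Real.exp (-t) := by
      rw [← Real.exp_add]
      congr 1
      ring
    simp only [abs_neg, abs_of_pos (mul_pos hβ (Real.exp_pos (-t))), he, polarMap]
    ring
  · intro s _ t _ hst
    have := mul_left_cancel₀ hβ.ne' hst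
    linarith [Real.exp_injective this]

theorem integral_circleMeasure {α β : ℝ} (hα : 0 < α) (hαβ : α < β) (F : Plane → ℝ)
    (hF : Continuous F) : ∫ x, F x ∂circleMeasure α =
      α * ∫ θ in (-Real.pi)..Real.pi, F (polarMap β (Real.log (β / α)) θ) := by
  have hβ : 0 < β := hα.trans hαβ
  have hc : Continuous fun θ : ℝ => (!₂[α * Real.cos θ, α * Real.sin θ] : Plane) := by
    refine (PiLp.continuous_toLp 2 _).comp (continuous_pi fun i => ?_)
    fin_cases i
    · simp only [Fin.zero_eta, Matrix.cons_val_zero]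
      fun_prop
    · simp only [Fin.mk_one, Matrix.cons_val_one, Matrix.cons_val_zero]
      fun_prop
  rw [circleMeasure, integral_smul_measure, integral_map hc.aemeasurable
    hF.aestronglyMeasurable, ENNReal.toReal_ofReal hα.le,
    intervalIntegral.integral_of_le (by linarith [Real.pi_pos]), smul_eq_mul]
  have h : β * Real.exp (-Real.log (β / α)) = α := by
    rw [Real.exp_neg, Real.exp_log (by positivity)]
    field_simp
  simp only [polarMap, h]

instance isFiniteMeasure_circleMeasure (α : ℝ) : IsFiniteMeasure (circleMeasure α) := by
  unfold circleMeasure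
  refine ⟨?_⟩
  rw [Measure.smul_apply, smul_eq_mul]
  exact ENNReal.mul_lt_top ENNReal.ofReal_lt_top (measure_lt_top _ _)

/-! ### The form on smooth functions on the shell -/

theorem setIntegrable_of_continuous {α β : ℝ} {F : Plane → ℝ} (hF : Continuous F) :
    IntegrableOn F (shell α β) :=
  (hF.continuousOn.integrableOn_compact (isCompact_closedBall (0 : Plane) β)).mono_set
    (sdiff_subset.trans Metric.ball_subset_closedBall)

/-- Conformal invariance: the area weight `β² e^{-2t}` equals `‖x‖²` and cancels in the Dirichlet
integral, which turns the form on the shell into the one on the strip. Arc length `α dθ` explains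
the boundary weight `η / α`. -/
theorem shell_form_nonneg {α β : ℝ} (hα : 0 < α) (hαβ : α < β) {l : ℕ} {m η : ℝ} {u v : ℝ → ℝ}
    (hs : ModeSol l m (Real.log (β / α)) u v) (hpos : ∀ t ∈ Icc 0 (Real.log (β / α)), 0 < u t)
    (hη : 0 ≤ v (Real.log (β / α)) + η * u (Real.log (β / α))) {s : ℝ}
    (hhyp : ∀ a a' : ℝ → ℝ, (∀ t ∈ Icc 0 (Real.log (β / α)), HasDerivAt a (a' t) t) →
      ContinuousOn a' (Icc 0 (Real.log (β / α))) → a s = 0 →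
      0 ≤ (∫ t in (0:ℝ)..(Real.log (β / α)), (a' t ^ 2 - m * Real.exp (-2 * t) * a t ^ 2)) +
        η * a (Real.log (β / α)) ^ 2)
    {φ : Plane → ℝ} (hφ : ContDiff ℝ 1 φ)
    (hcoeff : ∀ n ∈ Finset.Ioo (-l : ℤ) l, cosCoeff (fun θ => φ (polarMap β s θ)) n = 0 ∧
      sinCoeff (fun θ => φ (polarMap β s θ)) n = 0) :
    0 ≤ (∫ x in shell α β, ‖gradient φ x‖ ^ 2) - m / β ^ 2 * (∫ x in shell α β, φ x ^ 2) +
      η / α * ∫ x, φ x ^ 2 ∂circleMeasure α := by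
  have hβ : 0 < β := hα.trans hαβ
  have hL : 0 < Real.log (β / α) := Real.log_pos ((one_lt_div hα).2 hαβ)
  have hgc := continuous_gradient hφ
  have hφc := hφ.continuous
  have hstrip := stripFunction_of_contDiff hφ β
  have key := hstrip.form_nonneg hL hs hpos hη fun n hn =>
    ⟨hhyp (fun t => cosCoeff (fun θ => φ (polarMap β t θ)) n) _
      (fun t _ => hasDerivAt_cosCoeff hstrip.cont hstrip.cont_t hstrip.deriv_t n t)
      (continuous_cosCoeff hstrip.cont_t n).continuousOn (hcoeff n hn).1,
    hhyp (fun t => sinCoeff (fun θ => φ (polarMap β t θ)) n) _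
      (fun t _ => hasDerivAt_sinCoeff hstrip.cont hstrip.cont_t hstrip.deriv_t n t)
      (continuous_sinCoeff hstrip.cont_t n).continuousOn (hcoeff n hn).2⟩
  have hi1 : IntegrableOn (fun x => ‖gradient φ x‖ ^ 2) (shell α β) :=
    setIntegrable_of_continuous (hgc.norm.pow 2)
  have hi2 : IntegrableOn (fun x => m / β ^ 2 * φ x ^ 2) (shell α β) :=
    setIntegrable_of_continuous ((hφc.pow 2).const_mul _)
  rw [integral_circleMeasure hα hαβ (fun x => φ x ^ 2) (hφc.pow 2), ← integral_const_mul,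
    ← integral_sub hi1 hi2,
    integral_shell hα hαβ (by fun_prop)]
  have h1 : η / α * (α * ∫ θ in (-Real.pi)..Real.pi, φ (polarMap β (Real.log (β / α)) θ) ^ 2) =
      η * ∫ θ in (-Real.pi)..Real.pi, φ (polarMap β (Real.log (β / α)) θ) ^ 2 := by
    field_simp
  rw [h1]
  convert key using 8 with t θ
  have h2 := norm_sq_mul_norm_sq (gradient φ (polarMap β t θ)) (polarMap β t θ)
  rw [← h2, norm_sq_polarMap]
  field_simp

/-! ### The space of smooth functions and their data -/

/-- The space `C_c^∞(ℝ²)`. -/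
def smoothSpace : Submodule ℝ (Plane → ℝ) where
  carrier := {φ | ContDiff ℝ ∞ φ ∧ HasCompactSupport φ}
  add_mem' h1 h2 := ⟨h1.1.add h2.1, h1.2.add h2.2⟩
  zero_mem' := ⟨contDiff_const, HasCompactSupport.zero⟩
  smul_mem' c _ h := ⟨contDiff_const.smul h.1, h.2.mono (Function.support_const_smul_subset c _)⟩

theorem hasCompactSupport_gradient {φ : Plane → ℝ} (h : HasCompactSupport φ) :
    HasCompactSupport (gradient φ) := by
  refine (h.fderiv (𝕜 := ℝ)).mono fun x hx h0 => hx ?_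
  simp only [gradient]
  rw [h0, map_zero]

theorem contDiff_one_of_infty {φ : Plane → ℝ} (h : ContDiff ℝ ∞ φ) : ContDiff ℝ 1 φ :=
  h.of_le (by exact_mod_cast le_top)

theorem memLp_value {Ω : Set Plane} {φ : Plane → ℝ} (h1 : Continuous φ)
    (h2 : HasCompactSupport φ) : MemLp φ 2 (volume.restrict Ω) :=
  (h1.memLp_of_hasCompactSupport h2).restrict Ω

theorem memLp_gradient {Ω : Set Plane} {φ : Plane → ℝ} (h1 : ContDiff ℝ 1 φ)
    (h2 : HasCompactSupport φ) : MemLp (gradient φ) 2 (volume.restrict Ω) :=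
  ((continuous_gradient h1).memLp_of_hasCompactSupport (hasCompactSupport_gradient h2)).restrict Ω

theorem memLp_circle {α : ℝ} {φ : Plane → ℝ} (h1 : Continuous φ)
    (h2 : HasCompactSupport φ) : MemLp φ 2 (circleMeasure α) :=
  h1.memLp_of_hasCompactSupport h2

/-- The data of a function of class `C_c^1`. -/
def dataOf (α : ℝ) (Ω : Set Plane) (φ : Plane → ℝ) (h1 : ContDiff ℝ 1 φ)
    (h2 : HasCompactSupport φ) : DataSpace α Ω :=
  ((memLp_value h1.continuous h2).toLp φ, (memLp_gradient h1 h2).toLp (gradient φ),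
    (memLp_circle h1.continuous h2).toLp φ)

theorem gradient_add {φ ψ : Plane → ℝ} (h1 : ContDiff ℝ 1 φ) (h2 : ContDiff ℝ 1 ψ) :
    gradient (φ + ψ) = gradient φ + gradient ψ := by
  ext1 x
  simp only [gradient, Pi.add_apply]
  rw [fderiv_add (h1.differentiable (by norm_num) x) (h2.differentiable (by norm_num) x), map_add]

theorem gradient_const_smul (c : ℝ) {φ : Plane → ℝ} (h1 : ContDiff ℝ 1 φ) :
    gradient (c • φ) = c • gradient φ := by
  ext1 x
  simp only [gradient, Pi.smul_apply]
  rw [fderiv_const_smul (h1.differentiable (by norm_num) x), map_smul]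

/-- The space `C_c^1(ℝ²)`. -/
def testSpace : Submodule ℝ (Plane → ℝ) where
  carrier := {φ | ContDiff ℝ 1 φ ∧ HasCompactSupport φ}
  add_mem' h1 h2 := ⟨h1.1.add h2.1, h1.2.add h2.2⟩
  zero_mem' := ⟨contDiff_const, HasCompactSupport.zero⟩
  smul_mem' c _ h := ⟨contDiff_const.smul h.1, h.2.mono (Function.support_const_smul_subset c _)⟩

/-- The data of functions of class `C_c^1` as a linear map. -/
def testMap (α : ℝ) (Ω : Set Plane) : testSpace →ₗ[ℝ] DataSpace α Ω where
  toFun φ := dataOf α Ω φ φ.2.1 φ.2.2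
  map_add' φ ψ := by
    have h := gradient_add φ.2.1 ψ.2.1
    simp only [dataOf, Submodule.coe_add, h]
    rfl
  map_smul' c φ := by
    have h := gradient_const_smul c φ.2.1
    simp only [dataOf, Submodule.coe_smul, h, RingHom.id_apply]
    rfl

theorem smoothSpace_le_testSpace : smoothSpace ≤ testSpace :=
  fun _ h => ⟨contDiff_one_of_infty h.1, h.2⟩

/-- The data of smooth functions as a linear map. -/
def dataMap (α : ℝ) (Ω : Set Plane) : smoothSpace →ₗ[ℝ] DataSpace α Ω :=
  testMap α Ω ∘ₗ Submodule.inclusion smoothSpace_le_testSpace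

theorem smoothData_subset_range (α : ℝ) (Ω : Set Plane) :
    smoothData α Ω ⊆ range (dataMap α Ω) := by
  rintro ⟨u, g, t⟩ ⟨φ, h1, h2, hu, hg, ht⟩
  refine ⟨⟨φ, h1, h2⟩, ?_⟩
  refine Prod.ext ?_ (Prod.ext ?_ ?_)
  · exact Lp.ext ((memLp_value h1.continuous h2).coeFn_toLp.trans hu.symm)
  · exact Lp.ext ((memLp_gradient (contDiff_one_of_infty h1) h2).coeFn_toLp.trans hg.symm)
  · exact Lp.ext ((memLp_circle h1.continuous h2).coeFn_toLp.trans ht.symm)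

theorem norm_sq_Lp {X E : Type*} [MeasurableSpace X] {ν : Measure X} [NormedAddCommGroup E]
    [InnerProductSpace ℝ E] (f : Lp E 2 ν) : ‖f‖ ^ 2 = ∫ x, ‖f x‖ ^ 2 ∂ν := by
  rw [← real_inner_self_eq_norm_sq, L2.inner_def]
  simp_rw [real_inner_self_eq_norm_sq]

theorem norm_sq_toLp {X E : Type*} [MeasurableSpace X] {ν : Measure X} [NormedAddCommGroup E]
    [InnerProductSpace ℝ E] {f : X → E} (hf : MemLp f 2 ν) :
    ‖hf.toLp f‖ ^ 2 = ∫ x, ‖f x‖ ^ 2 ∂ν := by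
  rw [norm_sq_Lp]
  refine integral_congr_ae ?_
  filter_upwards [hf.coeFn_toLp] with x hx
  rw [hx]

/-- The quadratic form `∫ |∇u|² - μ ∫ u² + K ∫_{∂B_α} u²` on data. -/
def dataForm (μ K : ℝ) {α : ℝ} {Ω : Set Plane} (p : DataSpace α Ω) : ℝ :=
  ‖p.2.1‖ ^ 2 - μ * ‖p.1‖ ^ 2 + K * ‖p.2.2‖ ^ 2

theorem continuous_dataForm (μ K : ℝ) (α : ℝ) (Ω : Set Plane) :
    Continuous (dataForm μ K : DataSpace α Ω → ℝ) := by
  unfold dataForm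
  fun_prop

theorem dataForm_dataOf (μ K : ℝ) {α : ℝ} {Ω : Set Plane} {φ : Plane → ℝ} (h1 : ContDiff ℝ 1 φ)
    (h2 : HasCompactSupport φ) : dataForm μ K (dataOf α Ω φ h1 h2) =
      (∫ x in Ω, ‖gradient φ x‖ ^ 2) - μ * (∫ x in Ω, φ x ^ 2) +
        K * ∫ x, φ x ^ 2 ∂circleMeasure α := by
  simp only [dataForm, dataOf, norm_sq_toLp, Real.norm_eq_abs, sq_abs]

theorem rayleigh_eq (h : WithTop ℝ) {α : ℝ} {Ω : Set Plane} (p : DataSpace α Ω) :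
    rayleigh h p = (‖p.2.1‖ ^ 2 + h.untopD 0 * ‖p.2.2‖ ^ 2) / ‖p.1‖ ^ 2 := by
  simp only [rayleigh, norm_sq_Lp, Real.norm_eq_abs, sq_abs]

/-! ### The minimax principle with constraints on approximating functions -/

/-- The constraints `Λ` are defined on the approximating functions only and need not be continuous
on `E`. Each vector of a basis of `X` is approximated; at every stage a unit coefficient vector
satisfies the constraints, and compactness of the sphere gives a nonzero limit in `X`, to which the
sign of `q` passes. -/
theorem exists_ne_zero_nonneg_of_constraints {E W ι : Type*} [NormedAddCommGroup E]
    [NormedSpace ℝ E] [AddCommGroup W] [Module ℝ W] [Fintype ι] (T : W →ₗ[ℝ] E)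
    (Λ : W →ₗ[ℝ] (ι → ℝ)) (X : Submodule ℝ E) (hX : (X : Set E) ⊆ closure (range T))
    (hdim : Fintype.card ι < Module.finrank ℝ X) {q : E → ℝ} (hq : Continuous q)
    (hnn : ∀ w, Λ w = 0 → 0 ≤ q (T w)) : ∃ x ∈ X, x ≠ 0 ∧ 0 ≤ q x := by
  have : FiniteDimensional ℝ X := Module.finite_of_finrank_pos (by omega)
  set d := Module.finrank ℝ X with hd
  set b := Module.finBasis ℝ X with hb
  have hseq : ∀ i, ∃ w : ℕ → W, Filter.Tendsto (fun n => T (w n)) Filter.atTop (𝓝 (b i : E)) := by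
    intro i
    obtain ⟨y, hy, hlim⟩ := mem_closure_iff_seq_limit.1 (hX (b i).2)
    choose w hw using hy
    exact ⟨w, by simpa only [hw] using hlim⟩
  choose w hw using hseq
  have hker : ∀ n, ∃ c : Fin d → ℝ, ‖c‖ = 1 ∧ Λ (∑ i, c i • w i n) = 0 := by
    intro n
    set A : (Fin d → ℝ) →ₗ[ℝ] (ι → ℝ) := Λ ∘ₗ Fintype.linearCombination ℝ (fun i => w i n) with hA
    have hne : LinearMap.ker A ≠ ⊥ := LinearMap.ker_ne_bot_of_finrank_lt (by simpa using hdim)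
    obtain ⟨c, hc, hc0⟩ := (Submodule.ne_bot_iff _).1 hne
    refine ⟨‖c‖⁻¹ • c, norm_smul_inv_norm hc0, ?_⟩
    have h1 : A (‖c‖⁻¹ • c) = 0 := by rw [map_smul, LinearMap.mem_ker.1 hc, smul_zero]
    rwa [hA, LinearMap.comp_apply, Fintype.linearCombination_apply] at h1
  choose c hc1 hc2 using hker
  obtain ⟨c0, hc0, ψ, hψ, hlim⟩ := (isCompact_sphere (0 : Fin d → ℝ) 1).tendsto_subseq
    (fun n => by simpa using hc1 n : ∀ n, c n ∈ Metric.sphere (0 : Fin d → ℝ) 1)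
  have hc0n : c0 ≠ 0 := fun h => by simp [h] at hc0
  refine ⟨(∑ i, c0 i • b i : X), Submodule.coe_mem _, fun h => hc0n ?_, ?_⟩
  · have h1 : ∑ i, c0 i • b i = 0 := Subtype.ext h
    ext i
    exact Fintype.linearIndependent_iff.1 b.linearIndependent c0 h1 i
  · have h1 : Filter.Tendsto (fun n => T (∑ i, c (ψ n) i • w i (ψ n))) Filter.atTop
        (𝓝 ((∑ i, c0 i • b i : X) : E)) := by
      simp only [map_sum, map_smul, Submodule.coe_sum, Submodule.coe_smul]
      refine tendsto_finsetSum _ fun i _ => ?_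
      exact ((tendsto_pi_nhds.1 hlim) i).smul ((hw i).comp hψ.tendsto_atTop)
    exact ge_of_tendsto' ((hq.tendsto _).comp h1) fun n => hnn _ (hc2 (ψ n))

/-! ### Fourier coefficients on a circle as linear functionals -/

theorem cosCoeff_neg (F : ℝ → ℝ) (n : ℤ) : cosCoeff F (-n) = cosCoeff F n := by
  simp [cosCoeff]

theorem sinCoeff_neg (F : ℝ → ℝ) (n : ℤ) : sinCoeff F (-n) = -sinCoeff F n := by
  simp [sinCoeff]

theorem sinCoeff_zero (F : ℝ → ℝ) : sinCoeff F 0 = 0 := by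
  simp [sinCoeff]

/-- The real Fourier coefficients of order less than `l` on the circle of radius `β e^{-s}`,
indexed by `-l < n < l`. -/
def circleCoeffs (β s : ℝ) (l : ℕ) : smoothSpace →ₗ[ℝ] (Finset.Ioo (-l : ℤ) l → ℝ) where
  toFun φ n := if 0 ≤ (n : ℤ) then cosCoeff (fun θ => φ.1 (polarMap β s θ)) n
    else sinCoeff (fun θ => φ.1 (polarMap β s θ)) n
  map_add' φ ψ := by
    have hc : ∀ χ : smoothSpace, Continuous fun θ => χ.1 (polarMap β s θ) := fun χ =>
      χ.2.1.continuous.comp ((continuous_polarMap β).comp (Continuous.prodMk_right s))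
    have h1 := hc φ
    have h2 := hc ψ
    ext n
    simp only [Pi.add_apply, Submodule.coe_add]
    split_ifs
    · simp only [cosCoeff, add_mul]
      have h3 : Continuous fun θ : ℝ => Real.cos ((n : ℤ) * θ) := by fun_prop
      exact intervalIntegral.integral_add ((h1.mul h3).intervalIntegrable _ _)
        ((h2.mul h3).intervalIntegrable _ _)
    · simp only [sinCoeff, add_mul]
      have h3 : Continuous fun θ : ℝ => Real.sin ((n : ℤ) * θ) := by fun_prop
      exact intervalIntegral.integral_add ((h1.mul h3).intervalIntegrable _ _)
        ((h2.mul h3).intervalIntegrable _ _)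
  map_smul' c φ := by
    ext n
    simp only [Pi.smul_apply, Submodule.coe_smul, smul_eq_mul, RingHom.id_apply]
    split_ifs
    · simp only [cosCoeff, mul_assoc, intervalIntegral.integral_const_mul]
    · simp only [sinCoeff, mul_assoc, intervalIntegral.integral_const_mul]

/-- Cosine coefficients are even and sine coefficients odd in `n`, and the sine coefficient of order
0 vanishes; so `2 l - 1` numbers control all coefficients of order below `l`. -/
theorem circleCoeffs_eq_zero {β s : ℝ} {l : ℕ} {φ : smoothSpace} (h : circleCoeffs β s l φ = 0) :
    ∀ n ∈ Finset.Ioo (-l : ℤ) l, cosCoeff (fun θ => φ.1 (polarMap β s θ)) n = 0 ∧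
      sinCoeff (fun θ => φ.1 (polarMap β s θ)) n = 0 := by
  have hc : ∀ n ∈ Finset.Ioo (-l : ℤ) l, 0 ≤ n → cosCoeff (fun θ => φ.1 (polarMap β s θ)) n = 0 := by
    intro n hn h0
    have := congrFun h ⟨n, hn⟩
    simpa [circleCoeffs, h0] using this
  have hs : ∀ n ∈ Finset.Ioo (-l : ℤ) l, n < 0 → sinCoeff (fun θ => φ.1 (polarMap β s θ)) n = 0 := by
    intro n hn h0
    have := congrFun h ⟨n, hn⟩
    simpa [circleCoeffs, not_le.2 h0] using this
  have hneg : ∀ n ∈ Finset.Ioo (-l : ℤ) l, -n ∈ Finset.Ioo (-l : ℤ) l := by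
    intro n hn
    rw [Finset.mem_Ioo] at hn ⊢
    omega
  intro n hn
  rcases lt_trichotomy n 0 with h0 | h0 | h0
  · exact ⟨by rw [← cosCoeff_neg]; exact hc _ (hneg n hn) (by omega), hs n hn h0⟩
  · subst h0
    exact ⟨hc 0 hn le_rfl, sinCoeff_zero _⟩
  · exact ⟨hc n hn h0.le, by
      rw [← neg_eq_zero, ← sinCoeff_neg]
      exact hs _ (hneg n hn) (by omega)⟩

/-! ### The lower bound for the eigenvalues of the shell -/

theorem formDomain_subset_closure (h : WithTop ℝ) (α : ℝ) (Ω : Set Plane) :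
    formDomain h α Ω ⊆ closure (range (dataMap α Ω)) :=
  fun _ hp => closure_mono (smoothData_subset_range α Ω) hp.2.1

/-- The trace inequality on the shell. -/
theorem exists_trace_inequality {α β : ℝ} (hα : 0 < α) (hαβ : α < β) :
    ∃ μ K : ℝ, 0 < K ∧ ∀ p ∈ closure (range (dataMap α (shell α β))), 0 ≤ dataForm μ (-K) p := by
  set L := Real.log (β / α) with hLdef
  have hL : 0 < L := Real.log_pos ((one_lt_div hα).2 hαβ)
  -- For `m` negative enough the solution of the mode 0 has a positive logarithmic derivative `K` at
  -- the inner circle. Comparison with it for `l = 0`, where no Fourier coefficient is constrained,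
  -- allows the boundary weight `-K`.
  obtain ⟨m, hm⟩ := exists_pruferAngle_lt hL 0 (τ := 0) (by linarith [Real.pi_pos])
  have hm0 := hm m le_rfl
  obtain ⟨u, v, hs, hpos, hv⟩ := exists_modeSol_of_pruferAngle_lt hL
    (l := 0) (m := m) (hm0.trans (by positivity))
  have hlow := neg_pi_div_two_lt_pruferAngle hL (pruferAngle_zero hL 0 m)
    (hasDerivAt_pruferAngle hL 0 m)
  have htan : Real.tan (pruferAngle hL 0 m L) < 0 := Real.tan_neg_of_neg_of_pi_div_two_lt hm0 hlow
  set K := -Real.tan (pruferAngle hL 0 m L) with hK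
  refine ⟨m / β ^ 2, K / α, div_pos (by linarith) hα, ?_⟩
  have hclosed : IsClosed {p : DataSpace α (shell α β) | 0 ≤ dataForm (m / β ^ 2) (-(K / α)) p} :=
    isClosed_le continuous_const (continuous_dataForm _ _ _ _)
  refine fun p hp => closure_minimal ?_ hclosed hp
  rintro _ ⟨φ, rfl⟩
  have hcast : ((0 : ℕ) : ℝ) = 0 := Nat.cast_zero
  have key := shell_form_nonneg hα hαβ (l := 0) (η := -K) (s := 0) (hcast.symm ▸ hs) hpos
    (by rw [← hLdef, hv]; linarith) (φ := φ.1) ?_ (contDiff_one_of_infty φ.2.1) (by simp)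
  · show 0 ≤ dataForm (m / β ^ 2) (-(K / α)) (dataOf α (shell α β) φ (contDiff_one_of_infty φ.2.1) φ.2.2)
    rw [dataForm_dataOf]
    rwa [neg_div] at key
  · intro a a' ha ha' h0
    have h1 := hs.picone hL hpos ha ha'
    have h2 : v L * a L ^ 2 / u L = K * a L ^ 2 := by
      have := (hpos L ⟨hL.le, le_rfl⟩).ne'
      rw [hv]
      field_simp
    rw [h2] at h1
    have h3 : ∀ t : ℝ, a' t ^ 2 + ((0:ℝ) ^ 2 - m * Real.exp (-2 * t)) * a t ^ 2 =
      a' t ^ 2 - m * Real.exp (-2 * t) * a t ^ 2 := fun t => by ring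
    simp only [h3] at h1
    linarith

theorem volume_shell_lt_top (α β : ℝ) : volume (shell α β) < ⊤ :=
  (measure_mono sdiff_subset).trans_lt measure_ball_lt_top

/-- Uniqueness of the weak gradient, by the fundamental lemma of the calculus of variations. -/
theorem ae_eq_zero_of_isWeakGradient_zero {Ω : Set Plane} (hΩ : IsOpen Ω) (hvol : volume Ω < ⊤)
    {u : Plane → ℝ} {g : Lp Plane 2 (volume.restrict Ω)} (hu : u =ᵐ[volume.restrict Ω] 0)
    (h : IsWeakGradient Ω u g) : g = 0 := by
  have hfin : IsFiniteMeasure (volume.restrict Ω) := ⟨by simpa using hvol⟩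
  have hgi : Integrable g (volume.restrict Ω) := (Lp.memLp g).integrable one_le_two
  have hg : IntegrableOn g Ω := hgi
  have key := hΩ.ae_eq_zero_of_integral_contDiff_smul_eq_zero hg.locallyIntegrableOn
    fun φ h1 h2 h3 => by
      have h4 := h φ h1 h2 h3
      have h5 : ∫ x in Ω, u x • gradient φ x = 0 := by
        refine integral_eq_zero_of_ae ?_
        filter_upwards [hu] with x hx
        simp [hx]
      have h6 : ∫ x in Ω, φ x • g x = ∫ x, φ x • g x :=
        setIntegral_eq_integral_of_forall_compl_eq_zero fun x hx => by
          have : φ x = 0 := by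
            by_contra hne
            exact hx (h3 (subset_tsupport φ hne))
          simp [this]
      rw [h5, h6, zero_eq_neg] at h4
      exact h4
  refine Lp.ext ?_
  filter_upwards [(ae_restrict_iff' hΩ.measurableSet).2 key, Lp.coeFn_zero Plane 2
    (volume.restrict Ω)] with x h1 h2
  rw [h1, h2]
  rfl

/-- Ensures that the Rayleigh quotient of a nonzero triple has a nonzero denominator. If the
function vanishes, so does its gradient by uniqueness, and then its trace by the trace inequality.
-/
theorem norm_fst_pos_of_mem_formDomain {h : WithTop ℝ} {α β : ℝ} (hα : 0 < α) (hαβ : α < β)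
    {p : DataSpace α (shell α β)} (hp : p ∈ formDomain h α (shell α β)) (hp0 : p ≠ 0) :
    0 < ‖p.1‖ := by
  by_contra hcon
  have h1 : p.1 = 0 := norm_eq_zero.1 (le_antisymm (not_lt.1 hcon) (norm_nonneg _))
  have h2 : p.2.1 = 0 := ae_eq_zero_of_isWeakGradient_zero (isOpen_shell α β)
    (volume_shell_lt_top α β) (by rw [h1]; exact Lp.coeFn_zero _ _ _) hp.1
  obtain ⟨μ, K, hK, hform⟩ := exists_trace_inequality hα hαβ
  have h3 := hform p (formDomain_subset_closure h α _ hp)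
  simp only [dataForm, h1, h2, norm_zero] at h3
  have h4 : ‖p.2.2‖ ^ 2 = 0 := by nlinarith [sq_nonneg ‖p.2.2‖]
  exact hp0 (Prod.ext h1 (Prod.ext h2 (norm_eq_zero.1 (pow_eq_zero_iff two_ne_zero |>.1 h4))))

/-- If the mode `l` has no eigenvalue below `μ`, and the mode `0` at most one, then there are at
most `2 l - 1` eigenvalues below `μ`. -/
theorem le_tau_shell {h : WithTop ℝ} {α β : ℝ} (hα : 0 < α) (hαβ : α < β) {l i : ℕ}
    (hl : 1 ≤ l) (hi : 2 * l ≤ i) {μ K : ℝ} (hK : ∀ r : ℝ, h = r → K = r) {u v : ℝ → ℝ}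
    (hs : ModeSol l (μ * β ^ 2) (Real.log (β / α)) u v)
    (hpos : ∀ t ∈ Icc 0 (Real.log (β / α)), 0 < u t)
    (hη : 0 ≤ v (Real.log (β / α)) + K * α * u (Real.log (β / α)))
    (hhyp : NonnegOnHyperplane (μ * β ^ 2) (K * α) (Real.log (β / α))) :
    (μ : EReal) ≤ tau i h α (shell α β) := by
  have hβ : 0 < β := hα.trans hαβ
  obtain ⟨s, -, hyp⟩ := hhyp
  refine le_iInf fun X => le_iInf fun hXi => le_iInf fun hX => ?_
  have hm : μ * β ^ 2 / β ^ 2 = μ := by field_simp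
  have hKα : K * α / α = K := by field_simp
  -- There are `2 l - 1` constraints on a space of dimension `i ≥ 2 l`.
  obtain ⟨p, hpX, hp0, hq⟩ := exists_ne_zero_nonneg_of_constraints (dataMap α (shell α β))
    (circleCoeffs β s l) X (hX.trans (formDomain_subset_closure h α _))
    (by rw [Fintype.card_coe, Int.card_Ioo, hXi]; omega) (continuous_dataForm μ K α (shell α β))
    (fun φ hφ => by
      show 0 ≤ dataForm μ K (dataOf α (shell α β) φ (contDiff_one_of_infty φ.2.1) φ.2.2)
      rw [dataForm_dataOf]
      have := shell_form_nonneg hα hαβ hs hpos hη hyp (contDiff_one_of_infty φ.2.1)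
        (circleCoeffs_eq_zero hφ)
      rwa [hm, hKα] at this)
  have hpD := norm_fst_pos_of_mem_formDomain hα hαβ (hX hpX) hp0
  refine le_trans ?_ (le_iSup_of_le p (le_iSup_of_le hpX (le_iSup_of_le hp0 le_rfl)))
  rw [EReal.coe_le_coe_iff, rayleigh_eq, le_div_iff₀ (by positivity)]
  simp only [dataForm] at hq
  -- In the Dirichlet case the trace of `p` is 0, so the value of `K` does not matter.
  induction h using WithTop.recTopCoe with
  | top =>
    have h0 := (hX hpX).2.2 rfl
    rw [h0] at hq ⊢
    simp only [norm_zero] at hq ⊢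
    linarith
  | coe r =>
    rw [hK r rfl] at hq
    simp only [WithTop.untopD_coe]
    linarith

/-! ### Functions of class `C_c^1` belong to the form domain -/

theorem exists_smooth_approx {φ : Plane → ℝ} (h1 : ContDiff ℝ 1 φ) (h2 : HasCompactSupport φ)
    {ε : ℝ} (hε : 0 < ε) : ∃ ψ : Plane → ℝ, ContDiff ℝ ∞ ψ ∧ HasCompactSupport ψ ∧
      (∀ x, ‖ψ x - φ x‖ ≤ ε) ∧ ∀ x, ‖gradient ψ x - gradient φ x‖ ≤ ε := by
  have hu1 := h2.uniformContinuous_of_continuous h1.continuous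
  have hd := h1.continuous_fderiv (by norm_num)
  have hu2 := (h2.fderiv (𝕜 := ℝ)).uniformContinuous_of_continuous hd
  obtain ⟨δ1, hδ1, H1⟩ := Metric.uniformContinuous_iff.1 hu1 ε hε
  obtain ⟨δ2, hδ2, H2⟩ := Metric.uniformContinuous_iff.1 hu2 ε hε
  have hδ : 0 < min δ1 δ2 := lt_min hδ1 hδ2
  let b : ContDiffBump (0 : Plane) := ⟨min δ1 δ2 / 2, min δ1 δ2, by linarith, by linarith⟩
  have hbc : ContDiff ℝ ∞ (b.normed volume) := b.contDiff_normed
  have hbs : HasCompactSupport (b.normed volume) := b.hasCompactSupport_normed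
  have hbl : LocallyIntegrable (b.normed volume) := hbc.continuous.locallyIntegrable
  set ψ : Plane → ℝ := convolution (b.normed volume) φ (ContinuousLinearMap.lsmul ℝ ℝ) volume
    with hψ
  refine ⟨ψ, ?_, ?_, fun x => ?_, fun x => ?_⟩
  · exact hbs.contDiff_convolution_left _ hbc h1.continuous.locallyIntegrable
  · exact HasCompactSupport.convolution _ hbs h2
  · rw [← dist_eq_norm]
    exact b.dist_normed_convolution_le h1.continuous.aestronglyMeasurable
      fun y hy => (H1 (hy.trans_le (min_le_left _ _))).le
  · have h3 : HasFDerivAt ψ (convolution (b.normed volume) (fderiv ℝ φ)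
        (ContinuousLinearMap.lsmul ℝ ℝ) volume x) x := by
      have := h2.hasFDerivAt_convolution_right (ContinuousLinearMap.lsmul ℝ ℝ) hbl h1 x
      have e : convolution (b.normed volume) (fderiv ℝ φ)
          ((ContinuousLinearMap.lsmul ℝ ℝ).precompR Plane) volume x =
          convolution (b.normed volume) (fderiv ℝ φ) (ContinuousLinearMap.lsmul ℝ ℝ) volume x := by
        simp only [convolution]
        congr 1
      rw [e] at this
      exact this
    rw [gradient, gradient, ← map_sub, LinearIsometryEquiv.norm_map, h3.fderiv, ← dist_eq_norm]
    exact b.dist_normed_convolution_le hd.aestronglyMeasurable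
      fun y hy => (H2 (hy.trans_le (min_le_right _ _))).le

theorem norm_toLp_sub_toLp_le {X E : Type*} [MeasurableSpace X] {ν : Measure X}
    [IsFiniteMeasure ν] [NormedAddCommGroup E] {f g : X → E} (hf : MemLp f 2 ν)
    (hg : MemLp g 2 ν) {ε : ℝ} (hε : 0 ≤ ε) (h : ∀ x, ‖f x - g x‖ ≤ ε) :
    ‖hf.toLp f - hg.toLp g‖ ≤ (measureUnivNNReal ν : ℝ) ^ (2 : ℝ≥0∞).toReal⁻¹ * ε := by
  rw [← MemLp.toLp_sub]
  refine Lp.norm_le_of_ae_bound hε ?_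
  filter_upwards [(hf.sub hg).coeFn_toLp] with x hx
  rw [hx]
  exact h x

/-- The test functions used later are only `C¹`, whereas the form domain is built from smooth data.
Mollification converges uniformly together with the gradient, and both measures are finite. -/
theorem dataOf_mem_closure {α : ℝ} {Ω : Set Plane} (hvol : volume Ω < ⊤) {φ : Plane → ℝ}
    (h1 : ContDiff ℝ 1 φ) (h2 : HasCompactSupport φ) :
    dataOf α Ω φ h1 h2 ∈ closure (smoothData α Ω) := by
  have hfin : IsFiniteMeasure (volume.restrict Ω) := ⟨by simpa using hvol⟩
  rw [Metric.mem_closure_iff]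
  intro ε hε
  set A : ℝ := (measureUnivNNReal (volume.restrict Ω) : ℝ) ^ (2 : ℝ≥0∞).toReal⁻¹ with hA
  set B : ℝ := (measureUnivNNReal (circleMeasure α) : ℝ) ^ (2 : ℝ≥0∞).toReal⁻¹ with hB
  have hA0 : 0 ≤ A := by positivity
  have hB0 : 0 ≤ B := by positivity
  set δ := ε / (1 + A + B) with hδ
  have hδ0 : 0 < δ := by positivity
  have hδ1 : (1 + A + B) * δ = ε := by rw [hδ]; field_simp
  obtain ⟨ψ, hψ1, hψ2, hv, hg⟩ := exists_smooth_approx h1 h2 hδ0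
  refine ⟨dataOf α Ω ψ (contDiff_one_of_infty hψ1) hψ2,
    ⟨ψ, hψ1, hψ2, (memLp_value hψ1.continuous hψ2).coeFn_toLp,
      (memLp_gradient (contDiff_one_of_infty hψ1) hψ2).coeFn_toLp,
      (memLp_circle hψ1.continuous hψ2).coeFn_toLp⟩, ?_⟩
  rw [dist_comm, Prod.dist_eq, Prod.dist_eq, max_lt_iff, max_lt_iff]
  simp only [dist_eq_norm, dataOf]
  refine ⟨(norm_toLp_sub_toLp_le _ _ hδ0.le hv).trans_lt ?_,
    (norm_toLp_sub_toLp_le _ _ hδ0.le hg).trans_lt ?_,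
    (norm_toLp_sub_toLp_le _ _ hδ0.le hv).trans_lt ?_⟩
  · change A * δ < ε
    nlinarith
  · change A * δ < ε
    nlinarith
  · change B * δ < ε
    nlinarith

theorem isWeakGradient_gradient {Ω : Set Plane} {f : Plane → ℝ} (h1 : ContDiff ℝ 1 f) :
    IsWeakGradient Ω f (gradient f) := by
  intro φ hφ hφc hφΩ
  have hφ1 := contDiff_one_of_infty hφ
  have hsub : ∀ x ∉ Ω, x ∉ tsupport φ := fun x hx h => hx (hφΩ h)
  have hgs : tsupport (gradient φ) ⊆ tsupport φ := by
    refine closure_minimal (fun x hx => ?_) (isClosed_tsupport φ)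
    refine support_fderiv_subset ℝ (fun h0 => hx ?_)
    simp only [gradient]
    rw [h0, map_zero]
  rw [setIntegral_eq_integral_of_forall_compl_eq_zero fun x hx => by
      rw [image_eq_zero_of_notMem_tsupport fun h => hsub x hx (hgs h), smul_zero],
    setIntegral_eq_integral_of_forall_compl_eq_zero fun x hx => by
      rw [image_eq_zero_of_notMem_tsupport (hsub x hx), zero_smul]]
  have hgφ := continuous_gradient hφ1
  have hgf := continuous_gradient h1
  have hi1 : Integrable fun x => f x • gradient φ x :=
    (h1.continuous.smul hgφ).integrable_of_hasCompactSupport (hasCompactSupport_gradient hφc).smul_left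
  have hi2 : Integrable fun x => φ x • gradient f x :=
    (hφ.continuous.smul hgf).integrable_of_hasCompactSupport hφc.smul_right
  have hi3 : Integrable fun x => f x * φ x :=
    (h1.continuous.mul hφ.continuous).integrable_of_hasCompactSupport hφc.mul_left
  refine ext_inner_left ℝ fun w => ?_
  rw [inner_neg_right, ← integral_inner hi1, ← integral_inner hi2]
  have e1 : ∀ x, inner ℝ w (f x • gradient φ x) = f x * fderiv ℝ φ x w := fun x => by
    rw [inner_smul_right, real_inner_comm, inner_gradient]
  have e2 : ∀ x, inner ℝ w (φ x • gradient f x) = fderiv ℝ f x w * φ x := fun x => by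
    rw [inner_smul_right, real_inner_comm, inner_gradient, mul_comm]
  have hj1 := hi1.const_inner (𝕜 := ℝ) w
  have hj2 := hi2.const_inner (𝕜 := ℝ) w
  simp only [e1, e2] at hj1 hj2 ⊢
  exact integral_mul_fderiv_eq_neg_fderiv_mul_of_integrable hj2 hj1 hi3
    (fun x _ => h1.differentiable (by norm_num) x) (fun x _ => hφ1.differentiable (by norm_num) x)

theorem IsWeakGradient.congr {Ω : Set Plane} {u u' : Plane → ℝ} {g g' : Plane → Plane}
    (h : IsWeakGradient Ω u g) (hu : u =ᵐ[volume.restrict Ω] u')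
    (hg : g =ᵐ[volume.restrict Ω] g') : IsWeakGradient Ω u' g' := by
  intro φ hφ hφc hφΩ
  have e1 : ∫ x in Ω, u' x • gradient φ x = ∫ x in Ω, u x • gradient φ x :=
    integral_congr_ae (by filter_upwards [hu] with x hx; rw [hx])
  have e2 : ∫ x in Ω, φ x • g' x = ∫ x in Ω, φ x • g x :=
    integral_congr_ae (by filter_upwards [hg] with x hx; rw [hx])
  rw [e1, e2]
  exact h φ hφ hφc hφΩ

theorem dataOf_mem_formDomain {h : WithTop ℝ} {α : ℝ} {Ω : Set Plane} (hα : 0 < α)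
    (hvol : volume Ω < ⊤) {φ : Plane → ℝ} (h1 : ContDiff ℝ 1 φ) (h2 : HasCompactSupport φ)
    (h3 : h = ⊤ → ∀ x, ‖x‖ = α → φ x = 0) : dataOf α Ω φ h1 h2 ∈ formDomain h α Ω := by
  refine ⟨(isWeakGradient_gradient h1).congr (memLp_value h1.continuous h2).coeFn_toLp.symm
      (memLp_gradient h1 h2).coeFn_toLp.symm,
    dataOf_mem_closure hvol h1 h2, fun htop => ?_⟩
  have h4 := norm_sq_toLp (memLp_circle (α := α) h1.continuous h2)
  simp only [Real.norm_eq_abs, sq_abs] at h4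
  -- The circle may be parametrised from any larger outer radius.
  have hlt : α < 2 * α := by linarith
  rw [integral_circleMeasure hα hlt (fun x => φ x ^ 2) (h1.continuous.pow 2)] at h4
  have h5 : ∀ θ, φ (polarMap (2 * α) (Real.log (2 * α / α)) θ) = 0 := fun θ => by
    refine h3 htop _ ?_
    rw [norm_polarMap (by linarith), Real.exp_neg, Real.exp_log (by positivity)]
    field_simp
  simp only [h5] at h4
  have h6 : ‖(memLp_circle (α := α) h1.continuous h2).toLp φ‖ ^ 2 = 0 := by rw [h4]; simp
  exact norm_eq_zero.1 (pow_eq_zero_iff two_ne_zero |>.1 h6)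

/-! ### The upper bound by orthogonal test functions -/

theorem norm_sq_sum_smul {ι E : Type*} [Fintype ι] [NormedAddCommGroup E]
    [InnerProductSpace ℝ E] {f : ι → E} (h : ∀ i j, i ≠ j → inner ℝ (f i) (f j) = 0)
    (c : ι → ℝ) : ‖∑ i, c i • f i‖ ^ 2 = ∑ i, c i ^ 2 * ‖f i‖ ^ 2 := by
  rw [← real_inner_self_eq_norm_sq, sum_inner]
  refine Finset.sum_congr rfl fun i _ => ?_
  rw [inner_sum, Finset.sum_eq_single i]
  · rw [inner_smul_left, inner_smul_right, real_inner_self_eq_norm_sq]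
    simp only [conj_trivial]
    ring
  · intro j _ hj
    rw [inner_smul_left, inner_smul_right, h i j hj.symm]
    simp
  · simp

/-- Orthogonality in all three components makes the form diagonal on the span, so its sign there is
decided on the generators. -/
theorem tau_le_of_orthogonal {h : WithTop ℝ} {α : ℝ} {Ω : Set Plane} (hα : 0 < α)
    (hvol : volume Ω < ⊤) {i : ℕ} (Φ : Fin i → testSpace) {μ K : ℝ}
    (hK : ∀ r : ℝ, h = r → K = r) (htop : h = ⊤ → ∀ j x, ‖x‖ = α → (Φ j).1 x = 0)
    (horth : ∀ j k, j ≠ k →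
      inner ℝ (testMap α Ω (Φ j)).1 (testMap α Ω (Φ k)).1 = 0 ∧
      inner ℝ (testMap α Ω (Φ j)).2.1 (testMap α Ω (Φ k)).2.1 = 0 ∧
      inner ℝ (testMap α Ω (Φ j)).2.2 (testMap α Ω (Φ k)).2.2 = 0)
    (hpos : ∀ j, 0 < ‖(testMap α Ω (Φ j)).1‖)
    (hform : ∀ j, dataForm μ K (testMap α Ω (Φ j)) ≤ 0) : tau i h α Ω ≤ (μ : EReal) := by
  set S : (Fin i → ℝ) →ₗ[ℝ] testSpace := Fintype.linearCombination ℝ Φ with hS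
  set T := testMap α Ω ∘ₗ S with hT
  have hTc : ∀ c, T c = ∑ j, c j • testMap α Ω (Φ j) := fun c => by
    rw [hT, LinearMap.comp_apply, hS, Fintype.linearCombination_apply, map_sum]
    simp only [map_smul]
  have n1 : ∀ c, ‖(T c).1‖ ^ 2 = ∑ j, c j ^ 2 * ‖(testMap α Ω (Φ j)).1‖ ^ 2 := fun c => by
    rw [hTc, Prod.fst_sum]
    exact norm_sq_sum_smul (fun j k hjk => (horth j k hjk).1) c
  have n2 : ∀ c, ‖(T c).2.1‖ ^ 2 = ∑ j, c j ^ 2 * ‖(testMap α Ω (Φ j)).2.1‖ ^ 2 := fun c => by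
    rw [hTc, Prod.snd_sum, Prod.fst_sum]
    exact norm_sq_sum_smul (fun j k hjk => (horth j k hjk).2.1) c
  have n3 : ∀ c, ‖(T c).2.2‖ ^ 2 = ∑ j, c j ^ 2 * ‖(testMap α Ω (Φ j)).2.2‖ ^ 2 := fun c => by
    rw [hTc, Prod.snd_sum, Prod.snd_sum]
    exact norm_sq_sum_smul (fun j k hjk => (horth j k hjk).2.2) c
  have hne : ∀ c, c ≠ 0 → 0 < ‖(T c).1‖ ^ 2 := fun c hc => by
    obtain ⟨j, hj⟩ := Function.ne_iff.1 hc
    rw [n1]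
    refine Finset.sum_pos' (fun k _ => by positivity) ⟨j, Finset.mem_univ j, ?_⟩
    have h1 := hpos j
    have h2 : 0 < c j ^ 2 := by
      have : c j ≠ 0 := hj
      positivity
    positivity
  have hinj : Function.Injective T := by
    rw [injective_iff_map_eq_zero]
    intro c hc
    by_contra h0
    have := hne c h0
    rw [hc] at this
    simp at this
  have hle : ∀ c, ‖(T c).2.1‖ ^ 2 + K * ‖(T c).2.2‖ ^ 2 ≤ μ * ‖(T c).1‖ ^ 2 := fun c => by
    rw [n1, n2, n3, Finset.mul_sum, Finset.mul_sum, ← Finset.sum_add_distrib]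
    refine Finset.sum_le_sum fun j _ => ?_
    have h1 := mul_nonneg (sq_nonneg (c j)) (neg_nonneg.2 (hform j))
    simp only [dataForm] at h1
    linarith
  refine iInf_le_of_le (LinearMap.range T) (iInf_le_of_le ?_ (iInf_le_of_le ?_ ?_))
  · rw [LinearMap.finrank_range_of_inj hinj]
    simp
  · rintro _ ⟨c, rfl⟩
    refine dataOf_mem_formDomain hα hvol (S c).2.1 (S c).2.2 fun ht x hx => ?_
    rw [hS, Fintype.linearCombination_apply, Submodule.coe_sum, Finset.sum_apply]
    refine Finset.sum_eq_zero fun j _ => ?_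
    rw [Submodule.coe_smul, Pi.smul_apply, htop ht j x hx, smul_zero]
  · refine iSup_le fun p => iSup_le fun hp => iSup_le fun hp0 => ?_
    obtain ⟨c, rfl⟩ := hp
    have hc0 : c ≠ 0 := fun h0 => hp0 (by rw [h0, map_zero])
    rw [EReal.coe_le_coe_iff, rayleigh_eq, div_le_iff₀ (hne c hc0)]
    refine le_trans (le_of_eq ?_) (hle c)
    induction h using WithTop.recTopCoe with
    | top =>
      have h0 : (T c).2.2 = 0 := by
        refine (dataOf_mem_formDomain (h := ⊤) hα hvol (S c).2.1 (S c).2.2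
          fun ht x hx => ?_).2.2 rfl
        rw [hS, Fintype.linearCombination_apply, Submodule.coe_sum, Finset.sum_apply]
        refine Finset.sum_eq_zero fun j _ => ?_
        rw [Submodule.coe_smul, Pi.smul_apply, htop ht j x hx, smul_zero]
      simp [h0]
    | coe r => rw [hK r rfl, WithTop.untopD_coe]

/-! ### Angular functions and rotations -/

/-- The direction of a point of the plane as a complex number. -/
def unitDir (x : Plane) : ℂ := ((x 0 : ℂ) + x 1 * Complex.I) / ‖x‖

/-- The function `cos (n θ - φ)` of the polar angle `θ`. -/
def angular (n : ℤ) (φ : ℝ) (x : Plane) : ℝ :=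
  (Complex.exp (-φ * Complex.I) * unitDir x ^ n).re

theorem polarMap_ne_zero {β : ℝ} (hβ : 0 < β) (t θ : ℝ) : polarMap β t θ ≠ 0 := by
  rw [← norm_pos_iff, norm_polarMap hβ.le]
  positivity

theorem unitDir_polarMap {β : ℝ} (hβ : 0 < β) (t θ : ℝ) :
    unitDir (polarMap β t θ) = Complex.exp (θ * Complex.I) := by
  have h0 : ((β * Real.exp (-t) : ℝ) : ℂ) ≠ 0 := by
    rw [Complex.ofReal_ne_zero]
    positivity
  rw [unitDir, norm_polarMap hβ.le, div_eq_iff h0, Complex.exp_mul_I]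
  simp only [polarMap, Matrix.cons_val_zero, Matrix.cons_val_one]
  push_cast
  ring

theorem angular_polarMap {β : ℝ} (hβ : 0 < β) (n : ℤ) (φ t θ : ℝ) :
    angular n φ (polarMap β t θ) = Real.cos (n * θ - φ) := by
  rw [angular, unitDir_polarMap hβ, ← Complex.exp_int_mul, ← Complex.exp_add,
    ← Complex.exp_ofReal_mul_I_re]
  congr 2
  push_cast
  ring

theorem log_div_norm_polarMap {β : ℝ} (hβ : 0 < β) (t θ : ℝ) :
    Real.log (β / ‖polarMap β t θ‖) = t := by
  rw [norm_polarMap hβ.le, Real.exp_neg]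
  have : β / (β * (Real.exp t)⁻¹) = Real.exp t := by field_simp
  rw [this, Real.log_exp]

theorem exists_eq_polarMap {β : ℝ} (hβ : 0 < β) {x : Plane} (hx : x ≠ 0) :
    ∃ t θ, x = polarMap β t θ := by
  have hn : 0 < ‖x‖ := norm_pos_iff.2 hx
  set z : ℂ := ⟨x 0, x 1⟩ with hz
  have hzn : ‖z‖ = ‖x‖ := by
    rw [← sq_eq_sq₀ (norm_nonneg _) (norm_nonneg _), norm_sq_plane, Complex.sq_norm,
      Complex.normSq_mk]
    ring
  refine ⟨Real.log (β / ‖x‖), z.arg, ?_⟩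
  have he : β * Real.exp (-Real.log (β / ‖x‖)) = ‖z‖ := by
    rw [Real.exp_neg, Real.exp_log (by positivity), hzn]
    field_simp
  ext i
  fin_cases i
  · simp only [polarMap, he, Complex.norm_mul_cos_arg, Fin.zero_eta, Matrix.cons_val_zero]
    rw [hz]
  · simp only [polarMap, he, Complex.norm_mul_sin_arg, Fin.mk_one, Matrix.cons_val_one,
      Matrix.cons_val_zero]
    rw [hz]

theorem unitDir_ne_zero {x : Plane} (hx : x ≠ 0) : unitDir x ≠ 0 := by
  obtain ⟨t, θ, rfl⟩ := exists_eq_polarMap one_pos hx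
  rw [unitDir_polarMap one_pos]
  exact Complex.exp_ne_zero _

theorem contDiffAt_unitDir {x : Plane} (hx : x ≠ 0) : ContDiffAt ℝ 1 unitDir x := by
  have h : ∀ i : Fin 2, ContDiff ℝ 1 fun x : Plane => ((x i : ℝ) : ℂ) := fun i =>
    Complex.ofRealCLM.contDiff.comp (EuclideanSpace.proj (𝕜 := ℝ) i).contDiff
  have hn : ContDiffAt ℝ 1 (fun x : Plane => ((‖x‖ : ℝ) : ℂ)) x :=
    Complex.ofRealCLM.contDiff.contDiffAt.comp x (contDiffAt_norm ℝ hx)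
  exact ((h 0).contDiffAt.add ((h 1).contDiffAt.mul contDiffAt_const)).mul
    (hn.inv (Complex.ofReal_ne_zero.2 (norm_ne_zero_iff.2 hx)))

theorem contDiffAt_angular (k : ℕ) (φ : ℝ) {x : Plane} (hx : x ≠ 0) :
    ContDiffAt ℝ 1 (angular k φ) x := by
  unfold angular
  simp only [zpow_natCast]
  exact Complex.reCLM.contDiff.contDiffAt.comp x
    (contDiffAt_const.mul ((contDiffAt_unitDir hx).pow k))

theorem continuousAt_unitDir_zpow (n : ℤ) {x : Plane} (hx : x ≠ 0) :
    ContinuousAt (fun x => unitDir x ^ n) x :=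
  (contDiffAt_unitDir hx).continuousAt.zpow₀ n (Or.inl (unitDir_ne_zero hx))

theorem continuousAt_angular (n : ℤ) (φ : ℝ) {x : Plane} (hx : x ≠ 0) :
    ContinuousAt (angular n φ) x :=
  Complex.continuous_re.continuousAt.comp
    (continuousAt_const.mul (continuousAt_unitDir_zpow n hx))

theorem angular_zero (φ : ℝ) (x : Plane) : angular 0 φ x = Real.cos φ := by
  rw [angular, zpow_zero, mul_one, ← Complex.ofReal_neg, Complex.exp_ofReal_mul_I_re, Real.cos_neg]

theorem angular_add_pi (n : ℤ) (φ : ℝ) (x : Plane) :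
    angular n (φ + Real.pi) x = -angular n φ x := by
  have h : Complex.exp (-((φ + Real.pi : ℝ) : ℂ) * Complex.I) =
      -Complex.exp (-(φ : ℂ) * Complex.I) := by
    have h1 : -((φ + Real.pi : ℝ) : ℂ) * Complex.I = -(φ : ℂ) * Complex.I - Real.pi * Complex.I := by
      push_cast
      ring
    rw [h1, Complex.exp_sub_pi_mul_I]
  rw [angular, h, neg_mul, Complex.neg_re, angular]

theorem norm_rotate (t : ℝ) (x : Plane) : ‖rotate t x‖ = ‖x‖ := by
  rw [← sq_eq_sq₀ (norm_nonneg _) (norm_nonneg _), norm_sq_plane, norm_sq_plane]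
  simp only [rotate, Matrix.cons_val_zero, Matrix.cons_val_one]
  linear_combination (x 0 ^ 2 + x 1 ^ 2) * Real.sin_sq_add_cos_sq t

theorem unitDir_rotate (t : ℝ) (x : Plane) :
    unitDir (rotate t x) = Complex.exp (t * Complex.I) * unitDir x := by
  rw [unitDir, unitDir, norm_rotate, Complex.exp_mul_I, ← mul_div_assoc]
  congr 1
  simp only [rotate, Matrix.cons_val_zero, Matrix.cons_val_one]
  push_cast
  linear_combination (-(Complex.sin t) * x 1) * Complex.I_sq

/-- The rotation as a linear isometry. -/
def rotateIsometry (t : ℝ) : Plane ≃ₗᵢ[ℝ] Plane :=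
  LinearIsometry.toLinearIsometryEquiv
    { toFun := rotate t
      map_add' := fun x y => by
        ext i
        fin_cases i
        · simp [rotate]; ring
        · simp [rotate]; ring
      map_smul' := fun c x => by
        ext i
        fin_cases i
        · simp [rotate]; ring
        · simp [rotate]; ring
      norm_map' := norm_rotate t } rfl

theorem integral_rotate {E : Type*} [NormedAddCommGroup E] [NormedSpace ℝ E] {q : ℕ}
    {Ω : Set Plane} (hΩ : SymmetricOfOrder q Ω) (F : Plane → E) :
    ∫ x in Ω, F (rotate (2 * Real.pi / q) x) = ∫ x in Ω, F x := by
  have h := (rotateIsometry (2 * Real.pi / q)).measurePreserving.setIntegral_image_emb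
    (rotateIsometry (2 * Real.pi / q)).toHomeomorph.measurableEmbedding F Ω
  have e : (rotateIsometry (2 * Real.pi / q)) '' Ω = Ω := hΩ
  rw [e] at h
  exact h.symm

/-- The rotation by `2π/q` preserves `Ω` and multiplies the complex integrand by `e^{2πin/q} ≠ 1`,
so its integral is 0; take real parts. -/
theorem integral_radial_mul_angular {q : ℕ} (hq : 0 < q) {Ω : Set Plane}
    (hΩ : SymmetricOfOrder q Ω) {n : ℤ} (hn : ¬ (q : ℤ) ∣ n) (φ : ℝ) (b : ℝ → ℝ)
    (hint : IntegrableOn (fun x : Plane => ((b ‖x‖ : ℝ) : ℂ) *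
      (Complex.exp (-φ * Complex.I) * unitDir x ^ n)) Ω) :
    ∫ x in Ω, b ‖x‖ * angular n φ x = 0 := by
  set F : Plane → ℂ := fun x => ((b ‖x‖ : ℝ) : ℂ) *
      (Complex.exp (-φ * Complex.I) * unitDir x ^ n) with hF
  set ζ : ℂ := Complex.exp (((2 * Real.pi / q : ℝ) : ℂ) * Complex.I) ^ n with hζ
  have h1 : ∀ x, F (rotate (2 * Real.pi / q) x) = ζ * F x := fun x => by
    simp only [hF, norm_rotate, unitDir_rotate, mul_zpow, ← hζ]
    ring
  have h2 := integral_rotate hΩ F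
  simp only [h1, integral_const_mul] at h2
  have hζ1 : ζ ≠ 1 := by
    intro h3
    rw [hζ, ← Complex.exp_int_mul, Complex.exp_eq_one_iff] at h3
    obtain ⟨k, hk⟩ := h3
    have hq0 : (q : ℂ) ≠ 0 := Nat.cast_ne_zero.2 hq.ne'
    have hpi : (2 * Real.pi * Complex.I : ℂ) ≠ 0 := Complex.two_pi_I_ne_zero
    have h4 : (n : ℂ) * (2 * Real.pi * Complex.I) = (k * q) * (2 * Real.pi * Complex.I) := by
      push_cast at hk
      field_simp at hk
      linear_combination (2 * (Real.pi : ℂ) * Complex.I) * hk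
    have h5 := mul_right_cancel₀ hpi h4
    refine hn ⟨k, ?_⟩
    rw [mul_comm]
    exact_mod_cast h5
  have h3 : ∫ x in Ω, F x = 0 := by
    have : (ζ - 1) * ∫ x in Ω, F x = 0 := by rw [sub_mul, h2]; ring
    exact (mul_eq_zero.1 this).resolve_left (sub_ne_zero.2 hζ1)
  have h4 := integral_re (𝕜 := ℂ) hint
  have h5 : ∀ x, b ‖x‖ * angular n φ x = RCLike.re (F x) := fun x => by
    simp only [hF, angular, RCLike.re_to_complex, Complex.re_ofReal_mul]
  simp only [h5]
  rw [h4, ← hF, h3, map_zero]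

theorem integrableOn_of_continuousAt {E : Type*} [NormedAddCommGroup E] {α R : ℝ} (hα : 0 < α)
    {Ω : Set Plane} (hΩ : ∀ x ∈ Ω, α < ‖x‖ ∧ ‖x‖ < R) {F : Plane → E}
    (hF : ∀ x, x ≠ 0 → ContinuousAt F x) : IntegrableOn F Ω := by
  have hc : IsCompact (Metric.closedBall (0 : Plane) R \ Metric.ball 0 α) :=
    (isCompact_closedBall 0 R).diff Metric.isOpen_ball
  refine (ContinuousOn.integrableOn_compact hc fun x hx => (hF x ?_).continuousWithinAt).mono_set
    fun x hx => ?_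
  · rintro rfl
    exact hx.2 (by simpa using hα)
  · have := hΩ x hx
    simp only [mem_sdiff, mem_closedBall_zero_iff, mem_ball_zero_iff]
    exact ⟨this.2.le, not_lt.2 this.1.le⟩

/-- The alternative `n = 0`, `cos φ = 0` is the case of a sine and a cosine of the same frequency.
-/
theorem integral_continuous_radial_mul_angular {q : ℕ} (hq : 0 < q) {α R : ℝ} (hα : 0 < α)
    {Ω : Set Plane} (hΩs : ∀ x ∈ Ω, α < ‖x‖ ∧ ‖x‖ < R) (hΩ : SymmetricOfOrder q Ω) {n : ℤ}
    {φ : ℝ} (hn : ¬ (q : ℤ) ∣ n ∨ n = 0 ∧ Real.cos φ = 0) {b : ℝ → ℝ}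
    (hb : ∀ r, r ≠ 0 → ContinuousAt b r) : ∫ x in Ω, b ‖x‖ * angular n φ x = 0 := by
  rcases hn with hn | ⟨rfl, h0⟩
  · refine integral_radial_mul_angular hq hΩ hn φ b
      (integrableOn_of_continuousAt hα hΩs fun x hx => ?_)
    refine (Complex.continuous_ofReal.continuousAt.comp ?_).mul
      (continuousAt_const.mul (continuousAt_unitDir_zpow n hx))
    exact ContinuousAt.comp (f := fun x : Plane => ‖x‖) (hb _ (norm_ne_zero_iff.2 hx))
      continuous_norm.continuousAt
  · simp [angular_zero, h0]

theorem integral_cos_int_mul_sub {n : ℤ} {φ : ℝ} (hn : n ≠ 0 ∨ Real.cos φ = 0) :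
    ∫ θ in (-Real.pi)..Real.pi, Real.cos (n * θ - φ) = 0 := by
  by_cases h0 : n = 0
  · simp [h0, hn.resolve_left (not_not.2 h0)]
  · have hn' : (n : ℝ) ≠ 0 := Int.cast_ne_zero.2 h0
    rw [intervalIntegral.integral_comp_mul_sub (fun x => Real.cos x) hn' φ, integral_cos,
      Real.sin_sub, Real.sin_sub]
    have h1 : Real.sin (n * Real.pi) = 0 := Real.sin_int_mul_pi n
    have h2 : (n : ℝ) * -Real.pi = -(n * Real.pi) := by ring
    rw [h2, Real.sin_neg, Real.cos_neg, h1]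
    simp

/-! ### Test functions with separated variables -/

/-- The function `a (log (β / r)) cos (k θ - φ)`. -/
def modeFun (β : ℝ) (a : ℝ → ℝ) (k : ℕ) (φ : ℝ) (x : Plane) : ℝ :=
  if x = 0 then 0 else a (Real.log (β / ‖x‖)) * angular k φ x

theorem modeFun_polarMap {β : ℝ} (hβ : 0 < β) (a : ℝ → ℝ) (k : ℕ) (φ t θ : ℝ) :
    modeFun β a k φ (polarMap β t θ) = a t * Real.cos (k * θ - φ) := by
  rw [modeFun, if_neg (polarMap_ne_zero hβ t θ), log_div_norm_polarMap hβ, angular_polarMap hβ,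
    Int.cast_natCast]

theorem exists_forall_eq_zero_of_hasCompactSupport {a : ℝ → ℝ} (ha : HasCompactSupport a) :
    ∃ T > 0, ∀ t, T < |t| → a t = 0 := by
  obtain ⟨T, hT⟩ := ha.isCompact.isBounded.subset_closedBall 0
  refine ⟨max T 1, by positivity, fun t ht => image_eq_zero_of_notMem_tsupport fun h => ?_⟩
  have h1 := hT h
  rw [mem_closedBall_zero_iff, Real.norm_eq_abs] at h1
  exact absurd ((le_max_left T 1).trans_lt ht) (not_lt.2 h1)

/-- Compact support of `a` in the variable `log (β / r)` makes the function vanish near the origin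
as well as far away, so the singularity of the angle is harmless. -/
theorem contDiff_modeFun {β : ℝ} (hβ : 0 < β) {a : ℝ → ℝ} (ha : ContDiff ℝ 1 a)
    (hs : HasCompactSupport a) (k : ℕ) (φ : ℝ) : ContDiff ℝ 1 (modeFun β a k φ) := by
  obtain ⟨T, hT, hz⟩ := exists_forall_eq_zero_of_hasCompactSupport hs
  rw [contDiff_iff_contDiffAt]
  intro x
  by_cases hx : x = 0
  · subst hx
    refine (contDiffAt_const (c := (0 : ℝ))).congr_of_eventuallyEq ?_
    filter_upwards [Metric.ball_mem_nhds (0 : Plane) (by positivity : 0 < β * Real.exp (-T))]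
      with y hy
    rw [modeFun]
    split_ifs with h
    · rfl
    · rw [hz, zero_mul]
      have hy0 : 0 < ‖y‖ := norm_pos_iff.2 h
      refine lt_of_lt_of_le ?_ (le_abs_self _)
      rw [Real.lt_log_iff_exp_lt (by positivity), lt_div_iff₀ hy0]
      rw [mem_ball_zero_iff, Real.exp_neg, ← div_eq_mul_inv, lt_div_iff₀ (Real.exp_pos T)] at hy
      linarith
  · have hn : 0 < ‖x‖ := norm_pos_iff.2 hx
    have h1 : ContDiffAt ℝ 1 (fun x : Plane => a (Real.log (β / ‖x‖)) * angular k φ x) x := by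
      refine (ha.contDiffAt.comp x ?_).mul (contDiffAt_angular k φ hx)
      exact (contDiffAt_const.div (contDiffAt_norm ℝ hx) hn.ne').log (div_pos hβ hn).ne'
    refine h1.congr_of_eventuallyEq ?_
    filter_upwards [isOpen_ne.mem_nhds hx] with y hy
    rw [modeFun, if_neg hy]

theorem hasCompactSupport_modeFun {β : ℝ} (hβ : 0 < β) {a : ℝ → ℝ}
    (hs : HasCompactSupport a) (k : ℕ) (φ : ℝ) : HasCompactSupport (modeFun β a k φ) := by
  obtain ⟨T, hT, hz⟩ := exists_forall_eq_zero_of_hasCompactSupport hs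
  refine HasCompactSupport.of_support_subset_isCompact
    (isCompact_closedBall (0 : Plane) (β * Real.exp T)) fun y hy => ?_
  by_contra hc
  rw [mem_closedBall_zero_iff, not_le] at hc
  have hy0 : 0 < ‖y‖ := lt_trans (by positivity) hc
  refine hy ?_
  rw [modeFun]
  split_ifs
  · rfl
  · rw [hz, zero_mul]
    refine lt_of_lt_of_le ?_ (neg_le_abs _)
    rw [lt_neg, Real.log_lt_iff_lt_exp (by positivity), div_lt_iff₀ hy0, Real.exp_neg,
      inv_mul_eq_div, lt_div_iff₀ (Real.exp_pos T)]
    exact hc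

/-- The test function as an element of `C_c^1`. -/
def modeTest {β : ℝ} (hβ : 0 < β) {a : ℝ → ℝ} (ha : ContDiff ℝ 1 a) (hs : HasCompactSupport a)
    (k : ℕ) (φ : ℝ) : testSpace :=
  ⟨modeFun β a k φ, contDiff_modeFun hβ ha hs k φ, hasCompactSupport_modeFun hβ hs k φ⟩

theorem cos_mul_cos_eq (x y : ℝ) :
    Real.cos x * Real.cos y = (Real.cos (x - y) + Real.cos (x + y)) / 2 := by
  rw [Real.cos_sub, Real.cos_add]
  ring

theorem sin_mul_sin_eq (x y : ℝ) :
    Real.sin x * Real.sin y = (Real.cos (x - y) - Real.cos (x + y)) / 2 := by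
  rw [Real.cos_sub, Real.cos_add]
  ring

/-- The product-to-sum formulas leave only the frequencies `k - k'` and `k + k'`, to which the
symmetry of `Ω` can be applied. -/
theorem modeFun_mul_modeFun {β : ℝ} (hβ : 0 < β) (a : ℝ → ℝ) (k k' : ℕ) (φ φ' : ℝ) {x : Plane}
    (hx : x ≠ 0) : modeFun β a k φ x * modeFun β a k' φ' x =
      a (Real.log (β / ‖x‖)) ^ 2 / 2 * angular (k - k') (φ - φ') x +
        a (Real.log (β / ‖x‖)) ^ 2 / 2 * angular (k + k') (φ + φ') x := by
  obtain ⟨t, θ, rfl⟩ := exists_eq_polarMap hβ hx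
  rw [modeFun_polarMap hβ, modeFun_polarMap hβ, angular_polarMap hβ, angular_polarMap hβ,
    log_div_norm_polarMap hβ]
  have h := cos_mul_cos_eq (k * θ - φ) (k' * θ - φ')
  have e1 : (((k : ℤ) - k' : ℤ) : ℝ) * θ - (φ - φ') = k * θ - φ - (k' * θ - φ') := by
    push_cast
    ring
  have e2 : (((k : ℤ) + k' : ℤ) : ℝ) * θ - (φ + φ') = k * θ - φ + (k' * θ - φ') := by
    push_cast
    ring
  rw [e1, e2]
  linear_combination a t ^ 2 * h

theorem inner_gradient_modeFun {β : ℝ} (hβ : 0 < β) {a : ℝ → ℝ} (ha : ContDiff ℝ 1 a)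
    (hs : HasCompactSupport a) (k k' : ℕ) (φ φ' : ℝ) {x : Plane} (hx : x ≠ 0) :
    inner ℝ (gradient (modeFun β a k φ) x) (gradient (modeFun β a k' φ') x) =
      (deriv a (Real.log (β / ‖x‖)) ^ 2 + k * k' * a (Real.log (β / ‖x‖)) ^ 2) / ‖x‖ ^ 2 / 2 *
          angular (k - k') (φ - φ') x +
        (deriv a (Real.log (β / ‖x‖)) ^ 2 - k * k' * a (Real.log (β / ‖x‖)) ^ 2) / ‖x‖ ^ 2 / 2 *
          angular (k + k') (φ + φ') x := by
  have hn : 0 < ‖x‖ := norm_pos_iff.2 hx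
  obtain ⟨t, θ, rfl⟩ := exists_eq_polarMap hβ hx
  have hl : ∀ (k : ℕ) (φ : ℝ), inner ℝ (gradient (modeFun β a k φ) (polarMap β t θ))
      (-polarMap β t θ) = deriv a t * Real.cos (k * θ - φ) := fun k φ => by
    refine (hasDerivAt_comp_polarMap_left
      ((contDiff_modeFun hβ ha hs k φ).differentiable (by norm_num) _)).unique ?_
    simp only [modeFun_polarMap hβ]
    exact ((ha.differentiable (by norm_num) t).hasDerivAt).mul_const _
  have hr : ∀ (k : ℕ) (φ : ℝ), inner ℝ (gradient (modeFun β a k φ) (polarMap β t θ))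
      (rotQuarter (polarMap β t θ)) = -(k * a t * Real.sin (k * θ - φ)) := fun k φ => by
    refine (hasDerivAt_comp_polarMap_right
      ((contDiff_modeFun hβ ha hs k φ).differentiable (by norm_num) _)).unique ?_
    simp only [modeFun_polarMap hβ]
    have h1 : HasDerivAt (fun θ : ℝ => (k : ℝ) * θ - φ) k θ :=
      (((hasDerivAt_id θ).const_mul (k : ℝ)).sub_const φ).congr_deriv (mul_one _)
    exact (h1.cos.const_mul (a t)).congr_deriv (by ring)
  have key := inner_mul_norm_sq (gradient (modeFun β a k φ) (polarMap β t θ))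
    (gradient (modeFun β a k' φ') (polarMap β t θ)) (polarMap β t θ)
  rw [hl, hl, hr, hr] at key
  rw [angular_polarMap hβ, angular_polarMap hβ, log_div_norm_polarMap hβ]
  have h1 := cos_mul_cos_eq (k * θ - φ) (k' * θ - φ')
  have h2 := sin_mul_sin_eq (k * θ - φ) (k' * θ - φ')
  have e1 : (((k : ℤ) - k' : ℤ) : ℝ) * θ - (φ - φ') = k * θ - φ - (k' * θ - φ') := by
    push_cast
    ring
  have e2 : (((k : ℤ) + k' : ℤ) : ℝ) * θ - (φ + φ') = k * θ - φ + (k' * θ - φ') := by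
    push_cast
    ring
  rw [e1, e2]
  field_simp
  rw [mul_assoc, mul_left_comm] at *
  linear_combination 2 * key + 2 * deriv a t ^ 2 * h1 + 2 * k * k' * a t ^ 2 * h2

/-! ### The form on test functions with separated variables -/

theorem inner_toLp {X E : Type*} [MeasurableSpace X] {ν : Measure X} [NormedAddCommGroup E]
    [InnerProductSpace ℝ E] {f g : X → E} (hf : MemLp f 2 ν) (hg : MemLp g 2 ν) :
    inner ℝ (hf.toLp f) (hg.toLp g) = ∫ x, inner ℝ (f x) (g x) ∂ν := by
  rw [L2.inner_def]
  refine integral_congr_ae ?_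
  filter_upwards [hf.coeFn_toLp, hg.coeFn_toLp] with x h1 h2
  rw [h1, h2]

theorem continuousAt_comp_log_div {β : ℝ} (hβ : 0 < β) {a : ℝ → ℝ} (ha : Continuous a) {r : ℝ}
    (hr : r ≠ 0) : ContinuousAt (fun r => a (Real.log (β / r))) r :=
  ha.continuousAt.comp (f := fun r => Real.log (β / r))
    ((continuousAt_const.div continuousAt_id hr).log (div_ne_zero hβ.ne' hr))

theorem integral_two_radial_mul_angular {α R : ℝ} (hα : 0 < α) {Ω : Set Plane}
    (hΩs : ∀ x ∈ Ω, α < ‖x‖ ∧ ‖x‖ < R) {b b' : ℝ → ℝ} (hb : ∀ r, r ≠ 0 → ContinuousAt b r)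
    (hb' : ∀ r, r ≠ 0 → ContinuousAt b' r) (n n' : ℤ) (φ φ' : ℝ) :
    ∫ x in Ω, (b ‖x‖ * angular n φ x + b' ‖x‖ * angular n' φ' x) =
      (∫ x in Ω, b ‖x‖ * angular n φ x) + ∫ x in Ω, b' ‖x‖ * angular n' φ' x := by
  refine integral_add ?_ ?_
  · exact integrableOn_of_continuousAt hα hΩs fun x hx =>
      (ContinuousAt.comp (f := fun x : Plane => ‖x‖) (hb _ (norm_ne_zero_iff.2 hx))
        continuous_norm.continuousAt).mul (continuousAt_angular n φ hx)
  · exact integrableOn_of_continuousAt hα hΩs fun x hx =>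
      (ContinuousAt.comp (f := fun x : Plane => ‖x‖) (hb' _ (norm_ne_zero_iff.2 hx))
        continuous_norm.continuousAt).mul (continuousAt_angular n' φ' hx)

theorem integral_modeFun_mul_modeFun {α β R : ℝ} (hα : 0 < α) (hβ : 0 < β) {Ω : Set Plane}
    (hΩo : IsOpen Ω) (hΩs : ∀ x ∈ Ω, α < ‖x‖ ∧ ‖x‖ < R) {a : ℝ → ℝ} (ha : ContDiff ℝ 1 a)
    (k k' : ℕ) (φ φ' : ℝ) : ∫ x in Ω, modeFun β a k φ x * modeFun β a k' φ' x =
      (∫ x in Ω, a (Real.log (β / ‖x‖)) ^ 2 / 2 * angular (k - k') (φ - φ') x) +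
        ∫ x in Ω, a (Real.log (β / ‖x‖)) ^ 2 / 2 * angular (k + k') (φ + φ') x := by
  have hne : ∀ x ∈ Ω, x ≠ 0 := fun x hx => norm_pos_iff.1 (hα.trans (hΩs x hx).1)
  rw [setIntegral_congr_fun hΩo.measurableSet
    fun x hx => modeFun_mul_modeFun hβ a k k' φ φ' (hne x hx)]
  have hb : ∀ r, r ≠ 0 → ContinuousAt (fun r => a (Real.log (β / r)) ^ 2 / 2) r := fun r hr =>
    ((continuousAt_comp_log_div hβ ha.continuous hr).pow 2).div_const 2
  exact integral_two_radial_mul_angular hα hΩs hb hb _ _ _ _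

theorem integral_inner_gradient_modeFun {α β R : ℝ} (hα : 0 < α) (hβ : 0 < β) {Ω : Set Plane}
    (hΩo : IsOpen Ω) (hΩs : ∀ x ∈ Ω, α < ‖x‖ ∧ ‖x‖ < R) {a : ℝ → ℝ} (ha : ContDiff ℝ 1 a)
    (hs : HasCompactSupport a) (k k' : ℕ) (φ φ' : ℝ) :
    ∫ x in Ω, inner ℝ (gradient (modeFun β a k φ) x) (gradient (modeFun β a k' φ') x) =
      (∫ x in Ω, (deriv a (Real.log (β / ‖x‖)) ^ 2 + k * k' * a (Real.log (β / ‖x‖)) ^ 2) /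
        ‖x‖ ^ 2 / 2 * angular (k - k') (φ - φ') x) +
      ∫ x in Ω, (deriv a (Real.log (β / ‖x‖)) ^ 2 - k * k' * a (Real.log (β / ‖x‖)) ^ 2) /
        ‖x‖ ^ 2 / 2 * angular (k + k') (φ + φ') x := by
  have hne : ∀ x ∈ Ω, x ≠ 0 := fun x hx => norm_pos_iff.1 (hα.trans (hΩs x hx).1)
  rw [setIntegral_congr_fun hΩo.measurableSet
    fun x hx => inner_gradient_modeFun hβ ha hs k k' φ φ' (hne x hx)]
  have h0 : ∀ r, r ≠ 0 → ContinuousAt (fun r => a (Real.log (β / r))) r := fun r hr =>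
    continuousAt_comp_log_div hβ ha.continuous hr
  have h1 : ∀ r, r ≠ 0 → ContinuousAt (fun r => deriv a (Real.log (β / r))) r := fun r hr =>
    continuousAt_comp_log_div hβ (ha.continuous_deriv_one) hr
  exact integral_two_radial_mul_angular hα hΩs
    (b := fun r => (deriv a (Real.log (β / r)) ^ 2 + k * k' * a (Real.log (β / r)) ^ 2) /
        r ^ 2 / 2)
    (b' := fun r => (deriv a (Real.log (β / r)) ^ 2 - k * k' * a (Real.log (β / r)) ^ 2) /
        r ^ 2 / 2)
    (fun r hr => ((((h1 r hr).pow 2).add (((h0 r hr).pow 2).const_mul _)).div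
      (continuousAt_id.pow 2) (pow_ne_zero 2 hr)).div_const 2)
    (fun r hr => ((((h1 r hr).pow 2).sub (((h0 r hr).pow 2).const_mul _)).div
      (continuousAt_id.pow 2) (pow_ne_zero 2 hr)).div_const 2) _ _ _ _

theorem integral_circle_modeFun_mul_modeFun {α β : ℝ} (hα : 0 < α) (hαβ : α < β) {a : ℝ → ℝ}
    (ha : ContDiff ℝ 1 a) (hs : HasCompactSupport a) (k k' : ℕ) (φ φ' : ℝ) :
    ∫ x, modeFun β a k φ x * modeFun β a k' φ' x ∂circleMeasure α =
      α * (a (Real.log (β / α)) ^ 2 / 2 *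
        ((∫ θ in (-Real.pi)..Real.pi, Real.cos (((k - k' : ℤ) : ℝ) * θ - (φ - φ'))) +
          ∫ θ in (-Real.pi)..Real.pi, Real.cos (((k + k' : ℤ) : ℝ) * θ - (φ + φ')))) := by
  have hβ := hα.trans hαβ
  rw [integral_circleMeasure hα hαβ (fun x => modeFun β a k φ x * modeFun β a k' φ' x) ((contDiff_modeFun hβ ha hs k φ).continuous.mul
    (contDiff_modeFun hβ ha hs k' φ').continuous)]
  congr 1
  rw [← intervalIntegral.integral_add, ← intervalIntegral.integral_const_mul]
  · refine intervalIntegral.integral_congr fun θ _ => ?_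
    rw [modeFun_polarMap hβ, modeFun_polarMap hβ]
    have h := cos_mul_cos_eq (k * θ - φ) (k' * θ - φ')
    have e1 : (((k : ℤ) - k' : ℤ) : ℝ) * θ - (φ - φ') = k * θ - φ - (k' * θ - φ') := by
      push_cast
      ring
    have e2 : (((k : ℤ) + k' : ℤ) : ℝ) * θ - (φ + φ') = k * θ - φ + (k' * θ - φ') := by
      push_cast
      ring
    rw [e1, e2]
    linear_combination a (Real.log (β / α)) ^ 2 * h
  · exact Continuous.intervalIntegrable (by fun_prop) _ _
  · exact Continuous.intervalIntegrable (by fun_prop) _ _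

theorem testMap_modeTest_orthogonal {α β R : ℝ} (hα : 0 < α) (hαβ : α < β) (hβ : 0 < β)
    {Ω : Set Plane} (hΩo : IsOpen Ω) (hΩs : ∀ x ∈ Ω, α < ‖x‖ ∧ ‖x‖ < R) {q : ℕ} (hq : 0 < q)
    (hΩ : SymmetricOfOrder q Ω) {a : ℝ → ℝ} (ha : ContDiff ℝ 1 a) (hs : HasCompactSupport a)
    {k k' : ℕ} {φ φ' : ℝ} (h1 : ¬ (q : ℤ) ∣ (k - k' : ℤ) ∨ (k - k' : ℤ) = 0 ∧ Real.cos (φ - φ') = 0)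
    (h2 : ¬ (q : ℤ) ∣ (k + k' : ℤ)) :
    inner ℝ (testMap α Ω (modeTest hβ ha hs k φ)).1 (testMap α Ω (modeTest hβ ha hs k' φ')).1 = 0 ∧
    inner ℝ (testMap α Ω (modeTest hβ ha hs k φ)).2.1
      (testMap α Ω (modeTest hβ ha hs k' φ')).2.1 = 0 ∧
    inner ℝ (testMap α Ω (modeTest hβ ha hs k φ)).2.2
      (testMap α Ω (modeTest hβ ha hs k' φ')).2.2 = 0 := by
  have hc0 : ∀ r, r ≠ 0 → ContinuousAt (fun r => a (Real.log (β / r))) r := fun r hr =>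
    continuousAt_comp_log_div hβ ha.continuous hr
  have hc1 : ∀ r, r ≠ 0 → ContinuousAt (fun r => deriv a (Real.log (β / r))) r := fun r hr =>
    continuousAt_comp_log_div hβ (ha.continuous_deriv_one) hr
  have hne1 : (k - k' : ℤ) ≠ 0 ∨ Real.cos (φ - φ') = 0 :=
    h1.imp (fun h h0 => h (h0 ▸ dvd_zero _)) (fun h => h.2)
  have hne2 : (k + k' : ℤ) ≠ 0 := fun h0 => h2 (h0 ▸ dvd_zero _)
  refine ⟨?_, ?_, ?_⟩
  · have e := inner_toLp (memLp_value (Ω := Ω) (contDiff_modeFun hβ ha hs k φ).continuous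
      (hasCompactSupport_modeFun hβ hs k φ)) (memLp_value (contDiff_modeFun hβ ha hs k' φ').continuous
      (hasCompactSupport_modeFun hβ hs k' φ'))
    refine e.trans ?_
    have e2 : ∀ x, inner ℝ (modeFun β a k φ x) (modeFun β a k' φ' x) =
      modeFun β a k φ x * modeFun β a k' φ' x := fun x => mul_comm _ _
    simp only [e2]
    rw [integral_modeFun_mul_modeFun hα hβ hΩo hΩs ha,
      integral_continuous_radial_mul_angular hq hα hΩs hΩ h1
        (b := fun r => a (Real.log (β / r)) ^ 2 / 2) (fun r hr => ((hc0 r hr).pow 2).div_const 2),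
      integral_continuous_radial_mul_angular hq hα hΩs hΩ (Or.inl h2)
        (b := fun r => a (Real.log (β / r)) ^ 2 / 2) (fun r hr => ((hc0 r hr).pow 2).div_const 2),
      add_zero]
  · have e := inner_toLp (memLp_gradient (Ω := Ω) (contDiff_modeFun hβ ha hs k φ)
      (hasCompactSupport_modeFun hβ hs k φ)) (memLp_gradient (contDiff_modeFun hβ ha hs k' φ')
      (hasCompactSupport_modeFun hβ hs k' φ'))
    refine e.trans ?_
    rw [integral_inner_gradient_modeFun hα hβ hΩo hΩs ha hs,
      integral_continuous_radial_mul_angular hq hα hΩs hΩ h1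
        (b := fun r => (deriv a (Real.log (β / r)) ^ 2 + k * k' * a (Real.log (β / r)) ^ 2) /
          r ^ 2 / 2)
        (fun r hr => ((((hc1 r hr).pow 2).add (((hc0 r hr).pow 2).const_mul _)).div
          (continuousAt_id.pow 2) (pow_ne_zero 2 hr)).div_const 2),
      integral_continuous_radial_mul_angular hq hα hΩs hΩ (Or.inl h2)
        (b := fun r => (deriv a (Real.log (β / r)) ^ 2 - k * k' * a (Real.log (β / r)) ^ 2) /
          r ^ 2 / 2)
        (fun r hr => ((((hc1 r hr).pow 2).sub (((hc0 r hr).pow 2).const_mul _)).div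
          (continuousAt_id.pow 2) (pow_ne_zero 2 hr)).div_const 2),
      add_zero]
  · have e := inner_toLp (memLp_circle (α := α) (contDiff_modeFun hβ ha hs k φ).continuous
      (hasCompactSupport_modeFun hβ hs k φ)) (memLp_circle (contDiff_modeFun hβ ha hs k' φ').continuous
      (hasCompactSupport_modeFun hβ hs k' φ'))
    refine e.trans ?_
    have e2 : ∀ x, inner ℝ (modeFun β a k φ x) (modeFun β a k' φ' x) =
      modeFun β a k φ x * modeFun β a k' φ' x := fun x => mul_comm _ _
    simp only [e2]
    rw [integral_circle_modeFun_mul_modeFun hα hαβ ha hs, integral_cos_int_mul_sub hne1,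
      integral_cos_int_mul_sub (Or.inl hne2)]
    ring

/-- If the function vanished on the open set `Ω`, then `cos (k θ - φ)` would vanish along an arc
together with its derivative, which is impossible for `k ≠ 0`. For `k = 0` the phase is 0 and the
cosine is 1. -/
theorem norm_testMap_modeTest_pos {α β R : ℝ} (hα : 0 < α) (hβ : 0 < β)
    {Ω : Set Plane} (hΩo : IsOpen Ω) (hΩs : ∀ x ∈ Ω, α < ‖x‖ ∧ ‖x‖ < R) (hne : Ω.Nonempty)
    {a : ℝ → ℝ} (ha : ContDiff ℝ 1 a) (hs : HasCompactSupport a)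
    (hpos : ∀ x ∈ Ω, 0 < a (Real.log (β / ‖x‖))) {k : ℕ} {φ : ℝ} (hkφ : k = 0 → φ = 0) :
    0 < ‖(testMap α Ω (modeTest hβ ha hs k φ)).1‖ := by
  have hc := (contDiff_modeFun hβ ha hs k φ).continuous
  have e := norm_sq_toLp (memLp_value (Ω := Ω) hc (hasCompactSupport_modeFun hβ hs k φ))
  have hint : IntegrableOn (fun x => ‖modeFun β a k φ x‖ ^ 2) Ω :=
    integrableOn_of_continuousAt hα hΩs fun x _ => (hc.norm.pow 2).continuousAt
  have hsup : (Function.support (fun x => ‖modeFun β a k φ x‖ ^ 2) ∩ Ω).Nonempty := by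
    by_contra hcon
    have hz : ∀ x ∈ Ω, modeFun β a k φ x = 0 := fun x hx => by
      by_contra h0
      refine hcon ⟨x, ?_, hx⟩
      rw [Function.mem_support]
      positivity
    obtain ⟨x, hx⟩ := hne
    obtain ⟨t, θ, rfl⟩ := exists_eq_polarMap hβ (norm_pos_iff.1 (hα.trans (hΩs x hx).1))
    have ht := hpos _ hx
    rw [log_div_norm_polarMap hβ] at ht
    have hnear : ∀ᶠ θ' in 𝓝 θ, Real.cos (k * θ' - φ) = 0 := by
      have hcont : Continuous fun θ' => polarMap β t θ' :=
        (continuous_polarMap β).comp (Continuous.prodMk_right t)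
      filter_upwards [hcont.continuousAt.preimage_mem_nhds (hΩo.mem_nhds hx)] with θ' hθ'
      have := hz _ hθ'
      rw [modeFun_polarMap hβ] at this
      exact (mul_eq_zero.1 this).resolve_left ht.ne'
    have h1 : HasDerivAt (fun θ : ℝ => (k : ℝ) * θ - φ) k θ :=
      (((hasDerivAt_id θ).const_mul (k : ℝ)).sub_const φ).congr_deriv (mul_one _)
    have h2 := h1.cos.unique ((hasDerivAt_const θ (0 : ℝ)).congr_of_eventuallyEq hnear)
    have h3 := hnear.self_of_nhds
    by_cases hk : k = 0
    · rw [hkφ hk, hk] at h3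
      simp at h3
    · have hk' : (k : ℝ) ≠ 0 := Nat.cast_ne_zero.2 hk
      have h4 : Real.sin (k * θ - φ) = 0 := by
        have := (mul_eq_zero.1 h2).resolve_right hk'
        linarith
      have h5 := Real.sin_sq_add_cos_sq (k * θ - φ)
      rw [h3, h4] at h5
      norm_num at h5
  have h1 : 0 < ∫ x in Ω, ‖modeFun β a k φ x‖ ^ 2 := by
    rw [setIntegral_pos_iff_support_of_nonneg_ae (Filter.Eventually.of_forall fun x => by
      simp only [Pi.zero_apply]; positivity) hint]
    exact ((isOpen_ne.preimage (hc.norm.pow 2)).inter hΩo).measure_pos volume hsup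
  rw [← e] at h1
  have aux : ∀ r : ℝ, 0 ≤ r → 0 < r ^ 2 → 0 < r := fun r h h' =>
    h.lt_of_ne fun h0 => by simp [← h0] at h'
  exact aux _ (norm_nonneg _) h1

/-- The angular average of the quadratic form on a radial profile with angular frequency `l`. -/
def profileForm (β : ℝ) (a : ℝ → ℝ) (l : ℕ) (μ : ℝ) (Ω : Set Plane) : ℝ :=
  ∫ x in Ω, ((deriv a (Real.log (β / ‖x‖)) ^ 2 + l ^ 2 * a (Real.log (β / ‖x‖)) ^ 2) / ‖x‖ ^ 2 -
    μ * a (Real.log (β / ‖x‖)) ^ 2)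

/-- The angular oscillation of the quadratic form. -/
def oscForm (β : ℝ) (a : ℝ → ℝ) (k : ℕ) (φ μ : ℝ) (Ω : Set Plane) : ℝ :=
  ∫ x in Ω, ((deriv a (Real.log (β / ‖x‖)) ^ 2 - k ^ 2 * a (Real.log (β / ‖x‖)) ^ 2) / ‖x‖ ^ 2 -
    μ * a (Real.log (β / ‖x‖)) ^ 2) * angular (k + k) (φ + φ) x

theorem continuousAt_profile {β : ℝ} {a : ℝ → ℝ} (hβ : 0 < β) (ha : ContDiff ℝ 1 a) (c μ : ℝ) {r : ℝ} (hr : r ≠ 0) :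
    ContinuousAt (fun r => (deriv a (Real.log (β / r)) ^ 2 + c * a (Real.log (β / r)) ^ 2) / r ^ 2 -
      μ * a (Real.log (β / r)) ^ 2) r := by
  have hc0 := continuousAt_comp_log_div hβ ha.continuous hr
  have hc1 := continuousAt_comp_log_div hβ (ha.continuous_deriv_one) hr
  exact (((hc1.pow 2).add ((hc0.pow 2).const_mul _)).div (continuousAt_id.pow 2)
    (pow_ne_zero 2 hr)).sub ((hc0.pow 2).const_mul _)

theorem integrableOn_profile {α β R : ℝ} (hα : 0 < α) (hβ : 0 < β) {Ω : Set Plane}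
    (hΩs : ∀ x ∈ Ω, α < ‖x‖ ∧ ‖x‖ < R) {a : ℝ → ℝ} (ha : ContDiff ℝ 1 a) (c μ : ℝ) : IntegrableOn (fun x : Plane =>
    (deriv a (Real.log (β / ‖x‖)) ^ 2 + c * a (Real.log (β / ‖x‖)) ^ 2) / ‖x‖ ^ 2 -
      μ * a (Real.log (β / ‖x‖)) ^ 2) Ω :=
  integrableOn_of_continuousAt hα hΩs fun _ hx =>
    ContinuousAt.comp (f := fun x : Plane => ‖x‖)
      (continuousAt_profile hβ ha c μ (norm_ne_zero_iff.2 hx)) continuous_norm.continuousAt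

theorem dataForm_modeTest {α β R : ℝ} (hα : 0 < α) (hαβ : α < β) (hβ : 0 < β) {Ω : Set Plane}
    (hΩo : IsOpen Ω) (hΩs : ∀ x ∈ Ω, α < ‖x‖ ∧ ‖x‖ < R) {a : ℝ → ℝ} (ha : ContDiff ℝ 1 a)
    (hs : HasCompactSupport a) (μ K : ℝ) (k : ℕ) (φ : ℝ) :
    dataForm μ K (testMap α Ω (modeTest hβ ha hs k φ)) =
      (profileForm β a k μ Ω + oscForm β a k φ μ Ω) / 2 +
        K * (α * (a (Real.log (β / α)) ^ 2 / 2 * (2 * Real.pi +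
          ∫ θ in (-Real.pi)..Real.pi, Real.cos (((k + k : ℤ) : ℝ) * θ - (φ + φ))))) := by
  have hne : ∀ x ∈ Ω, x ≠ 0 := fun x hx => norm_pos_iff.1 (hα.trans (hΩs x hx).1)
  have h1 := dataForm_dataOf (Ω := Ω) (α := α) μ K (contDiff_modeFun hβ ha hs k φ)
    (hasCompactSupport_modeFun hβ hs k φ)
  refine h1.trans ?_
  have hc := integral_circle_modeFun_mul_modeFun hα hαβ ha hs k k φ φ
  simp only [← sq] at hc
  rw [hc]
  have e1 : ∫ θ in (-Real.pi)..Real.pi, Real.cos (((k - k : ℤ) : ℝ) * θ - (φ - φ)) =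
      2 * Real.pi := by
    simp
    ring
  rw [e1]
  congr 1
  have hgi : IntegrableOn (fun x => ‖gradient (modeFun β a k φ) x‖ ^ 2) Ω :=
    integrableOn_of_continuousAt hα hΩs fun x _ =>
      ((continuous_gradient (contDiff_modeFun hβ ha hs k φ)).norm.pow 2).continuousAt
  have hfi : IntegrableOn (fun x => μ * modeFun β a k φ x ^ 2) Ω :=
    integrableOn_of_continuousAt hα hΩs fun x _ =>
      (((contDiff_modeFun hβ ha hs k φ).continuous.pow 2).const_mul μ).continuousAt
  have hp := integrableOn_profile hα hβ hΩs ha (k ^ 2) μ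
  have ho : IntegrableOn (fun x => ((deriv a (Real.log (β / ‖x‖)) ^ 2 -
      k ^ 2 * a (Real.log (β / ‖x‖)) ^ 2) / ‖x‖ ^ 2 - μ * a (Real.log (β / ‖x‖)) ^ 2) *
        angular (k + k) (φ + φ) x) Ω :=
    integrableOn_of_continuousAt hα hΩs fun x hx => by
      have := ContinuousAt.comp (f := fun x : Plane => ‖x‖)
        (continuousAt_profile hβ ha (-k ^ 2) μ (norm_ne_zero_iff.2 hx)) continuous_norm.continuousAt
      refine ContinuousAt.mul ?_ (continuousAt_angular (k + k) (φ + φ) hx)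
      refine this.congr (Filter.Eventually.of_forall fun y => ?_)
      simp only [Function.comp_apply]
      ring
  rw [← integral_const_mul, ← integral_sub hgi hfi, profileForm, oscForm, ← integral_add hp ho,
    ← integral_div]
  refine setIntegral_congr_fun hΩo.measurableSet fun x hx => ?_
  have g1 := inner_gradient_modeFun hβ ha hs k k φ φ (hne x hx)
  have g2 := modeFun_mul_modeFun hβ a k k φ φ (hne x hx)
  rw [real_inner_self_eq_norm_sq, sub_self, sub_self, angular_zero, Real.cos_zero] at g1
  rw [sub_self, sub_self, angular_zero, Real.cos_zero] at g2
  beta_reduce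
  rw [g1, sq (modeFun β a k φ x), g2]
  ring

theorem profileForm_mono {α β R : ℝ} (hα : 0 < α) (hβ : 0 < β) {Ω : Set Plane}
    (hΩo : IsOpen Ω) (hΩs : ∀ x ∈ Ω, α < ‖x‖ ∧ ‖x‖ < R) {a : ℝ → ℝ} (ha : ContDiff ℝ 1 a)
    (μ : ℝ) {k l : ℕ} (hkl : k ≤ l) : profileForm β a k μ Ω ≤ profileForm β a l μ Ω := by
  refine setIntegral_mono_on (integrableOn_profile hα hβ hΩs ha _ μ)
    (integrableOn_profile hα hβ hΩs ha _ μ) hΩo.measurableSet fun x _ => ?_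
  have : (k : ℝ) ≤ l := by exact_mod_cast hkl
  gcongr

/-- The averaged form increases with the frequency, so `l` is the worst case. For `k = 0` the
oscillating part equals the average and the boundary integral doubles too, so the same condition
suffices. -/
theorem dataForm_modeTest_nonpos {α β R : ℝ} (hα : 0 < α) (hαβ : α < β) (hβ : 0 < β)
    {Ω : Set Plane} (hΩo : IsOpen Ω) (hΩs : ∀ x ∈ Ω, α < ‖x‖ ∧ ‖x‖ < R) {a : ℝ → ℝ}
    (ha : ContDiff ℝ 1 a) (hs : HasCompactSupport a) {μ K : ℝ} {k l : ℕ} (hkl : k ≤ l) {φ : ℝ}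
    (h0 : k = 0 → φ = 0) (hosc : k ≠ 0 → oscForm β a k φ μ Ω ≤ 0)
    (hJ : profileForm β a l μ Ω + 2 * Real.pi * (K * α) * a (Real.log (β / α)) ^ 2 ≤ 0) :
    dataForm μ K (testMap α Ω (modeTest hβ ha hs k φ)) ≤ 0 := by
  have hm := profileForm_mono hα hβ hΩo hΩs ha μ hkl
  rw [dataForm_modeTest hα hαβ hβ hΩo hΩs]
  by_cases hk : k = 0
  · have e : oscForm β a k φ μ Ω = profileForm β a k μ Ω := by
      rw [oscForm, profileForm]
      simp [hk, h0 hk, angular_zero]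
    rw [e]
    have e2 : ∫ θ in (-Real.pi)..Real.pi, Real.cos (((k + k : ℤ) : ℝ) * θ - (φ + φ)) =
        2 * Real.pi := by
      simp [hk, h0 hk]
      ring
    rw [e2]
    linarith
  · rw [integral_cos_int_mul_sub (Or.inl (by omega))]
    have := hosc hk
    linarith

theorem oscForm_eq_zero {α β R : ℝ} (hα : 0 < α) (hβ : 0 < β) {Ω : Set Plane}
    (hΩs : ∀ x ∈ Ω, α < ‖x‖ ∧ ‖x‖ < R) {q : ℕ} (hq : 0 < q) (hΩ : SymmetricOfOrder q Ω)
    {a : ℝ → ℝ} (ha : ContDiff ℝ 1 a) (μ : ℝ) {k : ℕ} (hk : 0 < k) (hkq : 2 * k < q) (φ : ℝ) :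
    oscForm β a k φ μ Ω = 0 := by
  have hdvd : ¬ (q : ℤ) ∣ (k + k : ℤ) := fun h => by
    have := Int.le_of_dvd (by omega) h
    omega
  refine integral_continuous_radial_mul_angular hq hα hΩs hΩ (Or.inl hdvd)
    (b := fun r => (deriv a (Real.log (β / r)) ^ 2 - k ^ 2 * a (Real.log (β / r)) ^ 2) / r ^ 2 -
      μ * a (Real.log (β / r)) ^ 2) fun r hr => ?_
  refine (continuousAt_profile hβ ha (-k ^ 2) μ hr).congr (Filter.Eventually.of_forall fun y => ?_)
  ring

theorem oscForm_add_pi_div_two (β : ℝ) (a : ℝ → ℝ) (k : ℕ) (φ μ : ℝ) (Ω : Set Plane) :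
    oscForm β a k (φ + Real.pi / 2) μ Ω = -oscForm β a k φ μ Ω := by
  rw [oscForm, oscForm, ← integral_neg]
  have e : φ + Real.pi / 2 + (φ + Real.pi / 2) = φ + φ + Real.pi := by ring
  simp only [e, angular_add_pi, mul_neg]

/-- The upper bound for the `i`-th eigenvalue, `i = 2 l` or `i = 2 l + 1`, by the test functions
with a common radial profile and angular frequencies up to `l`. -/
theorem tau_le_of_profileForm_nonpos {h : WithTop ℝ} {α β R : ℝ} (hα : 0 < α) (hαβ : α < β)
    {Ω : Set Plane} (hΩo : IsOpen Ω) (hΩs : ∀ x ∈ Ω, α < ‖x‖ ∧ ‖x‖ < R) (hne : Ω.Nonempty)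
    {q : ℕ} (hΩ : SymmetricOfOrder q Ω) {i : ℕ} (hi : 2 ≤ i) (hiq : i ≤ q) {a : ℝ → ℝ}
    (ha : ContDiff ℝ 1 a) (hs : HasCompactSupport a)
    (hpos : ∀ x ∈ Ω, 0 < a (Real.log (β / ‖x‖))) {μ K : ℝ} (hK : ∀ r : ℝ, h = r → K = r)
    (htop : h = ⊤ → a (Real.log (β / α)) = 0)
    (hJ : profileForm β a (i / 2) μ Ω + 2 * Real.pi * (K * α) * a (Real.log (β / α)) ^ 2 ≤ 0) :
    tau i h α Ω ≤ (μ : EReal) := by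
  have hβ := hα.trans hαβ
  have hq : 0 < q := by omega
  set l := i / 2 with hl
  have hsub : Ω ⊆ Metric.ball 0 R := fun x hx => by
    rw [mem_ball_zero_iff]
    exact (hΩs x hx).2
  have hvol : volume Ω < ⊤ := (measure_mono hsub).trans_lt measure_ball_lt_top
  -- If `2 l = q`, the symmetry does not cancel the oscillation of the top frequency; but a phase
  -- shift by `π/2` reverses its sign, so one of two phases is favourable.
  obtain ⟨φ₀, hφ₀⟩ : ∃ φ₀ : ℝ, oscForm β a l φ₀ μ Ω ≤ 0 := by
    rcases le_total (oscForm β a l 0 μ Ω) 0 with h1 | h1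
    · exact ⟨0, h1⟩
    · exact ⟨0 + Real.pi / 2, by rw [oscForm_add_pi_div_two]; linarith⟩
  -- The frequencies run `0, 1, 1, 2, 2, …`; the two phases within a pair differ by `π/2`, and for
  -- even `i` the top frequency occurs only once.
  set kk : ℕ → ℕ := fun j => (j + 1) / 2 with hkk
  set ph : ℕ → ℝ := fun j => if j = 0 then 0 else
    (if kk j = l then φ₀ else 0) + (if j % 2 = 0 then Real.pi / 2 else 0) with hph
  have hph0 : ∀ j, kk j = 0 → ph j = 0 := fun j hj => by
    have : j = 0 := by simp only [hkk] at hj; omega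
    simp [hph, this]
  refine tau_le_of_orthogonal hα hvol (fun j : Fin i => modeTest hβ ha hs (kk j) (ph j)) hK ?_ ?_ ?_
    (K := K) ?_
  · intro ht j x hx
    change modeFun β a _ _ x = 0
    rw [modeFun, hx, htop ht, zero_mul, ite_self]
  · intro j j' hjj
    have hjj' : (j : ℕ) ≠ j' := fun h => hjj (Fin.ext h)
    have hj := j.2
    have hj' := j'.2
    -- Distinct indices below `i ≤ q` have frequencies whose sum lies strictly between 0 and `q`.
    have hn2 : ¬ (q : ℤ) ∣ ((kk j : ℤ) + kk j') := fun h => by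
      have h2 : (q : ℤ) ≤ (kk j : ℤ) + kk j' := by
        refine Int.le_of_dvd ?_ h
        simp only [hkk]
        omega
      simp only [hkk] at h2
      omega
    refine testMap_modeTest_orthogonal hα hαβ hβ hΩo hΩs hq hΩ ha hs ?_ hn2
    by_cases hk : kk j = kk j'
    · right
      refine ⟨by rw [hk]; ring, ?_⟩
      have hj0 : (j : ℕ) ≠ 0 := by simp only [hkk] at hk; omega
      have hj0' : (j' : ℕ) ≠ 0 := by simp only [hkk] at hk; omega
      simp only [hph, if_neg hj0, if_neg hj0', hk, add_sub_add_left_eq_sub]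
      have hpar : (j : ℕ) % 2 = 0 ↔ ¬ (j' : ℕ) % 2 = 0 := by
        simp only [hkk] at hk
        omega
      by_cases hp : (j : ℕ) % 2 = 0
      · rw [if_pos hp, if_neg (hpar.1 hp), sub_zero, Real.cos_pi_div_two]
      · rw [if_neg hp, if_pos (by tauto), zero_sub, Real.cos_neg, Real.cos_pi_div_two]
    · left
      intro hd
      have h1 : (q : ℤ) ∣ |(kk j : ℤ) - kk j'| := (dvd_abs _ _).2 hd
      have h2 := Int.le_of_dvd (abs_pos.2 (by omega)) h1
      simp only [hkk] at h2 hk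
      rcases abs_cases (((((j : ℕ) + 1) / 2 : ℕ) : ℤ) - ((((j' : ℕ) + 1) / 2 : ℕ) : ℤ)) with h3 | h3 <;>
        omega
  · exact fun j => norm_testMap_modeTest_pos hα hβ hΩo hΩs hne ha hs hpos (hph0 j)
  · intro j
    have hj := j.2
    refine dataForm_modeTest_nonpos hα hαβ hβ hΩo hΩs ha hs (l := l) ?_ (hph0 j) (fun hk0 => ?_) hJ
    · simp only [hkk, hl]
      omega
    -- Failure forces `i = q = 2 l` and `j = i - 1`, the single function of top frequency, which
    -- carries the phase `φ₀`.
    · by_cases hk : 2 * kk j < q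
      · exact (oscForm_eq_zero hα hβ hΩs hq hΩ ha μ (Nat.pos_of_ne_zero hk0) hk _).le
      · have hkl : kk j = l := by simp only [hkk, hl] at hk ⊢; omega
        have hj0 : (j : ℕ) ≠ 0 := by simp only [hkk] at hk0; omega
        have hpar : ¬ (j : ℕ) % 2 = 0 := by simp only [hkk] at hk; omega
        have e : ph j = φ₀ := by
          simp only [hph, if_neg hj0, if_neg hpar, if_pos hkl, add_zero]
        rw [e, hkl]
        exact hφ₀

/-! ### The radial profile -/

/-- As `u'(0) = 0`, continuing `u` by the constant 1 to negative `t`, that is beyond the outer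
circle, is `C¹`. The construction integrates the derivative clamped to `[0, L]` and cuts off away
from the radii in use. -/
theorem ModeSol.exists_profile {l m L : ℝ} {u v : ℝ → ℝ} (h : ModeSol l m L u v) (hL : 0 < L)
    {T : ℝ} (hT : 0 < T) : ∃ a : ℝ → ℝ, ContDiff ℝ 1 a ∧ HasCompactSupport a ∧
      (∀ t ∈ Icc 0 L, a t = u t ∧ deriv a t = v t) ∧ ∀ t ∈ Icc (-T) 0, a t = 1 ∧ deriv a t = 0 := by
  set d : ℝ → ℝ := fun t => v (max 0 (min t L)) with hd
  have hdc : Continuous d := by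
    refine h.continuousOn_v.comp_continuous (by fun_prop) fun t => ⟨le_max_left _ _, ?_⟩
    exact max_le hL.le (min_le_right _ _)
  have hd1 : ∀ t ∈ Icc 0 L, d t = v t := fun t ht => by
    simp only [hd, min_eq_left ht.2, max_eq_right ht.1]
  have hd0 : ∀ t ≤ 0, d t = 0 := fun t ht => by
    simp only [hd]
    rw [max_eq_left ((min_le_left _ _).trans ht), h.v_zero]
  set w : ℝ → ℝ := fun t => 1 + ∫ s in (0:ℝ)..t, d s with hw
  have hwd : ∀ t, HasDerivAt w (d t) t := fun t =>
    (intervalIntegral.integral_hasDerivAt_right (hdc.intervalIntegrable _ _)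
      (hdc.stronglyMeasurableAtFilter _ _) hdc.continuousAt).const_add 1
  have hwd' : deriv w = d := funext fun t => (hwd t).deriv
  have hwC : ContDiff ℝ 1 w := by
    rw [contDiff_one_iff_deriv, hwd']
    exact ⟨fun t => (hwd t).differentiableAt, hdc⟩
  have hw1 : ∀ t ∈ Icc 0 L, w t = u t := fun t ht => by
    have hsub : uIcc 0 t ⊆ Icc 0 L := by
      rw [uIcc_of_le ht.1]
      exact Icc_subset_Icc le_rfl ht.2
    have e : ∫ s in (0:ℝ)..t, d s = ∫ s in (0:ℝ)..t, v s :=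
      intervalIntegral.integral_congr fun s hs => hd1 s (hsub hs)
    simp only [hw]
    rw [e, intervalIntegral.integral_eq_sub_of_hasDerivAt
      (fun s hs => h.hasDerivAt_u (hsub hs))
      (h.continuousOn_v.mono hsub).intervalIntegrable, h.u_zero]
    ring
  have hw0 : ∀ t ≤ 0, w t = 1 := fun t ht => by
    have e : ∫ s in (0:ℝ)..t, d s = ∫ s in (0:ℝ)..t, (0:ℝ) :=
      intervalIntegral.integral_congr fun s hs => hd0 s (by
        rw [uIcc_of_ge ht] at hs
        exact hs.2)
    simp only [hw]
    rw [e]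
    simp
  let χ : ContDiffBump (0 : ℝ) := ⟨T + L, T + L + 1, by linarith, by linarith⟩
  have hχ : ∀ t ∈ Ioo (-(T + L)) (T + L), (fun t => χ t * w t) =ᶠ[𝓝 t] w := fun t ht => by
    filter_upwards [isOpen_Ioo.mem_nhds ht] with s hs
    rw [χ.one_of_mem_closedBall, one_mul]
    rw [mem_closedBall_zero_iff, Real.norm_eq_abs]
    exact abs_le.2 ⟨hs.1.le, hs.2.le⟩
  refine ⟨fun t => χ t * w t, χ.contDiff.mul hwC, χ.hasCompactSupport.mul_right, ?_, ?_⟩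
  · intro t ht
    have e := hχ t ⟨by linarith [ht.1], by linarith [ht.2]⟩
    exact ⟨e.self_of_nhds.trans (hw1 t ht), by rw [e.deriv_eq, hwd', hd1 t ht]⟩
  · intro t ht
    have e := hχ t ⟨by linarith [ht.1], by linarith [ht.2]⟩
    exact ⟨e.self_of_nhds.trans (hw0 t ht.2), by rw [e.deriv_eq, hwd', hd0 t ht.2]⟩

/-! ### Comparison of the domain with the shell -/

/-- Mass transplantation: if `f ≥ c` on `S`, `f < c` almost everywhere on `Ω \ S`, and `Ω` and `S`
have the same measure, then `∫_Ω f < ∫_S f` unless `Ω \ S` is a null set. -/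
theorem setIntegral_lt_of_volume_eq {Ω S : Set Plane} (hΩ : MeasurableSet Ω) (hS : MeasurableSet S)
    (hvol : volume S = volume Ω) (hfin : volume S < ⊤) {f : Plane → ℝ}
    (hfΩ : IntegrableOn f Ω) (hfS : IntegrableOn f S) {c : ℝ} (h1 : ∀ x ∈ S, c ≤ f x)
    (h2 : ∀ᵐ x, x ∈ Ω \ S → f x < c) (hpos : 0 < volume (Ω \ S)) :
    ∫ x in Ω, f x < ∫ x in S, f x := by
  have hfinΩ : volume Ω < ⊤ := hvol ▸ hfin
  have hgΩ : IntegrableOn (fun x => f x - c) Ω := hfΩ.sub (integrableOn_const hfinΩ.ne)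
  have hgS : IntegrableOn (fun x => f x - c) S := hfS.sub (integrableOn_const hfin.ne)
  have eΩ : ∫ x in Ω, (f x - c) = (∫ x in Ω, f x) - c * volume.real Ω := by
    rw [integral_sub hfΩ (integrableOn_const hfinΩ.ne), setIntegral_const, smul_eq_mul, mul_comm]
  have eS : ∫ x in S, (f x - c) = (∫ x in S, f x) - c * volume.real S := by
    rw [integral_sub hfS (integrableOn_const hfin.ne), setIntegral_const, smul_eq_mul, mul_comm]
  have hreal : volume.real Ω = volume.real S := by rw [Measure.real, Measure.real, hvol]
  have dΩ := integral_inter_add_sdiff hS hgΩ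
  have dS := integral_inter_add_sdiff hΩ hgS
  rw [inter_comm] at dS
  have i1 : 0 ≤ ∫ x in S \ Ω, (f x - c) :=
    setIntegral_nonneg (hS.diff hΩ) fun x hx => sub_nonneg.2 (h1 x hx.1)
  have i2 : 0 < ∫ x in Ω \ S, -(f x - c) := by
    have hae : ∀ᵐ x ∂volume.restrict (Ω \ S), f x < c := (ae_restrict_iff' (hΩ.diff hS)).2 h2
    rw [integral_pos_iff_support_of_nonneg_ae]
    · have : ∀ᵐ x ∂volume.restrict (Ω \ S), x ∈ Function.support fun x => -(f x - c) := by
        filter_upwards [hae] with x hx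
        rw [Function.mem_support]
        linarith
      have e := measure_congr (Filter.eventuallyEq_univ.2 this)
      rw [Measure.restrict_apply_univ] at e
      exact hpos.trans_eq e.symm
    · filter_upwards [hae] with x hx
      simp only [Pi.zero_apply]
      linarith
    · exact (hgΩ.mono_set sdiff_subset).neg
  rw [integral_neg] at i2
  rw [hreal] at eΩ
  linarith

/-- Rules out slits and punctures: near a boundary point outside `Ω`, the region strictly below the
Lipschitz graph is an open piece of the complement. -/
theorem exists_nhds_volume_pos_of_frontier {Ω : Set Plane} (hΩ : HasLipschitzBoundary Ω)
    {p : Plane} (hp : p ∈ frontier Ω) (hpΩ : p ∉ Ω) {V : Set Plane} (hV : V ∈ 𝓝 p) :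
    0 < volume (V \ Ω) := by
  obtain ⟨U, hU, A, L, f, hf, hUf⟩ := hΩ p hp
  set W := {x | (A x) 1 < f ((A x) 0)} with hW
  have hc : ∀ i : Fin 2, Continuous fun x => (A x) i := fun i =>
    (EuclideanSpace.proj (𝕜 := ℝ) i).continuous.comp A.continuous
  have hWo : IsOpen W := isOpen_lt (hc 1) (hf.continuous.comp (hc 0))
  have hcurve : Continuous fun s : ℝ => A.symm (A p - s • EuclideanSpace.single 1 1) :=
    A.symm.continuous.comp (by fun_prop)
  have h0 : A.symm (A p - (0:ℝ) • EuclideanSpace.single 1 1) = p := by simp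
  have hN : ∀ᶠ s in 𝓝 (0:ℝ), A.symm (A p - s • EuclideanSpace.single 1 1) ∈ interior (V ∩ U) := by
    refine hcurve.continuousAt.preimage_mem_nhds ?_
    rw [h0]
    exact interior_mem_nhds.2 (Filter.inter_mem hV hU)
  obtain ⟨s, hsN, hs0⟩ := ((hN.filter_mono nhdsWithin_le_nhds).and
    (self_mem_nhdsWithin : Ioi (0:ℝ) ∈ 𝓝[>] 0)).exists
  have hs0 : 0 < s := hs0
  have hpf : (A p) 1 ≤ f ((A p) 0) := by
    by_contra hcon
    exact hpΩ ((hUf p (mem_of_mem_nhds hU)).2 (not_le.1 hcon))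
  have hsW : A.symm (A p - s • EuclideanSpace.single 1 1) ∈ W := by
    simp only [hW, mem_ofPred_eq, AffineIsometryEquiv.apply_symm_apply]
    simp
    linarith
  refine lt_of_lt_of_le ((isOpen_interior.inter hWo).measure_pos volume ⟨_, hsN, hsW⟩)
    (measure_mono fun x hx => ?_)
  have hxV := interior_subset hx.1
  exact ⟨hxV.1, fun hxΩ => lt_asymm hx.2 ((hUf x hxV.2).1 hxΩ)⟩

/-- An open set lying in the shell up to a null set lies in it, and equal areas make the rest of the
shell null. A missing point would then be a boundary point with exterior of positive measure nearby.
-/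
theorem eq_shell_of_volume_diff_eq_zero {α β : ℝ} {Ω : Set Plane} (hΩo : IsOpen Ω)
    (hα : 0 < α) (hαβ : α < β) (hΩα : ∀ x ∈ Ω, α < ‖x‖) (hlip : HasLipschitzBoundary Ω)
    (hvol : volume (shell α β) = volume Ω) (h0 : volume (Ω \ shell α β) = 0) :
    Ω = shell α β := by
  have hfin := volume_shell_lt_top α β
  have hsub : Ω ⊆ shell α β := by
    have h1 : Ω ⊆ Metric.closedBall 0 β := by
      by_contra hcon
      obtain ⟨x, hx, hxβ⟩ := not_subset.1 hcon
      have h2 : 0 < volume (Ω \ Metric.closedBall 0 β) :=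
        (hΩo.sdiff Metric.isClosed_closedBall).measure_pos volume ⟨x, hx, hxβ⟩
      have h3 : Ω \ Metric.closedBall 0 β ⊆ Ω \ shell α β := fun y hy =>
        ⟨hy.1, fun hys => hy.2 (Metric.ball_subset_closedBall hys.1)⟩
      exact (h2.trans_le (measure_mono h3)).ne' h0
    have h2 : Ω ⊆ Metric.ball 0 β := by
      rw [← interior_closedBall (0 : Plane) (hα.trans hαβ).ne']
      exact hΩo.subset_interior_iff.2 h1
    exact fun x hx => ⟨h2 hx, by simpa using hΩα x hx⟩
  have hnull : volume (shell α β \ Ω) = 0 := by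
    rw [measure_sdiff hsub hΩo.measurableSet.nullMeasurableSet (hvol ▸ hfin).ne, hvol, tsub_self]
  refine hsub.antisymm fun p hp => ?_
  by_contra hpΩ
  have hV := (isOpen_shell α β).mem_nhds hp
  have hcl : p ∈ closure Ω := by
    rw [mem_closure_iff]
    intro o ho hpo
    by_contra hemp
    have h3 : 0 < volume (o ∩ shell α β) :=
      (ho.inter (isOpen_shell α β)).measure_pos volume ⟨p, hpo, hp⟩
    have h4 : o ∩ shell α β ⊆ shell α β \ Ω := fun y hy =>
      ⟨hy.2, fun hyΩ => hemp ⟨y, hy.1, hyΩ⟩⟩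
    exact (h3.trans_le (measure_mono h4)).ne' hnull
  have hfr : p ∈ frontier Ω := ⟨hcl, by rwa [hΩo.interior_eq]⟩
  exact (exists_nhds_volume_pos_of_frontier hlip hfr hpΩ hV).ne' hnull

theorem profileForm_shell {α β : ℝ} (hα : 0 < α) (hαβ : α < β) {a u v : ℝ → ℝ}
    (ha : ContDiff ℝ 1 a) {l : ℕ} {μ : ℝ}
    (hs : ModeSol l (μ * β ^ 2) (Real.log (β / α)) u v)
    (hau : ∀ t ∈ Icc 0 (Real.log (β / α)), a t = u t ∧ deriv a t = v t) :
    profileForm β a l μ (shell α β) =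
      2 * Real.pi * (u (Real.log (β / α)) * v (Real.log (β / α))) := by
  have hβ := hα.trans hαβ
  have hL : 0 < Real.log (β / α) := Real.log_pos ((one_lt_div hα).2 hαβ)
  rw [profileForm, integral_shell hα hαβ (fun x hx => ?_), ← hs.integral_energy hL.le,
    ← intervalIntegral.integral_const_mul]
  · refine intervalIntegral.integral_congr fun t ht => ?_
    rw [uIcc_of_le hL.le] at ht
    simp only [log_div_norm_polarMap hβ, norm_sq_polarMap, (hau t ht).1, (hau t ht).2,
      intervalIntegral.integral_const, smul_eq_mul]
    field_simp
    ring
  · have hx0 : x ≠ 0 := norm_pos_iff.1 (hα.trans_le hx.1)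
    exact (ContinuousAt.comp (f := fun x : Plane => ‖x‖)
      (continuousAt_profile hβ ha (l ^ 2) μ (norm_ne_zero_iff.2 hx0))
      continuous_norm.continuousAt).continuousWithinAt

theorem log_div_mem_Ioo {α β r : ℝ} (hα : 0 < α) (hαr : α < r) (hrβ : r < β) :
    Real.log (β / r) ∈ Ioo 0 (Real.log (β / α)) := by
  have hr := hα.trans hαr
  have hβ := hr.trans hrβ
  exact ⟨Real.log_pos ((one_lt_div hr).2 hrβ), Real.log_lt_log (div_pos hβ hr)
    (div_lt_div_of_pos_left hβ hα hαr)⟩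

theorem log_div_mem_Icc {β R r : ℝ} (hβ : 0 < β) (hr : β ≤ r) (hrR : r < R) :
    Real.log (β / r) ∈ Icc (-Real.log (R / β)) 0 := by
  have hr0 := hβ.trans_le hr
  have hR0 := hr0.trans hrR
  refine ⟨?_, Real.log_nonpos (by positivity) ((div_le_one hr0).2 hr)⟩
  rw [← Real.log_inv, inv_div]
  exact Real.log_le_log (by positivity) (div_le_div_of_nonneg_left hβ.le hr0 hrR.le)

/-- The strict comparison of the averaged forms of the domain and of the shell. -/
theorem profileForm_lt {α β R : ℝ} (hα : 0 < α) (hαβ : α < β) {Ω : Set Plane} (hΩo : IsOpen Ω)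
    (hΩs : ∀ x ∈ Ω, α < ‖x‖ ∧ ‖x‖ < R) (hvol : volume (shell α β) = volume Ω)
    (hpos : 0 < volume (Ω \ shell α β)) {a u v : ℝ → ℝ}
    (ha : ContDiff ℝ 1 a) {l : ℕ} (hl : 1 ≤ l) {μ : ℝ}
    (hs : ModeSol l (μ * β ^ 2) (Real.log (β / α)) u v)
    (hu : ∀ t ∈ Ico 0 (Real.log (β / α)), 0 < u t)
    (hu' : ∀ t ∈ Icc 0 (Real.log (β / α)), 0 ≤ u t)
    (hau : ∀ t ∈ Icc 0 (Real.log (β / α)), a t = u t ∧ deriv a t = v t)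
    (ha1 : ∀ t ∈ Icc (-Real.log (R / β)) 0, a t = 1 ∧ deriv a t = 0) :
    profileForm β a l μ Ω < profileForm β a l μ (shell α β) := by
  have hβ := hα.trans hαβ
  have hΩS : ∀ x ∈ shell α β, α < ‖x‖ ∧ ‖x‖ < β := fun x hx => (mem_shell.1 hx).symm
  -- The threshold is the density on the outer circle, where `u = 1` and `v = 0`.
  refine setIntegral_lt_of_volume_eq (c := l ^ 2 / β ^ 2 - μ) hΩo.measurableSet
    (measurableSet_shell α β) hvol (volume_shell_lt_top α β)
    (integrableOn_profile hα hβ hΩs ha (l ^ 2) μ)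
    (integrableOn_profile hα hβ hΩS ha (l ^ 2) μ) (fun x hx => ?_) ?_ hpos
  · obtain ⟨hxα, hxβ⟩ := hΩS x hx
    obtain ⟨t, θ, rfl⟩ := exists_eq_polarMap hβ (norm_pos_iff.1 (hα.trans hxα))
    have ht := Ioo_subset_Icc_self (log_div_mem_Ioo hα hxα hxβ)
    simp only [log_div_norm_polarMap hβ] at ht ⊢
    rw [(hau t ht).1, (hau t ht).2, norm_sq_polarMap]
    have key := hs.density_ge hu hu' ht
    have he : Real.exp (2 * t) * Real.exp (-2 * t) = 1 := by rw [← Real.exp_add]; simp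
    have e1 : (v t ^ 2 + (l : ℝ) ^ 2 * u t ^ 2) / (β ^ 2 * Real.exp (-2 * t)) =
        Real.exp (2 * t) * (v t ^ 2 + l ^ 2 * u t ^ 2) / β ^ 2 := by
      rw [div_eq_div_iff (by positivity) (by positivity)]
      linear_combination (-(v t ^ 2 + (l : ℝ) ^ 2 * u t ^ 2) * β ^ 2) * he
    rw [e1, ← sub_nonneg]
    have e2 : ∀ E E' U V : ℝ, E * E' = 1 →
        E * (V ^ 2 + l ^ 2 * U ^ 2) / β ^ 2 - μ * U ^ 2 - (l ^ 2 / β ^ 2 - μ) =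
          (E * (V ^ 2 + (l ^ 2 - μ * β ^ 2 * E') * U ^ 2) - (l ^ 2 - μ * β ^ 2)) / β ^ 2 := by
      intro E E' U V hE
      field_simp
      linear_combination (μ * β ^ 2 * U ^ 2) * hE
    rw [e2 _ _ _ _ he]
    exact div_nonneg (sub_nonneg.2 key) (by positivity)
  · have hnull : volume (Metric.sphere (0 : Plane) β) = 0 := Measure.addHaar_sphere _ _ _
    filter_upwards [measure_eq_zero_iff_ae_notMem.1 hnull] with x hxs hx
    obtain ⟨hxα, hxR⟩ := hΩs x hx.1
    have hle : β ≤ ‖x‖ := not_lt.1 fun h => hx.2 (mem_shell.2 ⟨h, hxα⟩)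
    have hlt : β < ‖x‖ := hle.lt_of_ne fun h => hxs (mem_sphere_zero_iff_norm.2 h.symm)
    have ht := log_div_mem_Icc hβ hle hxR
    rw [(ha1 _ ht).1, (ha1 _ ht).2]
    have hl0 : (0 : ℝ) < l := by exact_mod_cast hl
    have : (l : ℝ) ^ 2 / ‖x‖ ^ 2 < l ^ 2 / β ^ 2 :=
      div_lt_div_of_pos_left (by positivity) (by positivity) (by gcongr)
    simp only [one_pow, mul_one, ne_eq, OfNat.ofNat_ne_zero, not_false_eq_true, zero_pow, zero_add]
    linarith

/-- Eigenvalues of competitors different from the shell are strictly below the first eigenvalue of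
the mode `i / 2` on the shell. -/
theorem exists_tau_le_lt {h : WithTop ℝ} {α β : ℝ} (hα : 0 < α) (hαβ : α < β) {Ω : Set Plane}
    (hΩ : IsBoundedLipschitzDomain Ω) (hΩα : ∀ x ∈ Ω, α < ‖x‖) {q : ℕ}
    (hsym : SymmetricOfOrder q Ω) (hvol : volume (shell α β) = volume Ω) (hne : Ω ≠ shell α β)
    {i : ℕ} (hi : 2 ≤ i) (hiq : i ≤ q) {μ K : ℝ} (hK : ∀ r : ℝ, h = r → K = r) {u v : ℝ → ℝ}
    (hs : ModeSol (i / 2 : ℕ) (μ * β ^ 2) (Real.log (β / α)) u v)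
    (hu : ∀ t ∈ Ico 0 (Real.log (β / α)), 0 < u t)
    (hu' : ∀ t ∈ Icc 0 (Real.log (β / α)), 0 ≤ u t)
    (htop : h = ⊤ → u (Real.log (β / α)) = 0)
    (hbc : u (Real.log (β / α)) * (v (Real.log (β / α)) + K * α * u (Real.log (β / α))) = 0) :
    ∃ μ' < μ, tau i h α Ω ≤ (μ' : EReal) := by
  have hβ := hα.trans hαβ
  set L := Real.log (β / α) with hLdef
  have hL : 0 < L := Real.log_pos ((one_lt_div hα).2 hαβ)
  obtain ⟨R, hR⟩ : ∃ R, β < R ∧ Ω ⊆ Metric.ball 0 R := by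
    obtain ⟨R₀, hR₀⟩ := hΩ.isBounded.subset_ball 0
    exact ⟨max R₀ (β + 1), lt_max_of_lt_right (by linarith),
      hR₀.trans (Metric.ball_subset_ball (le_max_left _ _))⟩
  have hΩs : ∀ x ∈ Ω, α < ‖x‖ ∧ ‖x‖ < R := fun x hx =>
    ⟨hΩα x hx, by simpa using hR.2 hx⟩
  have hpos : 0 < volume (Ω \ shell α β) := pos_iff_ne_zero.2 fun h0 =>
    hne (eq_shell_of_volume_diff_eq_zero hΩ.isOpen hα hαβ hΩα hΩ.lipschitz hvol h0)
  obtain ⟨a, haC, has, hau, ha1⟩ := hs.exists_profile hL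
    (Real.log_pos ((one_lt_div hβ).2 hR.1))
  have hlt := profileForm_lt hα hαβ hΩ.isOpen hΩs hvol hpos haC (by omega : 1 ≤ i / 2) hs hu hu' hau ha1
  rw [profileForm_shell hα hαβ haC hs hau] at hlt
  have haL := (hau L ⟨hL.le, le_rfl⟩).1
  set D := ∫ x in Ω, a (Real.log (β / ‖x‖)) ^ 2 with hD
  have hD0 : 0 ≤ D := integral_nonneg fun x => sq_nonneg _
  have hDi : IntegrableOn (fun x : Plane => a (Real.log (β / ‖x‖)) ^ 2) Ω :=
    integrableOn_of_continuousAt hα hΩs fun x hx =>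
      ContinuousAt.comp (f := fun x : Plane => ‖x‖)
        ((continuousAt_comp_log_div hβ haC.continuous (norm_ne_zero_iff.2 hx)).pow 2)
        continuous_norm.continuousAt
  set J := profileForm β a (i / 2) μ Ω + 2 * Real.pi * (K * α) * a L ^ 2 with hJ
  have hJneg : J < 0 := by
    rw [hJ, haL]
    have : 2 * Real.pi * (u L * v L) + 2 * Real.pi * (K * α) * u L ^ 2 =
      2 * Real.pi * (u L * (v L + K * α * u L)) := by ring
    rw [hbc] at this
    linarith
  -- The strict gap `J < 0` pays for lowering `μ` by `δ`, which raises the averaged form by `δ D`;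
  -- the added 1 avoids having to know `D > 0`.
  set δ := -J / (D + 1) with hδ
  have hδ0 : 0 < δ := div_pos (by linarith) (by linarith)
  have hδD : δ * D ≤ -J := by
    have : δ * (D + 1) = -J := by rw [hδ]; field_simp
    nlinarith
  refine ⟨μ - δ, by linarith, ?_⟩
  have hshift : profileForm β a (i / 2) (μ - δ) Ω = profileForm β a (i / 2) μ Ω + δ * D := by
    rw [profileForm, profileForm, hD, ← integral_const_mul,
      ← integral_add (integrableOn_profile hα hβ hΩs haC _ μ) (hDi.const_mul δ)]
    refine integral_congr_ae (Filter.Eventually.of_forall fun x => ?_)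
    simp only
    ring
  refine tau_le_of_profileForm_nonpos hα hαβ hΩ.isOpen hΩs hΩ.isConnected.nonempty hsym hi hiq haC
    has (fun x hx => ?_) hK (fun ht => by rw [← hLdef, haL, htop ht]) (by rw [hshift]; linarith)
  obtain ⟨hxα, hxR⟩ := hΩs x hx
  rcases lt_or_ge ‖x‖ β with hxβ | hxβ
  · have ht := log_div_mem_Ioo hα hxα hxβ
    rw [(hau _ (Ioo_subset_Icc_self ht)).1]
    exact hu _ (Ioo_subset_Ico_self ht)
  · rw [(ha1 _ (log_div_mem_Icc hβ hxβ hxR)).1]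
    exact one_pos

/-! ### The sharp bound -/

/-- The sharp bound follows if the one-dimensional form of the modes with a positive solution is
nonnegative on a hyperplane. -/
theorem sharpBound_of_nonnegOnHyperplane {h : WithTop ℝ} {α β : ℝ} (hα : 0 < α) (hαβ : α < β)
    {κ : ℕ} {Ωout : Set Plane} (hc : IsCompetitor κ α β Ωout) {i : ℕ} (hi : 2 ≤ i)
    (hiq : i ≤ 2 ^ κ)
    (H : ∀ (m : ℝ) (u v : ℝ → ℝ), ModeSol (i / 2 : ℕ) m (Real.log (β / α)) u v →
      (∀ t ∈ Icc 0 (Real.log (β / α)), 0 < u t) →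
      (∀ r : ℝ, h = r → 0 ≤ v (Real.log (β / α)) + r * α * u (Real.log (β / α))) →
      ∃ η, (∀ r : ℝ, h = r → η ≤ r * α) ∧ NonnegOnHyperplane m η (Real.log (β / α))) :
    SharpBound i h α β (Ωout \ Metric.closedBall 0 α) := by
  have hβ := hα.trans hαβ
  set Ω := Ωout \ Metric.closedBall 0 α with hΩdef
  by_cases hΩ : Ω = shell α β
  · rw [hΩ]
    exact ⟨le_rfl, by simp⟩
  set L := Real.log (β / α) with hLdef
  have hL : 0 < L := Real.log_pos ((one_lt_div hα).2 hαβ)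
  have hpi := Real.pi_pos
  -- Since `tan ψ = -v / u`, the condition at the inner circle reads `ψ(L) = arctan (h α)`, with
  -- `π/2` for Dirichlet.
  obtain ⟨τ, hτ, hτtop, hτr⟩ : ∃ τ ∈ Ioc (-(Real.pi / 2)) (Real.pi / 2),
      (h = ⊤ → τ = Real.pi / 2) ∧ ∀ r : ℝ, h = r → τ = Real.arctan (r * α) := by
    induction h using WithTop.recTopCoe with
    | top => exact ⟨Real.pi / 2, ⟨by linarith, le_rfl⟩, fun _ => rfl, by simp⟩
    | coe r =>
      refine ⟨Real.arctan (r * α), ⟨Real.neg_pi_div_two_lt_arctan _,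
        (Real.arctan_lt_pi_div_two _).le⟩, by simp, fun r' hr' => ?_⟩
      rw [WithTop.coe_eq_coe.1 hr']
  obtain ⟨m, u, v, hs, hu, ⟨ρ, hρ, huL, hvL⟩, hm⟩ := exists_first_eigenpair hL ((i / 2 : ℕ) : ℝ) hτ
  set μ := m / β ^ 2 with hμ
  have hμm : μ * β ^ 2 = m := by rw [hμ]; field_simp
  have huL0 : 0 ≤ u L := by
    rw [huL]
    exact mul_nonneg hρ.le (Real.cos_nonneg_of_mem_Icc ⟨hτ.1.le, hτ.2⟩)
  have hu' : ∀ t ∈ Icc 0 L, 0 ≤ u t := fun t ht => by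
    rcases ht.2.eq_or_lt with rfl | hlt
    · exact huL0
    · exact (hu t ⟨ht.1, hlt⟩).le
  have htop : h = ⊤ → u L = 0 := fun ht => by rw [huL, hτtop ht, Real.cos_pi_div_two, mul_zero]
  have hbc : u L * (v L + h.untopD 0 * α * u L) = 0 := by
    induction h using WithTop.recTopCoe with
    | top => rw [htop rfl, zero_mul]
    | coe r =>
      have h1 : Real.sin τ = r * α * Real.cos τ := by
        have h2 : Real.tan τ = r * α := by rw [hτr r rfl, Real.tan_arctan]
        have h3 : 0 < Real.cos τ := by rw [hτr r rfl]; exact Real.cos_arctan_pos _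
        rw [← h2, Real.tan_mul_cos h3.ne']
      rw [WithTop.untopD_coe, huL, hvL, h1]
      ring
  have hvol := hc.volume_eq
  have hΩα : ∀ x ∈ Ω, α < ‖x‖ := fun x hx => by simpa using hx.2
  obtain ⟨μ', hμ', hle⟩ := exists_tau_le_lt hα hαβ hc.assumption.domain hΩα hc.symmetric hvol hΩ hi
    hiq (K := h.untopD 0) (fun r hr => by rw [hr, WithTop.untopD_coe]) (hμm ▸ hs) hu hu' htop hbc
  -- Working below `μ` gives a solution positive on all of `[0, L]`; at `μ` itself it vanishes at
  -- `L` in the Dirichlet case. The gap `μ' < μ` absorbs the loss.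
  have hge : ∀ ν < μ, (ν : EReal) ≤ tau i h α (shell α β) := fun ν hν => by
    have hνm : ν * β ^ 2 < m := by rw [← hμm]; gcongr
    have hang := hm _ hνm
    obtain ⟨u₁, v₁, hs₁, hpos₁, hv₁⟩ := exists_modeSol_of_pruferAngle_lt hL (hang.trans_le hτ.2)
    have hlow := neg_pi_div_two_lt_pruferAngle hL (pruferAngle_zero hL (i / 2 : ℕ) (ν * β ^ 2))
      (hasDerivAt_pruferAngle hL (i / 2 : ℕ) (ν * β ^ 2))
    have hu₁ := hpos₁ L ⟨hL.le, le_rfl⟩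
    have hrobin : ∀ r : ℝ, h = r → 0 ≤ v₁ L + r * α * u₁ L := fun r hr => by
      have h1 : Real.tan (pruferAngle hL (i / 2 : ℕ) (ν * β ^ 2) L) < r * α := by
        have := Real.tan_lt_tan_of_lt_of_lt_pi_div_two hlow
          (by rw [hτr r hr]; exact Real.arctan_lt_pi_div_two _) hang
        rwa [hτr r hr, Real.tan_arctan] at this
      rw [hv₁]
      nlinarith
    obtain ⟨η, hη, hN⟩ := H _ u₁ v₁ hs₁ hpos₁ hrobin
    induction h using WithTop.recTopCoe with
    | top =>
      -- The trace vanishes, so the boundary weight is free and is taken large enough for both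
      -- requirements.
      set ξ := max η (Real.tan (pruferAngle hL (i / 2 : ℕ) (ν * β ^ 2) L)) with hξ
      have e : ξ / α * α = ξ := by field_simp
      refine le_tau_shell hα hαβ (l := i / 2) (by omega) (by omega) (K := ξ / α) (by simp) hs₁
        hpos₁ ?_ ?_
      · rw [e, ← hLdef, hv₁]
        have := le_max_right η (Real.tan (pruferAngle hL (i / 2 : ℕ) (ν * β ^ 2) L))
        rw [← hξ] at this
        nlinarith
      · rw [e]
        exact hN.mono hL.le le_rfl (le_max_left _ _)
    | coe r =>
      exact le_tau_shell hα hαβ (l := i / 2) (by omega) (by omega) (K := r)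
        (fun r' hr' => WithTop.coe_eq_coe.1 hr') hs₁ hpos₁ (hrobin r rfl)
        (hN.mono hL.le le_rfl (hη r rfl))
  have hlt : tau i h α Ω < tau i h α (shell α β) := by
    obtain ⟨ν, h1, h2⟩ := exists_between hμ'
    exact hle.trans_lt ((EReal.coe_lt_coe_iff.2 h1).trans_le (hge ν h2))
  exact ⟨hlt.le, ⟨fun h => absurd h hlt.ne, fun h => absurd h hΩ⟩⟩

/-! ### The three parameter ranges -/

theorem div_two_le_two_pow {i κ : ℕ} (hi : i ≤ 2 ^ κ) : ((i / 2 : ℕ) : ℝ) ≤ 2 ^ κ := by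
  have : i / 2 ≤ 2 ^ κ := (Nat.div_le_self i 2).trans hi
  exact_mod_cast this

/-- Thin shells: the sharp bound for all boundary parameters. -/
theorem sharpBound_of_thin {h : WithTop ℝ} {α β : ℝ} (hα : 0 < α) (hαβ : α < β) {κ : ℕ}
    (hκ : 1 ≤ κ) (hthin : Real.log (β / α) ≤ 1 / (10 * 2 ^ κ)) {Ωout : Set Plane}
    (hc : IsCompetitor κ α β Ωout) {i : ℕ} (hi : 2 ≤ i) (hiq : i ≤ 2 ^ κ) :
    SharpBound i h α β (Ωout \ Metric.closedBall 0 α) := by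
  refine sharpBound_of_nonnegOnHyperplane hα hαβ hc hi hiq fun m u v hs hpos hrobin => ?_
  set L := Real.log (β / α) with hLdef
  have hL : 0 < L := Real.log_pos ((one_lt_div hα).2 hαβ)
  have huL := hpos L ⟨hL.le, le_rfl⟩
  rcases le_or_gt m 0 with hm | hm
  · exact ⟨(h.untopD 0) * α, fun r hr => by rw [hr, WithTop.untopD_coe],
      nonnegOnHyperplane_of_nonpos hL hm _⟩
  have hlN := div_two_le_two_pow hiq
  set l : ℝ := ((i / 2 : ℕ) : ℝ) with hl
  have hl0 : 0 ≤ l := Nat.cast_nonneg _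
  have hN2 : (2 : ℝ) ≤ 2 ^ κ := by
    calc (2 : ℝ) = 2 ^ 1 := (pow_one 2).symm
      _ ≤ 2 ^ κ := pow_le_pow_right₀ (by norm_num) hκ
  have hNL : 2 ^ κ * L ≤ 1 / 10 := by
    rw [le_div_iff₀ (by positivity)] at hthin
    linarith
  have hlL : l * L ≤ 1 / 10 := (mul_le_mul_of_nonneg_right hlN hL.le).trans hNL
  have hlL2 : l ^ 2 * L ^ 2 ≤ 1 / 100 := by
    have : 0 ≤ l * L := by positivity
    nlinarith
  have hL20 : L ≤ 1 / 20 := by nlinarith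
  have hexp : Real.exp (2 * L) ≤ 10 / 9 := by
    have h1 := Real.one_sub_le_exp_neg (2 * L)
    rw [Real.exp_neg] at h1
    have h2 : (9 : ℝ) / 10 ≤ (Real.exp (2 * L))⁻¹ := by linarith
    rw [le_inv_comm₀ (by norm_num) (Real.exp_pos _)] at h2
    linarith
  refine ⟨-(1 / L), fun r hr => ?_, nonnegOnHyperplane_of_small hL ?_ le_rfl⟩
  -- The Robin inequality gives `r α ≥ -v(L) / u(L) ≥ -l² L`, and `l L` is small.
  · have h1 := hs.v_le_mul_u hL.le hm.le hpos
    have h2 := hrobin r hr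
    have h3 : 0 ≤ (l ^ 2 * L + r * α) * u L := by linarith
    have h4 := nonneg_of_mul_nonneg_left h3 huL
    have h5 : l ^ 2 * L ≤ 1 / L := by
      rw [le_div_iff₀ hL]
      nlinarith
    linarith
  -- The bound reads `m L² ≤ e^{2L} (3 + l² L²)`, and for thin shells `10/9 · (3 + 1/100) ≤ 4`.
  · have h1 := hs.upper_bound hL hm.le hpos
    rw [le_div_iff₀ (by positivity)]
    have he : Real.exp (2 * L) * Real.exp (-2 * L) = 1 := by rw [← Real.exp_add]; simp
    have h2 : m * L ^ 2 * Real.exp (-2 * L) ≤ 3 + l ^ 2 * L ^ 2 := by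
      have h3 : (m * L ^ 2 * Real.exp (-2 * L)) * L ≤ (3 + l ^ 2 * L ^ 2) * L := by linarith
      exact le_of_mul_le_mul_right h3 hL
    have h3 : m * L ^ 2 = Real.exp (2 * L) * (m * L ^ 2 * Real.exp (-2 * L)) := by
      linear_combination (-(m * L ^ 2)) * he
    rw [h3]
    calc Real.exp (2 * L) * (m * L ^ 2 * Real.exp (-2 * L))
        ≤ 10 / 9 * (3 + 1 / 100) := by
          refine mul_le_mul hexp (by linarith) ?_ (by norm_num)
          have := Real.exp_pos (-2 * L)
          positivity
      _ ≤ 4 := by norm_num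

/-- The sharp bound for very negative boundary parameters. -/
theorem sharpBound_of_le {h : ℝ} {α β : ℝ} (hα : 0 < α) (hαβ : α < β) {κ : ℕ}
    (hh : h * α < -((2 ^ κ) ^ 2 * Real.log (β / α))) {Ωout : Set Plane}
    (hc : IsCompetitor κ α β Ωout) {i : ℕ} (hi : 2 ≤ i) (hiq : i ≤ 2 ^ κ) :
    SharpBound i h α β (Ωout \ Metric.closedBall 0 α) := by
  refine sharpBound_of_nonnegOnHyperplane hα hαβ hc hi hiq fun m u v hs hpos hrobin => ?_
  set L := Real.log (β / α) with hLdef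
  have hL : 0 < L := Real.log_pos ((one_lt_div hα).2 hαβ)
  have huL := hpos L ⟨hL.le, le_rfl⟩
  -- For `m > 0` the logarithmic derivative at `L` would be at most `l² L < -h α`, against the Robin
  -- inequality.
  have hm : m ≤ 0 := by
    by_contra! hm
    have h1 := hs.v_le_mul_u hL.le hm.le hpos
    have h2 := hrobin h rfl
    have h3 : 0 ≤ (((i / 2 : ℕ) : ℝ) ^ 2 * L + h * α) * u L := by linarith
    have h4 := nonneg_of_mul_nonneg_left h3 huL
    have h5 : ((i / 2 : ℕ) : ℝ) ^ 2 * L ≤ (2 ^ κ) ^ 2 * L := by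
      have := div_two_le_two_pow hiq
      gcongr
    linarith
  exact ⟨h * α, fun r hr => by rw [WithTop.coe_eq_coe.1 hr],
    nonnegOnHyperplane_of_nonpos hL hm _⟩

/-- The sharp bound for the first two modes and slightly negative boundary parameters. -/
theorem exists_sharpBound_of_ge {α β : ℝ} (hα : 0 < α) (hαβ : α < β) :
    ∃ h₂ : ℝ, h₂ < 0 ∧ ∀ h : WithTop ℝ, (h₂ : WithTop ℝ) ≤ h → ∀ (κ : ℕ) (Ωout : Set Plane),
      IsCompetitor κ α β Ωout → ∀ i : ℕ, 2 ≤ i → i ≤ 2 ^ κ → i ≤ 5 →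
        SharpBound i h α β (Ωout \ Metric.closedBall 0 α) := by
  set L := Real.log (β / α) with hLdef
  have hL : 0 < L := Real.log_pos ((one_lt_div hα).2 hαβ)
  have hpi := Real.pi_pos
  obtain ⟨M, f, g, hf, hfpos, ⟨ρ, hρ, hfL, -⟩, -⟩ := exists_first_eigenpair hL 2
    (τ := Real.pi / 2) ⟨by linarith, le_rfl⟩
  rw [Real.cos_pi_div_two, mul_zero] at hfL
  obtain ⟨c, hc, hN⟩ := hf.nonnegOnHyperplane_of_dirichlet hL hfpos hfL
  -- The constant `c` is the slack that the mode 0 still has at the first Dirichlet eigenvalue `M`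
  -- of the mode 2. For `i ≤ 5` the mode `i / 2` is at most 2, so `M` bounds every parameter `m`
  -- that admits a positive solution.
  refine ⟨-c / α, div_neg_of_neg_of_pos (by linarith) hα, fun h hh κ Ωout hcomp i hi hiq hi5 => ?_⟩
  refine sharpBound_of_nonnegOnHyperplane hα hαβ hcomp hi hiq fun m u v hs hpos _ => ?_
  have hl : ((i / 2 : ℕ) : ℝ) ^ 2 ≤ 2 ^ 2 := by
    have : i / 2 ≤ 2 := by omega
    have : ((i / 2 : ℕ) : ℝ) ≤ 2 := by exact_mod_cast this
    gcongr
  refine ⟨-c, fun r hr => ?_, hN.mono hL.le (hf.le_of_dirichlet hL hl hfL hs hpos) le_rfl⟩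
  rw [hr, WithTop.coe_le_coe, div_le_iff₀ hα] at hh
  exact hh

end

theorem theorem1p3 (β : ℝ) (hβ : 0 < β) :
    ∃ αt : ℕ → ℝ,
      (∀ κ : ℕ, 1 ≤ κ → αt κ ∈ Set.Ioo 0 β) ∧
      (∀ κ : ℕ, 1 ≤ κ → ∀ α ∈ Set.Ioo 0 β, ∃ hbar : WithTop ℝ,
        (αt κ ≤ α → hbar = ⊤) ∧
        ∀ h : WithTop ℝ, h ≤ hbar → ∀ Ωout : Set Plane, IsCompetitor κ α β Ωout →
          ∀ i : ℕ, 2 ≤ i → i ≤ 2 ^ κ →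
            SharpBound i h α β (Ωout \ Metric.closedBall 0 α)) ∧
      (∀ α ∈ Set.Ioo 0 (αt 2), ∃ h2 : ℝ, h2 < 0 ∧
        ∀ h : WithTop ℝ, (h2 : WithTop ℝ) ≤ h →
          (∀ κ : ℕ, κ = 1 ∨ κ = 2 → ∀ Ωout : Set Plane, IsCompetitor κ α β Ωout →
            ∀ i : ℕ, 2 ≤ i → i ≤ 2 ^ κ →
              SharpBound i h α β (Ωout \ Metric.closedBall 0 α)) ∧
          (∀ Ωout : Set Plane, IsCompetitor 3 α β Ωout →
            ∀ i : ℕ, 2 ≤ i → i ≤ 5 →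
              SharpBound i h α β (Ωout \ Metric.closedBall 0 α))) := by
  -- The thickness `log (β / α) = 1 / (10 · 2^κ)` up to which a shell counts as thin determines
  -- `α_κ`.
  refine ⟨fun κ => β * Real.exp (-(1 / (10 * 2 ^ κ))), fun κ _ => ⟨by positivity, ?_⟩, ?_, ?_⟩
  · have h1 : Real.exp (-(1 / (10 * 2 ^ κ))) < 1 := by
      rw [Real.exp_lt_one_iff, neg_lt_zero]
      positivity
    exact mul_lt_of_lt_one_right hβ h1
  · intro κ hκ α hα
    by_cases hthin : β * Real.exp (-(1 / (10 * 2 ^ κ))) ≤ α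
    · refine ⟨⊤, fun _ => rfl, fun h _ Ωout hc i hi hiq =>
        sharpBound_of_thin hα.1 hα.2 hκ ?_ hc hi hiq⟩
      rw [Real.log_le_iff_le_exp (div_pos hβ hα.1), div_le_iff₀ hα.1]
      rw [Real.exp_neg, ← div_eq_mul_inv, div_le_iff₀ (Real.exp_pos _)] at hthin
      linarith
    -- For thicker shells this choice gives `h α ≤ -(4^κ L + 1)`; the 1 makes the required
    -- inequality strict.
    · refine ⟨((-((2 ^ κ) ^ 2 * Real.log (β / α) + 1) / α : ℝ) : WithTop ℝ),
        fun h => absurd h hthin, fun h hh Ωout hc i hi hiq => ?_⟩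
      lift h to ℝ using ne_top_of_le_ne_top WithTop.coe_ne_top hh
      rw [WithTop.coe_le_coe, le_div_iff₀ hα.1] at hh
      exact sharpBound_of_le hα.1 hα.2 (by linarith) hc hi hiq
  · intro α hα
    have hαβ : α < β := hα.2.trans_le
      (mul_le_of_le_one_right hβ.le (Real.exp_le_one_iff.2 (neg_nonpos.2 (by positivity))))
    obtain ⟨h₂, hneg, H⟩ := exists_sharpBound_of_ge hα.1 hαβ
    refine ⟨h₂, hneg, fun h hh => ⟨fun κ hκ Ωout hc i hi hiq => H h hh κ Ωout hc i hi hiq ?_,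
      fun Ωout hc i hi hi5 => H h hh 3 Ωout hc i hi (hi5.trans (by norm_num)) hi5⟩⟩
    rcases hκ with rfl | rfl
    · exact hiq.trans (by norm_num)
    · exact hiq.trans (by norm_num)
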